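/- Let $\mathbf k$ be a field and let $\Gamma$ be a quiver with vertex set $I$ (possibly infinite), with finitely many arrows between any two vertices and no arrows $i\to i$. Write $h_{i,j}$ for the number of arrows $i\to j$, and put $Q_{i,i}=0$ and $Q_{i,j}(u,v)=(v-u)^{h_{i,j}}(u-v)^{h_{j,i}}$ for $i\neq j$. **KLR algebras.** For a dimension vector $\alpha=\sum_i d_i\alpha_i$ ($d_i\in\mathbb N$, finitely many nonzero) let $d=|\alpha|=\sum_i d_i$, and let $I^\alpha$ be the set of sequences $\mathbf i=(i_1,\dots,i_d)$ in $I$ in which each vertex $i$ occurs $d_i$ times. Let $s_r(\mathbf i)$ be $\mathbf i$ with the $r$-th and $(r+1)$-st entries exchanged. The KLR algebra $R_\alpha(\Gamma)$ is the unital $\mathbf k$-algebra with generators $e(\mathbf i)$ ($\mathbf i\in I^\alpha$), $x_1,\dots,x_d$, $\tau_1,\dots,\tau_{d-1}$ and relations: $e(\mathbf i)e(\mathbf j)=\delta_{\mathbf i,\mathbf j}e(\mathbf i)$; $\sum_{\mathbf i\in I^\alpha}e(\mathbf i)=1$; $x_re(\mathbf i)=e(\mathbf i)x_r$; $\tau_re(\mathbf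 i)=e(s_r(\mathbf i))\tau_r$; $x_rx_s=x_sx_r$; $\tau_rx_{r+1}e(\mathbf i)=(x_r\tau_r+\delta_{i_r,i_{r+1}})e(\mathbf i)$; $x_{r+1}\tau_re(\mathbf i)=(\tau_rx_r+\delta_{i_r,i_{r+1}})e(\mathbf i)$; $\tau_rx_s=x_s\tau_r$ if $s\ne r,r+1$; $\tau_r\tau_s=\tau_s\tau_r$ if $|r-s|>1$; $\tau_r^2e(\mathbf i)=Q_{i_r,i_{r+1}}(x_r,x_{r+1})e(\mathbf i)$; and $$(\tau_{r+1}\tau_r\tau_{r+1}-\tau_r\tau_{r+1}\tau_r)e(\mathbf i)=\begin{cases}\dfrac{Q_{i_r,i_{r+1}}(x_{r+2},x_{r+1})-Q_{i_r,i_{r+1}}(x_r,x_{r+1})}{x_{r+2}-x_r}\,e(\mathbf i)&\text{if }i_r=i_{r+2},\\0&\text{otherwise,}\end{cases}$$ where the quotient is taken in the polynomial ring before evaluation. (If $I$ is finite, $R_\alpha(\Gamma)$ is the block $e(\alpha)R_d(\Gamma)$, $e(\alpha)=\sum_{\mathbf i\in I^\alpha}e(\mathbf i)$, of the KLR algebra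 $R_d(\Gamma)$ of rank $d$, which has the same presentation with $I^d$ in place of $I^\alpha$.) **The doubled quiver.** Let $I=I_0\sqcup I_1$ be such that there are no arrows between vertices of $I_1$. The quiver $\overline\Gamma$ has the vertices $i^0$ for $i\in I_0$ and $i^1,i^2$ for $i\in I_1$, and the arrows: $i^0\to j^0$ for each arrow $i\to j$ with $i,j\in I_0$; $i^0\to j^1$ for each arrow $i\to j$ with $i\in I_0$, $j\in I_1$; $i^2\to j^0$ for each arrow $i\to j$ with $i\in I_1$, $j\in I_0$; and one arrow $i^1\to i^2$ for each $i\in I_1$. Let $\phi$ be the map on finite sequences, compatible with concatenation, that replaces an entry $i\in I_0$ by $i^0$ and an entry $i\in I_1$ by $i^1,i^2$. Let $\alpha\mapsto\overline\alpha$ be the additive map on dimension vectors with $\alpha_i\mapsto\alpha_{i^0}$ for $i\in I_0$ and $\alpha_i\mapsto\alpha_{i^1}+\alpha_{i^2}$ for $i\in I_1$; thus $\phi(I^\alpha)\subset\overline I^{\overline\alpha}$. **Balanced KLR algebras.** A sequence of vertices of $\overline\Gamma$ is *well-ordered* if each entry $i^1$ ($i\in I_1$) is immediately followed by $i^2$.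 It is *unordered* if some non-empty initial segment contains strictly more entries from $\{i^2:i\in I_1\}$ than from $\{i^1:i\in I_1\}$. Let $\mathbf e\in R_{\overline\alpha}(\overline\Gamma)$ be the sum of $e(\mathbf i)$ over the well-ordered $\mathbf i\in\overline I^{\overline\alpha}$, and put $$S_{\overline\alpha}(\overline\Gamma)=\mathbf eR_{\overline\alpha}(\overline\Gamma)\mathbf e\Big/\sum_{\mathbf i\in\overline I^{\overline\alpha}\text{ unordered}}\mathbf eR_{\overline\alpha}(\overline\Gamma)e(\mathbf i)R_{\overline\alpha}(\overline\Gamma)\mathbf e .$$ For $\mathbf i\in I^\alpha$ and $r\in[1,d]$ let $r'=r'_{\mathbf i}$ be one more than the length of $\phi(i_1,\dots,i_{r-1})$. Let $x_r^*=\sum_{\mathbf i\in I^\alpha}x_{r'}e(\phi(\mathbf i))$ and $\tau_r^*=\sum_{\mathbf i\in I^\alpha}\tau_r^*e(\phi(\mathbf i))$ in $S_{\overline\alpha}(\overline\Gamma)$, where $$\tau_r^*e(\phi(\mathbf i))=\begin{cases}\tau_{r'}e(\phi(\mathbf i))&\text{if }i_r,i_{r+1}\in I_0,\\ \tau_{r'}\tau_{r'+1}e(\phi(\mathbf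 i))&\text{if }i_r\in I_1,\ i_{r+1}\in I_0,\\ \tau_{r'+1}\tau_{r'}e(\phi(\mathbf i))&\text{if }i_r\in I_0,\ i_{r+1}\in I_1,\\ \tau_{r'+1}\tau_{r'+2}\tau_{r'}\tau_{r'+1}e(\phi(\mathbf i))&\text{if }i_r\neq i_{r+1}\text{ are both in }I_1,\\ -\tau_{r'+1}\tau_{r'+2}\tau_{r'}\tau_{r'+1}e(\phi(\mathbf i))&\text{if }i_r=i_{r+1}\in I_1.\end{cases}$$ **Theorem.** For every dimension vector $\alpha$ of $\Gamma$ there is an isomorphism of unital $\mathbf k$-algebras $\Phi_\alpha\colon R_\alpha(\Gamma)\to S_{\overline\alpha}(\overline\Gamma)$ such that, for all $\mathbf i\in I^\alpha$ and all $r$, $$e(\mathbf i)\mapsto e(\phi(\mathbf i)),\qquad x_re(\mathbf i)\mapsto x_r^*e(\phi(\mathbf i))=x_{r'}e(\phi(\mathbf i)),\qquad \tau_re(\mathbf i)\mapsto\tau_r^*e(\phi(\mathbf i)),$$ and hence $x_r\mapsto x_r^*$ and $\tau_r\mapsto\tau_r^*$. In particular, let $e\ge2$, let $A_{e-1}^{(1)}$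 be the cyclic quiver with vertices $0,\dots,e-1$ and one arrow $i\to i+1$ (modulo $e$) for each $i$, and let $k\in[0,e-1]$. For each dimension vector $\alpha=\sum_{i=0}^{e-1}d_i\alpha_i$ put $\overline\alpha=\sum_{i=0}^{k}d_i\alpha_i+\sum_{i=k+1}^{e}d_{i-1}\alpha_i$. Then $R_\alpha(A_{e-1}^{(1)})\simeq S_{\overline\alpha}(A_e^{(1)})$, where $S_{\overline\alpha}(A_e^{(1)})$ is defined as above with the vertices $k$ and $k+1$ of $A_e^{(1)}$ in the roles of the only $i^1$ and the only $i^2$. Consequently $R_\alpha(A_{e-1}^{(1)})$ is a subquotient of $R_{\overline\alpha}(A_e^{(1)})$, that is, a quotient of a (not necessarily unital) subalgebra of it. -/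

import Mathlib

open scoped BigOperators

universe u v w

/-! ## The polynomials attached to a quiver -/

/-- `h_{i,j}`: the number of arrows from `i` to `j`. -/
noncomputable def arrowCount {I : Type u} [Quiver.{v} I] (i j : I) : ℕ := Nat.card (i ⟶ j)

section QPolynomials

variable {I : Type u} [Quiver.{v} I] {A : Type w}

open Classical in
/-- `Q_{i,j}(a, b) = (b - a) ^ h_{i,j} * (a - b) ^ h_{j,i}` for `i ≠ j`, and `Q_{i,i} = 0`. -/
noncomputable def klrQ [Ring A] (i j : I) (a b : A) : A :=
  if i = j then 0 else (b - a) ^ arrowCount i j * (a - b) ^ arrowCount j i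

open Classical in
/-- The divided difference `(c - a)⁻¹ * (Q_{i,j}(c, b) - Q_{i,j}(a, b))`, written as a polynomial;
see `mul_klrDiff`. -/
noncomputable def klrDiff [Ring A] (i j : I) (a b c : A) : A :=
  if i = j then 0 else
    (-1) ^ arrowCount i j * ∑ m ∈ Finset.range (arrowCount i j + arrowCount j i),
      (c - b) ^ m * (a - b) ^ (arrowCount i j + arrowCount j i - 1 - m)

/-- The defining property of the divided difference. -/
theorem mul_klrDiff [CommRing A] (i j : I) (a b c : A) :
    (c - a) * klrDiff i j a b c = klrQ i j c b - klrQ i j a b := by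
  unfold klrDiff klrQ
  split_ifs with h
  · simp
  · have key := (Commute.all (c - b) (a - b)).mul_geom_sum₂
      (arrowCount i j + arrowCount j i)
    have h1 : (c - b) - (a - b) = c - a := by ring
    rw [h1] at key
    have e1 : (b - c) = (-1) * (c - b) := by ring
    have e2 : (b - a) = (-1) * (a - b) := by ring
    rw [mul_left_comm, key, e1, e2, mul_pow, mul_pow, mul_sub, pow_add, pow_add]
    ring

end QPolynomials

/-! ## KLR algebras -/

namespace KLR

/-- Generators: idempotents `e(i)` for `i ∈ S`, polynomial generators `x_r` (`r < d`) and
crossings `τ_r` (`r + 1 < d`); indices start at `0`. -/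
inductive Gen {I : Type u} (d : ℕ) (S : Set (Fin d → I)) : Type u
  | e (i : S)
  | x (r : Fin d)
  | tau (r : Fin (d - 1))

/-- The left position of the crossing `τ_r`. -/
def lo {d : ℕ} (r : Fin (d - 1)) : Fin d := ⟨r.1, by omega⟩

/-- The right position of the crossing `τ_r`. -/
def hi {d : ℕ} (r : Fin (d - 1)) : Fin d := ⟨r.1 + 1, by omega⟩

/-- The sequence `s_r(i)`, in which the entries of `i` at the two positions of `τ_r` are
exchanged. -/
def swapSeq {I : Type u} {d : ℕ} (r : Fin (d - 1)) (i : Fin d → I) : Fin d → I :=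
  i ∘ Equiv.swap (lo r) (hi r)

section Presentation

variable (k : Type w) [Field k] {I : Type u} [Quiver.{v} I] (d : ℕ) (S : Set (Fin d → I))

/-- The generator `e(i)` of the free algebra. -/
def genE (i : S) : FreeAlgebra k (Gen d S) := FreeAlgebra.ι k (Gen.e i)

/-- The generator `x_r` of the free algebra. -/
def genX (r : Fin d) : FreeAlgebra k (Gen d S) := FreeAlgebra.ι k (Gen.x r)

/-- The generator `τ_r` of the free algebra. -/
def genTau (r : Fin (d - 1)) : FreeAlgebra k (Gen d S) := FreeAlgebra.ι k (Gen.tau r)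

open Classical in
/-- The defining relations of the KLR algebra on the sequences in `S`. -/
inductive Rel [Fintype S] : FreeAlgebra k (Gen d S) → FreeAlgebra k (Gen d S) → Prop
  | e_mul_self (i : S) : Rel (genE k d S i * genE k d S i) (genE k d S i)
  | e_mul_ne (i j : S) (h : i ≠ j) : Rel (genE k d S i * genE k d S j) 0
  | sum_e : Rel (∑ i : S, genE k d S i) 1
  | x_e (r : Fin d) (i : S) :
      Rel (genX k d S r * genE k d S i) (genE k d S i * genX k d S r)
  | tau_e (r : Fin (d - 1)) (i j : S) (h : j.1 = swapSeq r i.1) :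
      Rel (genTau k d S r * genE k d S i) (genE k d S j * genTau k d S r)
  | x_x (r s : Fin d) :
      Rel (genX k d S r * genX k d S s) (genX k d S s * genX k d S r)
  | tau_x_hi (r : Fin (d - 1)) (i : S) :
      Rel (genTau k d S r * genX k d S (hi r) * genE k d S i)
        ((genX k d S (lo r) * genTau k d S r
          + (if i.1 (lo r) = i.1 (hi r) then 1 else 0)) * genE k d S i)
  | x_hi_tau (r : Fin (d - 1)) (i : S) :
      Rel (genX k d S (hi r) * genTau k d S r * genE k d S i)
        ((genTau k d S r * genX k d S (lo r)
          + (if i.1 (lo r) = i.1 (hi r) then 1 else 0)) * genE k d S i)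
  | tau_x (r : Fin (d - 1)) (s : Fin d) (h1 : s ≠ lo r) (h2 : s ≠ hi r) :
      Rel (genTau k d S r * genX k d S s) (genX k d S s * genTau k d S r)
  | tau_tau (r s : Fin (d - 1)) (h : r.1 + 1 < s.1) :
      Rel (genTau k d S r * genTau k d S s) (genTau k d S s * genTau k d S r)
  | tau_sq (r : Fin (d - 1)) (i : S) :
      Rel (genTau k d S r * genTau k d S r * genE k d S i)
        (klrQ (i.1 (lo r)) (i.1 (hi r)) (genX k d S (lo r)) (genX k d S (hi r))
          * genE k d S i)
  | braid (r s : Fin (d - 1)) (h : s.1 = r.1 + 1) (i : S) :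
      Rel ((genTau k d S s * genTau k d S r * genTau k d S s
          - genTau k d S r * genTau k d S s * genTau k d S r) * genE k d S i)
        ((if i.1 (lo r) = i.1 (hi s) then
            klrDiff (i.1 (lo r)) (i.1 (hi r))
              (genX k d S (lo r)) (genX k d S (hi r)) (genX k d S (hi s))
          else 0) * genE k d S i)

/-- The KLR algebra on a finite set `S` of sequences of length `d`, stable under permutations of
the positions. For `S = I^d` (with `I` finite) this is the KLR algebra `R_d` of rank `d`; for
`S = I^α` it is its block `R_α`, which makes sense for infinite `I` too. -/
def Alg [Fintype S] : Type (max u w) := RingQuot (Rel k d S)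

noncomputable instance [Fintype S] : Ring (Alg k d S) :=
  inferInstanceAs (Ring (RingQuot (Rel k d S)))

noncomputable instance [Fintype S] : Algebra k (Alg k d S) :=
  inferInstanceAs (Algebra k (RingQuot (Rel k d S)))

end Presentation

section Elements

variable (k : Type w) [Field k] {I : Type u} [Quiver.{v} I] {d : ℕ} {S : Set (Fin d → I)}
  [Fintype S]

/-- The idempotent `e(i)`. -/
noncomputable def e (i : S) : Alg k d S := RingQuot.mkAlgHom k (Rel k d S) (genE k d S i)

variable (S) in
/-- The element `x_r`. -/
noncomputable def x (r : Fin d) : Alg k d S := RingQuot.mkAlgHom k (Rel k d S) (genX k d S r)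

variable (S) in
/-- The element `τ_r`. -/
noncomputable def tau (r : Fin (d - 1)) : Alg k d S :=
  RingQuot.mkAlgHom k (Rel k d S) (genTau k d S r)

variable (S) in
/-- The element `x_n` for a natural number `n < d` (and `0` for other `n`, which are not used). -/
noncomputable def xAt (n : ℕ) : Alg k d S := if h : n < d then x k S ⟨n, h⟩ else 0

variable (S) in
/-- The element `τ_n` for a natural number `n < d - 1` (and `0` for other `n`, which are not
used). -/
noncomputable def tauAt (n : ℕ) : Alg k d S := if h : n < d - 1 then tau k S ⟨n, h⟩ else 0

open Classical in
/-- The sum of the idempotents `e(i)` over `i ∈ O`. -/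
noncomputable def eSum (O : Set S) : Alg k d S := ∑ i ∈ Finset.univ.filter (· ∈ O), e k i

theorem e_mul_self (i : S) : e k i * e k i = e k i := by
  have := RingQuot.mkAlgHom_rel k (Rel.e_mul_self (k := k) i)
  rwa [map_mul] at this

theorem e_mul_ne {i j : S} (h : i ≠ j) : e k i * e k j = 0 := by
  have := RingQuot.mkAlgHom_rel k (Rel.e_mul_ne (k := k) i j h)
  rwa [map_mul, map_zero] at this

theorem eSum_isIdempotentElem (O : Set S) : IsIdempotentElem (eSum k O) := by
  classical
  unfold IsIdempotentElem eSum
  rw [Finset.sum_mul_sum]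
  refine Finset.sum_congr rfl fun i hi => ?_
  rw [Finset.sum_eq_single i (fun j _ hj => e_mul_ne k (Ne.symm hj)) (fun h => absurd hi h)]
  exact e_mul_self k i

end Elements

end KLR

/-! ## Idempotent truncations as algebras -/

section Corner

variable {k : Type w} [Field k] {A : Type u} [Ring A] [Algebra k A] {ε : A}

/-- The element `ε a ε` of the idempotent truncation `ε A ε`. -/
def toCorner (hε : IsIdempotentElem ε) (a : A) : hε.Corner := ⟨ε * a * ε, a, rfl⟩

noncomputable instance cornerSMul (hε : IsIdempotentElem ε) : SMul k hε.Corner where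
  smul c a := ⟨c • a.1, by
    obtain ⟨b, hb⟩ := a.2
    exact ⟨c • b, by simp only [← hb, mul_smul_comm, smul_mul_assoc]⟩⟩

/-- The `k`-algebra structure of `ε A ε`, with unit `ε`. -/
noncomputable instance cornerAlgebra (hε : IsIdempotentElem ε) : Algebra k hε.Corner :=
  letI : Module k hε.Corner :=
    { one_smul := fun a => Subtype.ext (one_smul k a.1)
      mul_smul := fun c c' a => Subtype.ext (mul_smul c c' a.1)
      smul_zero := fun c => Subtype.ext (smul_zero c)
      smul_add := fun c a b => Subtype.ext (smul_add c a.1 b.1)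
      add_smul := fun c c' a => Subtype.ext (add_smul c c' a.1)
      zero_smul := fun a => Subtype.ext (zero_smul k a.1) }
  Algebra.ofModule
    (fun c a b => Subtype.ext (smul_mul_assoc c a.1 b.1))
    (fun c a b => Subtype.ext (mul_smul_comm c a.1 b.1))

end Corner

/-- `B` is a subquotient of the algebra `A`: a quotient of a (not necessarily unital) subalgebra
of `A`. -/
def IsSubquotientAlgebra (k : Type w) [Field k] (B : Type u) [Ring B] [Algebra k B]
    (A : Type v) [Ring A] [Algebra k A] : Prop :=
  ∃ (C : NonUnitalSubalgebra k A) (f : C →ₙₐ[k] B), Function.Surjective f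

namespace KLR

/-! ## Dimension vectors and the algebras `R_α` -/

/-- The set `I^α` of sequences of length `|α|` in which every vertex `i` occurs `α i` times. -/
def seqs {I : Type u} (α : I →₀ ℕ) : Set (Fin α.degree → I) :=
  {i | ∑ r, Finsupp.single (i r) 1 = α}

theorem seqs_finite {I : Type u} (α : I →₀ ℕ) : (seqs α).Finite := by
  classical
  refine (Set.Finite.pi' (t := fun _ : Fin α.degree => (α.support : Set I))
    (fun _ => α.support.finite_toSet)).subset ?_
  intro i hi r
  have hi' : ∑ r, Finsupp.single (i r) 1 = α := hi
  simp only [Finset.mem_coe, Finsupp.mem_support_iff]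
  rw [← hi', Finsupp.finsetSum_apply]
  refine (Finset.sum_pos' (fun _ _ => Nat.zero_le _) ⟨r, Finset.mem_univ r, ?_⟩).ne'
  simp

noncomputable instance {I : Type u} (α : I →₀ ℕ) : Fintype (seqs α) := (seqs_finite α).fintype

/-- The KLR algebra `R_α`. -/
abbrev Block (k : Type w) [Field k] {I : Type u} [Quiver.{v} I] (α : I →₀ ℕ) :
    Type (max u w) :=
  Alg k α.degree (seqs α)

/-! ## Balanced KLR algebras -/

section Balanced

/-- Let `one j` and `two j` (`j : J`) be chosen vertices. A sequence is well-ordered if each entry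
`one j` is immediately followed by `two j`. -/
def IsWellOrdered {V : Type u} {J : Type v} (one two : J → V) {d : ℕ} (i : Fin d → V) : Prop :=
  ∀ (a : Fin d) (j : J), i a = one j → ∃ h : a.1 + 1 < d, i ⟨a.1 + 1, h⟩ = two j

open Classical in
/-- A sequence is unordered if it has a non-empty initial segment that contains strictly more
vertices of the form `two j` than vertices of the form `one j`. -/
def IsUnordered {V : Type u} {J : Type v} (one two : J → V) {d : ℕ} (i : Fin d → V) : Prop :=
  ∃ r : Fin d,
    (Finset.univ.filter fun a : Fin d => a ≤ r ∧ i a ∈ Set.range one).card <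
      (Finset.univ.filter fun a : Fin d => a ≤ r ∧ i a ∈ Set.range two).card

variable (k : Type w) [Field k] {V : Type u} [Quiver.{v} V] {J : Type*}
  (one two : J → V)
  (β : V →₀ ℕ)

/-- The idempotent `𝐞`, the sum of `e(i)` over the well-ordered sequences `i`. -/
noncomputable def ordIdem : Block k β := eSum k {i : seqs β | IsWellOrdered one two i.1}

theorem ordIdem_isIdempotentElem : IsIdempotentElem (ordIdem k one two β) :=
  eSum_isIdempotentElem k _

/-- The truncation `𝐞 R_β 𝐞`. -/
abbrev OrdCorner : Type _ := (ordIdem_isIdempotentElem k one two β).Corner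

/-- The ideal `∑ 𝐞 R_β e(i) R_β 𝐞` of `𝐞 R_β 𝐞`, the sum being over the unordered sequences `i`. -/
noncomputable def unIdeal : TwoSidedIdeal (OrdCorner k one two β) :=
  TwoSidedIdeal.span
    {y | ∃ (i : seqs β) (a b : Block k β), IsUnordered one two i.1 ∧
      y = toCorner (ordIdem_isIdempotentElem k one two β) (a * e k i * b)}

/-- The balanced KLR algebra `S_β`. -/
def Balanced : Type _ := (unIdeal k one two β).ringCon.Quotient

noncomputable instance : Ring (Balanced k one two β) :=
  inferInstanceAs (Ring (unIdeal k one two β).ringCon.Quotient)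

noncomputable instance : Algebra k (Balanced k one two β) :=
  inferInstanceAs (Algebra k (unIdeal k one two β).ringCon.Quotient)

/-- The class in `S_β` of `𝐞 a 𝐞`; this is the class of `a` itself if `a ∈ 𝐞 R_β 𝐞`. -/
noncomputable def toBalanced (a : Block k β) : Balanced k one two β :=
  RingCon.toQuotient (c := (unIdeal k one two β).ringCon)
    (toCorner (ordIdem_isIdempotentElem k one two β) a)

end Balanced

end KLR

/-! ## The doubled quiver -/

/-- The vertices of the doubled quiver for the decomposition of `I` into `I₀ = I₁ᶜ` and `I₁`:
`i⁰` for `i ∈ I₀`, and `i¹`, `i²` for `i ∈ I₁`. -/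
inductive DoubledVertex (I : Type u) (I₁ : Set I) : Type u
  | zero (i : (I₁ᶜ : Set I))
  | one (i : I₁)
  | two (i : I₁)

namespace DoubledVertex

variable {I : Type u} [Quiver.{v} I] {I₁ : Set I}

/-- The arrows of the doubled quiver. -/
def Arrow : DoubledVertex I I₁ → DoubledVertex I I₁ → Type v
  | zero i, zero j => (i : I) ⟶ (j : I)
  | zero i, one j => (i : I) ⟶ (j : I)
  | two i, zero j => (i : I) ⟶ (j : I)
  | one i, two j => ULift.{v} (PLift (i = j))
  | _, _ => PEmpty

instance : Quiver.{v} (DoubledVertex I I₁) := ⟨Arrow⟩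

end DoubledVertex

section Doubling

variable {I : Type u} (I₁ : Set I)

open Classical in
/-- `φ(i)` for a vertex `i`: the sequence `(i⁰)` if `i ∈ I₀`, and `(i¹, i²)` if `i ∈ I₁`. -/
noncomputable def dblVertex (i : I) : List (DoubledVertex I I₁) :=
  if h : i ∈ I₁ then [.one ⟨i, h⟩, .two ⟨i, h⟩] else [.zero ⟨i, h⟩]

/-- The morphism of monoids `φ` on finite sequences. -/
noncomputable def dblList (l : List I) : List (DoubledVertex I I₁) := l.flatMap (dblVertex I₁)

/-- The additive map `φ` on dimension vectors, `α ↦ ᾱ`, with `α_i ↦ α_{i⁰}` for `i ∈ I₀` and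
`α_i ↦ α_{i¹} + α_{i²}` for `i ∈ I₁`. -/
noncomputable def dblDim (α : I →₀ ℕ) : DoubledVertex I I₁ →₀ ℕ :=
  α.sum fun i n => n • ((dblVertex I₁ i).map fun v => Finsupp.single v 1).sum

theorem dblDim_add (α β : I →₀ ℕ) : dblDim I₁ (α + β) = dblDim I₁ α + dblDim I₁ β :=
  Finsupp.sum_add_index' (by simp) (fun _ _ _ => add_smul _ _ _)

theorem dblList_weight (l : List I) :
    ((dblList I₁ l).map fun v => Finsupp.single v 1).sum
      = dblDim I₁ ((l.map fun i => Finsupp.single i 1).sum) := by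
  induction l with
  | nil => simp [dblList, dblDim]
  | cons a l ih =>
    have h1 : dblList I₁ (a :: l) = dblVertex I₁ a ++ dblList I₁ l := by simp [dblList]
    rw [h1, List.map_append, List.sum_append, ih, List.map_cons, List.sum_cons, dblDim_add]
    congr 1
    simp [dblDim]

theorem degree_weight {V : Type u} (l : List V) :
    ((l.map fun v => Finsupp.single v 1).sum : V →₀ ℕ).degree = l.length := by
  induction l with
  | nil => simp
  | cons a l ih => simp [ih, Nat.add_comm]

theorem weight_ofFn {α : I →₀ ℕ} (i : KLR.seqs α) :
    (((List.ofFn i.1).map fun i => Finsupp.single i 1).sum : I →₀ ℕ) = α := by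
  rw [List.map_ofFn, List.sum_ofFn]
  exact i.2

theorem dblList_length {α : I →₀ ℕ} (i : KLR.seqs α) :
    (dblList I₁ (List.ofFn i.1)).length = (dblDim I₁ α).degree := by
  rw [← degree_weight, dblList_weight, weight_ofFn]

/-- The map `φ : I^α → Ī^ᾱ`. -/
noncomputable def dblSeq {α : I →₀ ℕ} (i : KLR.seqs α) : KLR.seqs (dblDim I₁ α) :=
  ⟨fun a => (dblList I₁ (List.ofFn i.1)).get (Fin.cast (dblList_length I₁ i).symm a), by
    change ∑ a, _ = _
    conv_rhs => rw [← weight_ofFn i, ← dblList_weight]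
    rw [← Fin.sum_univ_fun_getElem (dblList I₁ (List.ofFn i.1)) (fun v => Finsupp.single v 1)]
    exact (finCongr (dblList_length I₁ i).symm).sum_comp
      (fun b => Finsupp.single ((dblList I₁ (List.ofFn i.1)).get b) 1)⟩

/-- The position `r'` in `φ(i)` (counted from `0`): the length of `φ` of the first `r` entries. -/
noncomputable def dblPos {α : I →₀ ℕ} (i : KLR.seqs α) (r : ℕ) : ℕ :=
  (dblList I₁ ((List.ofFn i.1).take r)).length

end Doubling

namespace KLR

section Star

variable (k : Type w) [Field k] {I : Type u} [Quiver.{v} I] (I₁ : Set I) (α : I →₀ ℕ)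

/-- The balanced KLR algebra `S_ᾱ` of the doubled quiver. -/
abbrev DoubledBalanced : Type _ :=
  Balanced k (DoubledVertex.one (I₁ := I₁)) (DoubledVertex.two (I₁ := I₁)) (dblDim I₁ α)

variable {α}

/-- `x_{r'} e(φ(i))` in `R_ᾱ`. -/
noncomputable def xStarAt (r : Fin α.degree) (i : seqs α) : Block k (dblDim I₁ α) :=
  xAt k _ (dblPos I₁ i r.1) * e k (dblSeq I₁ i)

open Classical in
/-- The product of crossings that replaces `τ_r e(i)`, times `e(φ(i))`, in `R_ᾱ`. -/
noncomputable def tauStarAt (r : Fin (α.degree - 1)) (i : seqs α) : Block k (dblDim I₁ α) :=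
  let p := dblPos I₁ i r.1
  let t : ℕ → Block k (dblDim I₁ α) := fun n => tauAt k _ n
  if i.1 (lo r) ∈ I₁ then
    if i.1 (hi r) ∈ I₁ then
      if i.1 (lo r) = i.1 (hi r) then
        -(t (p + 1) * t (p + 2) * t p * t (p + 1) * e k (dblSeq I₁ i))
      else
        t (p + 1) * t (p + 2) * t p * t (p + 1) * e k (dblSeq I₁ i)
    else
      t p * t (p + 1) * e k (dblSeq I₁ i)
  else
    if i.1 (hi r) ∈ I₁ then
      t (p + 1) * t p * e k (dblSeq I₁ i)
    else
      t p * e k (dblSeq I₁ i)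

/-- The class in `S_ᾱ` of an element of `R_ᾱ`, truncated by `𝐞` on both sides. -/
noncomputable abbrev cls (a : Block k (dblDim I₁ α)) : DoubledBalanced k I₁ α :=
  toBalanced k DoubledVertex.one DoubledVertex.two (dblDim I₁ α) a

/-- The element `x*_r` of `S_ᾱ`. -/
noncomputable def xStar (r : Fin α.degree) : DoubledBalanced k I₁ α :=
  ∑ i : seqs α, cls k I₁ (xStarAt k I₁ r i)

/-- The element `τ*_r` of `S_ᾱ`. -/
noncomputable def tauStar (r : Fin (α.degree - 1)) : DoubledBalanced k I₁ α :=
  ∑ i : seqs α, cls k I₁ (tauStarAt k I₁ r i)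

end Star

end KLR

/-! ## Cyclic quivers -/

/-- The vertices `0, …, n - 1` of the cyclic quiver of length `n`. -/
@[ext]
structure CyclicVertex (n : ℕ) where
  /-- The label of the vertex. -/
  val : Fin n

namespace CyclicVertex

instance (n : ℕ) : Finite (CyclicVertex n) :=
  Finite.of_injective CyclicVertex.val fun _ _ h => CyclicVertex.ext h

/-- The cyclic quiver of length `n`: one arrow `i → i + 1` (modulo `n`) for each vertex `i`. -/
instance (n : ℕ) : Quiver.{0} (CyclicVertex n) :=
  ⟨fun i j => PLift (j.val.1 = (i.val.1 + 1) % n)⟩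

/-- For `α = ∑ d_i α_i` on the cyclic quiver of length `n` and a vertex `m`, the dimension vector
`∑_{i ≤ m} d_i α_i + ∑_{i > m} d_{i-1} α_i` on the cyclic quiver of length `n + 1`. -/
noncomputable def bar {n : ℕ} (m : Fin n) (α : CyclicVertex n →₀ ℕ) :
    CyclicVertex (n + 1) →₀ ℕ :=
  Finsupp.equivFunOnFinite.symm fun j =>
    if h : j.val.1 ≤ m.1 then α ⟨⟨j.val.1, h.trans_lt m.2⟩⟩
    else α ⟨⟨j.val.1 - 1, by have := j.val.2; omega⟩⟩

/-- The balanced KLR algebra of the cyclic quiver of length `n + 1` with respect to the arrow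
`m → m + 1`. -/
abbrev BalancedAlg (k : Type w) [Field k] {n : ℕ} (m : Fin n) (α : CyclicVertex n →₀ ℕ) :
    Type w :=
  KLR.Balanced k (fun _ : Unit => (⟨m.castSucc⟩ : CyclicVertex (n + 1)))
    (fun _ : Unit => (⟨m.succ⟩ : CyclicVertex (n + 1))) (bar m α)

end CyclicVertex

namespace KLR

/-! ## Comparison with the blocks `e(α) R_d` for a finite vertex set -/

section Relations

variable (k : Type w) [Field k] {I : Type u} [Quiver.{v} I] {d : ℕ} {S : Set (Fin d → I)}
  [Fintype S]

/-- The quotient map from the free algebra to the KLR algebra. -/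
noncomputable def mk : FreeAlgebra k (Gen d S) →ₐ[k] Alg k d S := RingQuot.mkAlgHom k (Rel k d S)

theorem mk_rel {a b : FreeAlgebra k (Gen d S)} (h : Rel k d S a b) : mk k a = mk k b :=
  RingQuot.mkAlgHom_rel k h

theorem mk_genE (i : S) : mk k (genE k d S i) = e k i := rfl

theorem mk_genX (r : Fin d) : mk k (genX k d S r) = x k S r := rfl

theorem mk_genTau (r : Fin (d - 1)) : mk k (genTau k d S r) = tau k S r := rfl

theorem map_klrQ {A B : Type*} [Ring A] [Ring B] (f : A →+* B) (i j : I) (a b : A) :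
    f (klrQ i j a b) = klrQ i j (f a) (f b) := by
  unfold klrQ; split_ifs <;> simp

theorem map_klrDiff {A B : Type*} [Ring A] [Ring B] (f : A →+* B) (i j : I) (a b c : A) :
    f (klrDiff i j a b c) = klrDiff i j (f a) (f b) (f c) := by
  unfold klrDiff; split_ifs <;> simp

open Classical in
/-- The defining relations of the KLR algebra for elements of an algebra. -/
structure Relations {B : Type*} [Ring B] [Algebra k B] (E : S → B) (X : Fin d → B)
    (T : Fin (d - 1) → B) : Prop where
  e_mul_self (i : S) : E i * E i = E i
  e_mul_ne (i j : S) (h : i ≠ j) : E i * E j = 0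
  sum_e : ∑ i : S, E i = 1
  x_e (r : Fin d) (i : S) : X r * E i = E i * X r
  tau_e (r : Fin (d - 1)) (i j : S) (h : j.1 = swapSeq r i.1) : T r * E i = E j * T r
  x_x (r s : Fin d) : X r * X s = X s * X r
  tau_x_hi (r : Fin (d - 1)) (i : S) :
    T r * X (hi r) * E i
      = (X (lo r) * T r + (if i.1 (lo r) = i.1 (hi r) then 1 else 0)) * E i
  x_hi_tau (r : Fin (d - 1)) (i : S) :
    X (hi r) * T r * E i
      = (T r * X (lo r) + (if i.1 (lo r) = i.1 (hi r) then 1 else 0)) * E i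
  tau_x (r : Fin (d - 1)) (s : Fin d) (h1 : s ≠ lo r) (h2 : s ≠ hi r) : T r * X s = X s * T r
  tau_tau (r s : Fin (d - 1)) (h : r.1 + 1 < s.1) : T r * T s = T s * T r
  tau_sq (r : Fin (d - 1)) (i : S) :
    T r * T r * E i = klrQ (i.1 (lo r)) (i.1 (hi r)) (X (lo r)) (X (hi r)) * E i
  braid (r s : Fin (d - 1)) (h : s.1 = r.1 + 1) (i : S) :
    (T s * T r * T s - T r * T s * T r) * E i
      = (if i.1 (lo r) = i.1 (hi s) then
          klrDiff (i.1 (lo r)) (i.1 (hi r)) (X (lo r)) (X (hi r)) (X (hi s)) else 0) * E i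

theorem relations_alg : Relations k (e k (S := S)) (x k S) (tau k S) := by
  classical
  constructor
  · intro i; simpa [mk_genE, mk_genX, mk_genTau] using mk_rel k (Rel.e_mul_self i)
  · intro i j h; simpa [mk_genE, mk_genX, mk_genTau] using mk_rel k (Rel.e_mul_ne i j h)
  · simpa [mk_genE, mk_genX, mk_genTau] using mk_rel k (Rel.sum_e (S := S))
  · intro r i; simpa [mk_genE, mk_genX, mk_genTau] using mk_rel k (Rel.x_e r i)
  · intro r i j h; simpa [mk_genE, mk_genX, mk_genTau] using mk_rel k (Rel.tau_e r i j h)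
  · intro r s; simpa [mk_genE, mk_genX, mk_genTau] using mk_rel k (Rel.x_x (S := S) r s)
  · intro r i
    have := mk_rel k (Rel.tau_x_hi r i)
    rw [map_mul, map_mul, map_mul, map_add, map_mul, apply_ite (mk k), map_one, map_zero] at this
    exact this
  · intro r i
    have := mk_rel k (Rel.x_hi_tau r i)
    rw [map_mul, map_mul, map_mul, map_add, map_mul, apply_ite (mk k), map_one, map_zero] at this
    exact this
  · intro r s h1 h2; simpa [mk_genE, mk_genX, mk_genTau] using mk_rel k (Rel.tau_x (S := S) r s h1 h2)
  · intro r s h; simpa [mk_genE, mk_genX, mk_genTau] using mk_rel k (Rel.tau_tau (S := S) r s h)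
  · intro r i
    have := mk_rel k (Rel.tau_sq r i)
    rw [map_mul, map_mul, map_mul] at this
    exact this.trans (congrArg (· * _) (map_klrQ (mk k).toRingHom _ _ _ _))
  · intro r s h i
    have := mk_rel k (Rel.braid r s h i)
    rw [map_mul, map_mul, map_sub, map_mul, map_mul, map_mul, map_mul, apply_ite (mk k),
      map_zero] at this
    refine this.trans (congrArg (· * _) ?_)
    split_ifs
    · exact map_klrDiff (mk k).toRingHom _ _ _ _ _
    · rfl

variable {k} in
theorem exists_lift {B : Type*} [Ring B] [Algebra k B] {E : S → B} {X : Fin d → B}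
    {T : Fin (d - 1) → B} (h : Relations k E X T) :
    ∃ f : Alg k d S →ₐ[k] B, (∀ i, f (e k i) = E i) ∧ (∀ r, f (x k S r) = X r) ∧
      ∀ r, f (tau k S r) = T r := by
  classical
  let F : FreeAlgebra k (Gen d S) →ₐ[k] B := FreeAlgebra.lift k fun g => match g with
    | .e i => E i
    | .x r => X r
    | .tau r => T r
  have hE : ∀ i, F (genE k d S i) = E i := fun i => FreeAlgebra.lift_ι_apply _ _
  have hX : ∀ i, F (genX k d S i) = X i := fun i => FreeAlgebra.lift_ι_apply _ _
  have hT : ∀ i, F (genTau k d S i) = T i := fun i => FreeAlgebra.lift_ι_apply _ _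
  have hF : ∀ ⦃a b⦄, Rel k d S a b → F a = F b := by
    intro a b hab
    cases hab with
    | e_mul_self i => simpa [hE] using h.e_mul_self i
    | e_mul_ne i j hij => simpa [hE] using h.e_mul_ne i j hij
    | sum_e => simpa [hE] using h.sum_e
    | x_e r i => simpa [hE, hX] using h.x_e r i
    | tau_e r i j hij => simpa [hE, hT] using h.tau_e r i j hij
    | x_x r s => simpa [hX] using h.x_x r s
    | tau_x_hi r i =>
      rw [map_mul, map_mul, map_mul, map_add, map_mul, apply_ite F, map_one, map_zero, hE, hX,
        hX, hT]
      exact h.tau_x_hi r i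
    | x_hi_tau r i =>
      rw [map_mul, map_mul, map_mul, map_add, map_mul, apply_ite F, map_one, map_zero, hE, hX,
        hX, hT]
      exact h.x_hi_tau r i
    | tau_x r s h1 h2 => simpa [hX, hT] using h.tau_x r s h1 h2
    | tau_tau r s hrs => simpa [hT] using h.tau_tau r s hrs
    | tau_sq r i =>
      have hq := map_klrQ F.toRingHom (i.1 (lo r)) (i.1 (hi r)) (genX k d S (lo r))
        (genX k d S (hi r))
      simp only [AlgHom.toRingHom_eq_coe, RingHom.coe_coe, hX] at hq
      rw [map_mul, map_mul, map_mul, hq, hE, hT]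
      exact h.tau_sq r i
    | braid r s hrs i =>
      have hq := map_klrDiff F.toRingHom (i.1 (lo r)) (i.1 (hi r)) (genX k d S (lo r))
        (genX k d S (hi r)) (genX k d S (hi s))
      simp only [AlgHom.toRingHom_eq_coe, RingHom.coe_coe, hX] at hq
      rw [map_mul, map_mul, map_sub, map_mul, map_mul, map_mul, map_mul, apply_ite F, map_zero,
        hq, hE, hT, hT]
      exact h.braid r s hrs i
  refine ⟨RingQuot.liftAlgHom k ⟨F, hF⟩, fun i => ?_, fun r => ?_, fun r => ?_⟩
  · exact (RingQuot.liftAlgHom_mkAlgHom_apply k F hF _).trans (hE i)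
  · exact (RingQuot.liftAlgHom_mkAlgHom_apply k F hF _).trans (hX r)
  · exact (RingQuot.liftAlgHom_mkAlgHom_apply k F hF _).trans (hT r)

theorem hom_ext {B : Type*} [Ring B] [Algebra k B] {f g : Alg k d S →ₐ[k] B}
    (he : ∀ i, f (e k i) = g (e k i)) (hx : ∀ r, f (x k S r) = g (x k S r))
    (ht : ∀ r, f (tau k S r) = g (tau k S r)) : f = g := by
  refine RingQuot.ringQuot_ext' (S := k) (s := Rel k d S) f g
    (FreeAlgebra.hom_ext (funext fun a => ?_))
  cases a
  · exact he _
  · exact hx _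
  · exact ht _

variable {k} in
theorem alg_induction {P : Alg k d S → Prop} (he : ∀ i, P (e k i)) (hx : ∀ r, P (x k S r))
    (ht : ∀ r, P (tau k S r)) (hc : ∀ c : k, P (algebraMap k _ c))
    (ha : ∀ a b, P a → P b → P (a + b)) (hm : ∀ a b, P a → P b → P (a * b)) (a : Alg k d S) :
    P a := by
  obtain ⟨b, rfl⟩ := RingQuot.mkAlgHom_surjective k (Rel k d S) a
  change P (mk k b)
  induction b with
  | grade0 c => simpa using hc c
  | grade1 g =>
    cases g
    · exact he _
    · exact hx _
    · exact ht _
  | mul a b iha ihb => simpa using hm _ _ iha ihb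
  | add a b iha ihb => simpa using ha _ _ iha ihb

end Relations

section Comparison

variable (k : Type w) [Field k] {I : Type u} [Quiver.{v} I]

/-- The KLR algebra `R_d` of rank `d` of a quiver with finitely many vertices. -/
abbrev Rank (I : Type u) [Quiver.{v} I] (d : ℕ) [Fintype (Set.univ : Set (Fin d → I))] :
    Type (max u w) :=
  Alg k d (Set.univ : Set (Fin d → I))

variable (α : I →₀ ℕ) [Fintype (Set.univ : Set (Fin α.degree → I))]

/-- The idempotent `e(α)` of `R_d`, where `d = |α|`. -/
noncomputable abbrev eDim : Rank k I α.degree := eSum k {i | i.1 ∈ seqs α}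

theorem eDim_idem : IsIdempotentElem (eDim k α) := eSum_isIdempotentElem k _

theorem swapSeq_mem {V : Type u} {α : V →₀ ℕ} {r : Fin (α.degree - 1)} {i : Fin α.degree → V} :
    swapSeq r i ∈ seqs α ↔ i ∈ seqs α := by
  change (∑ a, Finsupp.single (i (Equiv.swap (lo r) (hi r) a)) 1 = α) ↔ (∑ a, _ = α)
  rw [Equiv.sum_comp (Equiv.swap (lo r) (hi r)) (fun r => Finsupp.single (i r) 1)]

theorem swapSeq_swapSeq {V : Type u} {d : ℕ} (r : Fin (d - 1)) (i : Fin d → V) :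
    swapSeq r (swapSeq r i) = i := by
  funext a; simp [swapSeq]

theorem eSum_mul_e {d : ℕ} {S : Set (Fin d → I)} [Fintype S] (O : Set S) (i : S)
    [Decidable (i ∈ O)] :
    eSum k O * e k i = if i ∈ O then e k i else 0 := by
  classical
  unfold eSum
  rw [Finset.sum_mul]
  split_ifs with h
  · rw [Finset.sum_eq_single i (fun j _ hj => e_mul_ne k hj) (fun h' => by simp [h] at h')]
    exact e_mul_self k i
  · refine Finset.sum_eq_zero fun j hj => e_mul_ne k ?_
    rintro rfl
    simp [h] at hj

theorem e_mul_eSum {d : ℕ} {S : Set (Fin d → I)} [Fintype S] (O : Set S) (i : S)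
    [Decidable (i ∈ O)] :
    e k i * eSum k O = if i ∈ O then e k i else 0 := by
  classical
  unfold eSum
  rw [Finset.mul_sum]
  split_ifs with h
  · rw [Finset.sum_eq_single i (fun j _ hj => e_mul_ne k hj.symm) (fun h' => by simp [h] at h')]
    exact e_mul_self k i
  · refine Finset.sum_eq_zero fun j hj => e_mul_ne k ?_
    rintro rfl
    simp [h] at hj

/-- The idempotent `e(α)` is central in `R_d`. -/
theorem eDim_commute (a : Rank k I α.degree) : Commute (eDim k α) a := by
  classical
  induction a using alg_induction with
  | he i => exact (eSum_mul_e k _ i).trans (e_mul_eSum k _ i).symm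
  | hx r =>
    change eSum _ _ * _ = _ * eSum _ _
    unfold eSum
    rw [Finset.sum_mul, Finset.mul_sum]
    exact Finset.sum_congr rfl fun i _ => ((relations_alg k).x_e r i).symm
  | ht r =>
    change eSum _ _ * _ = _ * eSum _ _
    unfold eSum
    rw [Finset.sum_mul, Finset.mul_sum]
    refine Finset.sum_bij' (fun i _ => ⟨swapSeq r i.1, trivial⟩)
      (fun i _ => ⟨swapSeq r i.1, trivial⟩) ?_ ?_ ?_ ?_ ?_
    · intro i hi
      simpa [swapSeq_mem] using hi
    · intro i hi
      simpa [swapSeq_mem] using hi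
    · intro i _; exact Subtype.ext (swapSeq_swapSeq r _)
    · intro i _; exact Subtype.ext (swapSeq_swapSeq r _)
    · intro i _
      exact ((relations_alg k (S := Set.univ)).tau_e r ⟨swapSeq r i.1, trivial⟩ i
        (swapSeq_swapSeq r _).symm).symm
  | hc c => exact (Algebra.commutes c _).symm
  | ha a b ha hb => exact ha.add_right hb
  | hm a b ha hb => exact ha.mul_right hb

/-- Compression `a ↦ e(α) a e(α)` is a homomorphism of algebras since `e(α)` is central. -/
noncomputable def compress : Rank k I α.degree →ₐ[k] (eDim_idem k α).Corner :=
  have hid := eDim_idem k α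
  have hval : ∀ a : Rank k I α.degree, eDim k α * a * eDim k α = eDim k α * a := fun a => by
    rw [mul_assoc, ← (eDim_commute k α a).eq, ← mul_assoc, hid.eq]
  AlgHom.ofLinearMap
    { toFun := toCorner (eDim_idem k α)
      map_add' := fun a b => Subtype.ext (by
        change eDim k α * (a + b) * eDim k α = eDim k α * a * eDim k α + eDim k α * b * eDim k α
        rw [mul_add, add_mul])
      map_smul' := fun c a => Subtype.ext (by
        change eDim k α * (c • a) * eDim k α = c • (eDim k α * a * eDim k α)
        rw [mul_smul_comm, smul_mul_assoc]) }
    (Subtype.ext (by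
      change eDim k α * 1 * eDim k α = eDim k α
      rw [mul_one, hid.eq]))
    (fun a b => Subtype.ext (by
      change eDim k α * (a * b) * eDim k α
        = (eDim k α * a * eDim k α) * (eDim k α * b * eDim k α)
      rw [hval, hval, hval, (eDim_commute k α a).eq, mul_assoc a, ← mul_assoc (eDim k α) (eDim k α),
        hid.eq, ← mul_assoc, ← mul_assoc, (eDim_commute k α a).eq]))

theorem compress_apply (a : Rank k I α.degree) :
    compress k α a = toCorner (eDim_idem k α) a := rfl

theorem compress_val (a : Rank k I α.degree) :
    (compress k α a).1 = eDim k α * a * eDim k α := rfl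

theorem relations_compress :
    Relations k (fun i : seqs α => compress k α (e k ⟨i.1, trivial⟩))
      (fun r => compress k α (x k _ r)) (fun r => compress k α (tau k _ r)) := by
  classical
  have R := relations_alg k (S := (Set.univ : Set (Fin α.degree → I)))
  set θ := compress k α with hθ
  refine ⟨?_, ?_, ?_, ?_, ?_, ?_, ?_, ?_, ?_, ?_, ?_, ?_⟩
  · intro i; rw [← map_mul, R.e_mul_self]
  · intro i j h
    rw [← map_mul, R.e_mul_ne _ _ (fun h' => h (Subtype.ext (congrArg (·.1) h'))), map_zero]
  · rw [← map_sum]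
    have h1 : ∑ i : seqs α, e k (⟨i.1, trivial⟩ : (Set.univ : Set (Fin α.degree → I)))
        = eDim k α := by
      unfold eDim eSum
      refine Finset.sum_bij (fun i _ => ⟨i.1, trivial⟩) ?_ ?_ ?_ ?_
      · intro i _; simp
      · intro i _ j _ h; exact Subtype.ext (congrArg (·.1) h)
      · intro j hj
        exact ⟨⟨j.1, by simpa using hj⟩, Finset.mem_univ _, rfl⟩
      · intro i _; rfl
    rw [h1]
    refine Subtype.ext ?_
    change eDim k α * eDim k α * eDim k α = eDim k α
    rw [(eDim_idem k α).eq, (eDim_idem k α).eq]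
  · intro r i; rw [← map_mul, ← map_mul, R.x_e]
  · intro r i j h; rw [← map_mul, ← map_mul, R.tau_e r ⟨i.1, trivial⟩ ⟨j.1, trivial⟩ h]
  · intro r s; rw [← map_mul, ← map_mul, R.x_x]
  · intro r i
    have := congrArg θ (R.tau_x_hi r ⟨i.1, trivial⟩)
    rwa [map_mul, map_mul, map_mul, map_add, map_mul, apply_ite θ, map_one, map_zero] at this
  · intro r i
    have := congrArg θ (R.x_hi_tau r ⟨i.1, trivial⟩)
    rwa [map_mul, map_mul, map_mul, map_add, map_mul, apply_ite θ, map_one, map_zero] at this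
  · intro r s h1 h2; rw [← map_mul, ← map_mul, R.tau_x r s h1 h2]
  · intro r s h; rw [← map_mul, ← map_mul, R.tau_tau r s h]
  · intro r i
    have := congrArg θ (R.tau_sq r ⟨i.1, trivial⟩)
    have hq := fun i j a b => map_klrQ (I := I) θ.toRingHom i j a b
    simp only [AlgHom.toRingHom_eq_coe, RingHom.coe_coe] at hq
    rwa [map_mul, map_mul, map_mul, hq] at this
  · intro r s h i
    have := congrArg θ (R.braid r s h ⟨i.1, trivial⟩)
    have hq := fun i j a b c => map_klrDiff (I := I) θ.toRingHom i j a b c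
    simp only [AlgHom.toRingHom_eq_coe, RingHom.coe_coe] at hq
    rwa [map_mul, map_mul, map_sub, map_mul, map_mul, map_mul, map_mul, apply_ite θ, map_zero,
      hq] at this

open Classical in
/-- `e(i)` in `R_α` if `i` lies in `I^α`, and `0` otherwise. -/
noncomputable def eOrZero (i : (Set.univ : Set (Fin α.degree → I))) : Block k α :=
  if h : i.1 ∈ seqs α then e k (⟨i.1, h⟩ : seqs α) else 0

theorem relations_block : Relations k (eOrZero k α) (fun r => x k (seqs α) r)
    (fun r => tau k (seqs α) r) := by
  classical
  have Q := relations_alg k (S := seqs α)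
  have pos : ∀ i (h : i.1 ∈ seqs α), eOrZero k α i = e k (⟨i.1, h⟩ : seqs α) :=
    fun i h => dif_pos h
  have neg : ∀ i, i.1 ∉ seqs α → eOrZero k α i = 0 := fun i h => dif_neg h
  refine ⟨?_, ?_, ?_, ?_, ?_, Q.x_x, ?_, ?_, Q.tau_x, Q.tau_tau, ?_, ?_⟩
  · intro i
    by_cases h : i.1 ∈ seqs α
    · rw [pos i h]; exact Q.e_mul_self _
    · rw [neg i h, mul_zero]
  · intro i j h
    by_cases hi : i.1 ∈ seqs α
    · by_cases hj : j.1 ∈ seqs α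
      · rw [pos i hi, pos j hj]
        exact Q.e_mul_ne _ _ (fun h' => h (Subtype.ext (congrArg (·.1) h')))
      · rw [neg j hj, mul_zero]
    · rw [neg i hi, zero_mul]
  · rw [← Q.sum_e]
    symm
    refine Finset.sum_of_injOn (fun i => ⟨i.1, trivial⟩) ?_ ?_ ?_ ?_
    · intro i _ j _ h; exact Subtype.ext (congrArg (·.1) h)
    · intro i _; simp
    · intro j _ hj
      refine neg j fun h => hj ⟨⟨j.1, h⟩, Finset.mem_coe.2 (Finset.mem_univ _), rfl⟩
    · intro i _; exact (pos ⟨i.1, trivial⟩ i.2).symm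
  · intro r i
    by_cases h : i.1 ∈ seqs α
    · rw [pos i h]; exact Q.x_e r _
    · rw [neg i h, mul_zero, zero_mul]
  · intro r i j h
    have hm : j.1 ∈ seqs α ↔ i.1 ∈ seqs α := by rw [h, swapSeq_mem]
    by_cases hi : i.1 ∈ seqs α
    · rw [pos i hi, pos j (hm.2 hi)]
      exact Q.tau_e r ⟨i.1, hi⟩ ⟨j.1, hm.2 hi⟩ h
    · rw [neg i hi, neg j (fun h' => hi (hm.1 h')), mul_zero, zero_mul]
  · intro r i
    by_cases hi : i.1 ∈ seqs α
    · rw [pos i hi]; exact Q.tau_x_hi r ⟨i.1, hi⟩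
    · rw [neg i hi, mul_zero, mul_zero]
  · intro r i
    by_cases hi : i.1 ∈ seqs α
    · rw [pos i hi]; exact Q.x_hi_tau r ⟨i.1, hi⟩
    · rw [neg i hi, mul_zero, mul_zero]
  · intro r i
    by_cases hi : i.1 ∈ seqs α
    · rw [pos i hi]; exact Q.tau_sq r ⟨i.1, hi⟩
    · rw [neg i hi, mul_zero, mul_zero]
  · intro r s h i
    by_cases hi : i.1 ∈ seqs α
    · rw [pos i hi]; exact Q.braid r s h ⟨i.1, hi⟩
    · rw [neg i hi, mul_zero, mul_zero]

/-- For a finite vertex set, `R_α` is isomorphic to the block `e(α) R_d = e(α) R_d e(α)` of `R_d`,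
where `d = |α|`, compatibly with the generators. -/
theorem exists_blockEquiv :
    ∃ f : Block k α ≃ₐ[k] (eDim_idem k α).Corner,
      (∀ i, f (e k i) = toCorner (eDim_idem k α) (e k ⟨i.1, trivial⟩)) ∧
      (∀ r, f (x k _ r) = toCorner (eDim_idem k α) (x k _ r)) ∧
      ∀ r, f (tau k _ r) = toCorner (eDim_idem k α) (tau k _ r) := by
  classical
  obtain ⟨f, fE, fX, fT⟩ := exists_lift (relations_compress k α)
  obtain ⟨ψ, ψE, ψX, ψT⟩ := exists_lift (relations_block k α)
  have hfψ : f.comp ψ = compress k α := by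
    refine hom_ext k (fun i => ?_) (fun r => ?_) (fun r => ?_)
    · rw [AlgHom.comp_apply, ψE, eOrZero]
      split_ifs with h
      · exact fE _
      · rw [map_zero]
        refine (Subtype.ext ?_).symm
        change eDim k α * e k i * eDim k α = 0
        rw [eSum_mul_e, if_neg (show ¬ i ∈ {i | i.1 ∈ seqs α} from h), zero_mul]
    · rw [AlgHom.comp_apply, ψX, fX]
    · rw [AlgHom.comp_apply, ψT, fT]
  have hψ1 : ψ (eDim k α) = 1 := by
    rw [← ψ.map_one, ← (relations_alg k (S := Set.univ)).sum_e, eDim, eSum, map_sum, map_sum]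
    refine Finset.sum_subset (Finset.subset_univ _) fun i _ hi => ?_
    rw [ψE, eOrZero, dif_neg]
    simpa using hi
  have hψθ : ∀ a, ψ (compress k α a).1 = ψ a := fun a => by
    rw [compress_val, map_mul, map_mul, hψ1, one_mul, mul_one]
  have hsurj : Function.Surjective f := by
    rintro ⟨_, a, rfl⟩
    exact ⟨ψ a, AlgHom.congr_fun hfψ a⟩
  have hψsurj : Function.Surjective ψ := by
    intro b
    induction b using alg_induction with
    | he i => exact ⟨e k ⟨i.1, trivial⟩, (ψE _).trans (dif_pos i.2)⟩
    | hx r => exact ⟨_, ψX r⟩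
    | ht r => exact ⟨_, ψT r⟩
    | hc c => exact ⟨algebraMap k _ c, ψ.commutes c⟩
    | ha a b ha hb =>
      obtain ⟨a, rfl⟩ := ha; obtain ⟨b, rfl⟩ := hb; exact ⟨a + b, map_add _ _ _⟩
    | hm a b ha hb =>
      obtain ⟨a, rfl⟩ := ha; obtain ⟨b, rfl⟩ := hb; exact ⟨a * b, map_mul _ _ _⟩
  have hinj : ∀ b, ψ (f b).1 = b := by
    intro b
    obtain ⟨a, rfl⟩ := hψsurj b
    rw [← AlgHom.comp_apply f ψ, hfψ, hψθ]
  refine ⟨AlgEquiv.ofBijective f ⟨fun a b h => ?_, hsurj⟩, fE, fX, fT⟩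
  rw [← hinj a, ← hinj b, h]

end Comparison

end KLR

/-!
The isomorphism is obtained by letting both algebras act faithfully on the same space of
polynomials, by the same operators.

The KLR algebra `R_β` acts on the families of polynomials indexed by the sequences of weight `β`
(`polRep`). The crossing of two strands acts by a divided difference if their labels agree, and
otherwise exchanges the two variables and multiplies by a power of their difference (`cross`). The
elements `τ_w p(x) e(i)`, with a reduced word chosen for each permutation `w`, span `R_β`
(`combine_surjective`), since up to words with fewer crossings the product of the crossings of a
word depends only on its permutation and is zero if the word is not reduced
(`wordTau_sub_mem_filt`, `wordTau_mem_filt_of_not_isReduced`). After clearing denominators, `τ_w`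
acts as `w` on the variables up to shorter permutations, and different permutations of the
variables are linearly independent by Dedekind's lemma. Hence these elements are independent as
operators (`polRep_combine_injective`), and the polynomial representation is faithful.

For the doubled quiver, a matching of a sequence pairs each entry `i²` with an entry `i¹` to the
left of it (`IsMatching`), and thus defines a linear subspace, on which the variables of matched
entries agree. The families of polynomials that vanish on the subspaces of all matchings form a
subrepresentation (`polRep_mem_vanishing`): a crossing that would reverse a matched pair comes
with the factor `x_{r+1} - x_r` of the arrow `i¹ → i²`, which is zero on the subspace. An
unordered sequence has no matching, so the quotient by this subrepresentation vanishes at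
unordered sequences. The well-ordered sequences are the sequences `φ(i)`, and `φ(i)` has only the
matching of adjacent entries. So the truncation of the quotient by `𝐞` is the space of families of
polynomials for the original quiver, and the balanced algebra acts on it (`exists_balancedRep`). A
direct computation shows that `e(φ(i))`, `x*_r` and `τ*_r` act there as `e(i)`, `x_r` and `τ_r` do
(`dblAct_e`, `dblAct_xStarAt`, `dblAct_tauStarAt`); the sign in `τ*_r` for equal entries in `I₁`
appears because one of the two divided differences is applied to a linear factor.

It remains to see that the elements `τ*_w p(x*) e(φ(i))` span the balanced algebra
(`starCombine_surjective`). The two variables of a pair `i¹, i²` agree there, because their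
difference is the square of the crossing of the pair, which factors through an unordered sequence
(`cls_mul_x_mul_e`). A reduced word of crossings on `φ(i)` that reverses a pair can be rewritten,
up to shorter words, with the crossing of this pair acting first, and is then zero for the same
reason. If it keeps the order within each pair and leads to a sequence `φ(i')`, it permutes the
blocks of `φ(i)` (`exists_isBlockPerm`), and is the product of the corresponding `τ*_r` up to sign
and shorter words (`isReduced_starList_redWord`). Otherwise it ends at a sequence that is not
well-ordered. The spanning elements of the two algebras act by the same independent operators,
which gives the isomorphism (`exists_doubledEquiv`).

For the cyclic quiver of length `n` and a single doubled vertex, the doubled quiver is the cyclic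
quiver of length `n + 1` (`CyclicVertex.arrowCount_ofDoubled`), and the balanced algebra depends
only on the numbers of arrows (`nonempty_balanced_equiv`). It is a quotient of the subalgebra
`𝐞 R 𝐞` (`isSubquotientAlgebra_of_balanced`).
-/

namespace KLR

/-! ### Inversions and reduced words of permutations -/

section Words

variable {d : ℕ}

theorem lo_lt_hi (r : Fin (d - 1)) : lo r < hi r := Fin.lt_def.2 (Nat.lt_succ_self _)

theorem lo_ne_hi (r : Fin (d - 1)) : lo r ≠ hi r := (lo_lt_hi r).ne

theorem lo_val (r : Fin (d - 1)) : (lo r).1 = r.1 := rfl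

theorem hi_val (r : Fin (d - 1)) : (hi r).1 = r.1 + 1 := rfl

/-- The simple transposition at the positions of the crossing `τ_r`. -/
def simple (r : Fin (d - 1)) : Equiv.Perm (Fin d) := Equiv.swap (lo r) (hi r)

@[simp] theorem simple_lo (r : Fin (d - 1)) : simple r (lo r) = hi r := Equiv.swap_apply_left _ _

@[simp] theorem simple_hi (r : Fin (d - 1)) : simple r (hi r) = lo r := Equiv.swap_apply_right _ _

theorem simple_of_ne {r : Fin (d - 1)} {a : Fin d} (h1 : a ≠ lo r) (h2 : a ≠ hi r) :
    simple r a = a := Equiv.swap_apply_of_ne_of_ne h1 h2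

@[simp] theorem simple_mul_self (r : Fin (d - 1)) : simple r * simple r = 1 :=
  Equiv.swap_mul_self _ _

@[simp] theorem simple_simple (r : Fin (d - 1)) (a : Fin d) : simple r (simple r a) = a :=
  Equiv.swap_apply_self _ _ _

@[simp] theorem simple_inv (r : Fin (d - 1)) : (simple r)⁻¹ = simple r := Equiv.swap_inv _ _

theorem swapSeq_eq {I : Type u} (r : Fin (d - 1)) (i : Fin d → I) :
    swapSeq r i = i ∘ simple r := rfl

theorem simple_val (r : Fin (d - 1)) (a : Fin d) :
    (simple r a).1 = if a.1 = r.1 then r.1 + 1 else if a.1 = r.1 + 1 then r.1 else a.1 := by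
  split_ifs with h1 h2
  · rw [show a = lo r from Fin.ext h1, simple_lo, hi_val]
  · rw [show a = hi r from Fin.ext h2, simple_hi, lo_val]
  · rw [simple_of_ne (fun h => h1 (congrArg Fin.val h)) (fun h => h2 (congrArg Fin.val h))]

theorem simple_commute {r s : Fin (d - 1)} (h : r.1 + 1 < s.1) :
    simple r * simple s = simple s * simple r := by
  ext a
  simp only [Equiv.Perm.mul_apply, simple_val]
  split_ifs <;> omega

theorem simple_braid {r s : Fin (d - 1)} (h : s.1 = r.1 + 1) :
    simple s * simple r * simple s = simple r * simple s * simple r := by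
  have e1 : r.1 ≠ r.1 + 1 + 1 := by omega
  have e2 : r.1 + 1 + 1 ≠ r.1 := by omega
  ext a
  rcases eq_or_ne a.1 r.1 with h0 | h0
  · simp [simple_val, h, e1, e2, h0]
  rcases eq_or_ne a.1 (r.1 + 1) with h1 | h1
  · simp [simple_val, h, e1, e2, h1]
  rcases eq_or_ne a.1 (r.1 + 1 + 1) with h2 | h2
  · simp [simple_val, h, e1, e2, h2]
  · simp [simple_val, h, h0, h1, h2]

/-- The inversions of a permutation. -/
def inversions (w : Equiv.Perm (Fin d)) : Finset (Fin d × Fin d) :=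
  Finset.univ.filter fun p => p.1 < p.2 ∧ w p.2 < w p.1

theorem mem_inversions {w : Equiv.Perm (Fin d)} {a b : Fin d} :
    (a, b) ∈ inversions w ↔ a < b ∧ w b < w a := by
  rw [inversions, Finset.mem_filter]
  exact and_iff_right (Finset.mem_univ _)

/-- The length of a permutation: the number of its inversions. -/
def len (w : Equiv.Perm (Fin d)) : ℕ := (inversions w).card

theorem len_one : len (1 : Equiv.Perm (Fin d)) = 0 := by
  refine Finset.card_eq_zero.2 (Finset.eq_empty_of_forall_notMem ?_)
  rintro ⟨a, b⟩ h
  obtain ⟨h1, h2⟩ := mem_inversions.1 h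
  exact lt_asymm h1 h2

theorem simple_lt {r : Fin (d - 1)} {a b : Fin d} (h : a < b) (hne : ¬ (a = lo r ∧ b = hi r)) :
    simple r a < simple r b := by
  rw [Fin.lt_def, simple_val, simple_val]
  have hne' : ¬ (a.1 = r.1 ∧ b.1 = r.1 + 1) := fun h' => hne ⟨Fin.ext h'.1, Fin.ext h'.2⟩
  have := Fin.lt_def.1 h
  split_ifs <;> omega

/-- The inversions of `w s_r` other than that at the positions of `r` correspond to those of `w`
under `s_r`. -/
theorem len_mul_simple {w : Equiv.Perm (Fin d)} {r : Fin (d - 1)} (h : w (lo r) < w (hi r)) :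
    len (w * simple r) = len w + 1 := by
  classical
  have hmem : ∀ a b, (a, b) ∈ (inversions w).map
      ((Equiv.prodCongr (simple r) (simple r)).toEmbedding) ↔
      (simple r a, simple r b) ∈ inversions w := by
    intro a b
    rw [Finset.mem_map_equiv]
    exact Iff.rfl
  unfold len
  rw [← Finset.card_map (s := inversions w)
      ((Equiv.prodCongr (simple r) (simple r)).toEmbedding),
    ← Finset.card_insert_of_notMem (a := (lo r, hi r))]
  · congr 1
    ext ⟨a, b⟩
    rw [Finset.mem_insert, hmem, mem_inversions, mem_inversions, Equiv.Perm.mul_apply,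
      Equiv.Perm.mul_apply, Prod.mk.injEq]
    constructor
    · rintro ⟨hab, hw⟩
      by_cases hh : a = lo r ∧ b = hi r
      · exact Or.inl hh
      · exact Or.inr ⟨simple_lt hab hh, hw⟩
    · rintro (⟨rfl, rfl⟩ | ⟨hab, hw⟩)
      · simpa [lo_lt_hi] using h
      · refine ⟨?_, hw⟩
        have := simple_lt hab (r := r) ?_
        · simpa using this
        · rintro ⟨h1, h2⟩
          rw [h1, h2] at hw
          exact lt_asymm h hw
  · rw [hmem, mem_inversions, simple_lo, simple_hi]
    exact fun h' => lt_asymm h'.1 (lo_lt_hi r)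

theorem len_mul_simple_of_gt {w : Equiv.Perm (Fin d)} {r : Fin (d - 1)} (h : w (hi r) < w (lo r)) :
    len (w * simple r) + 1 = len w := by
  have := len_mul_simple (w := w * simple r) (r := r) (by simpa using h)
  rw [mul_assoc, simple_mul_self, mul_one] at this
  exact this.symm

theorem len_mul_simple_le (w : Equiv.Perm (Fin d)) (r : Fin (d - 1)) :
    len (w * simple r) ≤ len w + 1 := by
  rcases lt_or_gt_of_ne (w.injective.ne (lo_ne_hi r)) with h | h
  · exact (len_mul_simple h).le
  · have := len_mul_simple_of_gt h
    omega

theorem exists_descent {w : Equiv.Perm (Fin d)} (hw : w ≠ 1) : ∃ r, w (hi r) < w (lo r) := by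
  by_contra! hcon
  apply hw
  have hmono : StrictMono w := by
    cases d with
    | zero => exact fun a => a.elim0
    | succ n =>
      rw [Fin.strictMono_iff_lt_succ]
      intro i
      exact lt_of_le_of_ne (hcon i) (w.injective.ne (lo_ne_hi (d := n + 1) i))
  ext a
  have : (⟨w, fun {a b} => hmono.le_iff_le⟩ : Fin d ≃o Fin d) = OrderIso.refl _ :=
    Subsingleton.elim _ _
  exact congrArg (fun f : Fin d ≃o Fin d => (f a).1) this

/-- The product of the simple transpositions of a word. -/
def wordPerm (l : List (Fin (d - 1))) : Equiv.Perm (Fin d) := (l.map simple).prod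

@[simp] theorem wordPerm_nil : wordPerm ([] : List (Fin (d - 1))) = 1 := rfl

@[simp] theorem wordPerm_cons (r : Fin (d - 1)) (l : List (Fin (d - 1))) :
    wordPerm (r :: l) = simple r * wordPerm l := by simp [wordPerm]

theorem wordPerm_append (l l' : List (Fin (d - 1))) :
    wordPerm (l ++ l') = wordPerm l * wordPerm l' := by simp [wordPerm]

theorem wordPerm_concat (l : List (Fin (d - 1))) (r : Fin (d - 1)) :
    wordPerm (l ++ [r]) = wordPerm l * simple r := by simp [wordPerm]

theorem len_wordPerm_le (l : List (Fin (d - 1))) : len (wordPerm l) ≤ l.length := by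
  induction l using List.reverseRecOn with
  | nil => simp [len_one]
  | append_singleton l r ih =>
    rw [wordPerm_concat, List.length_append, List.length_singleton]
    exact (len_mul_simple_le _ _).trans (by omega)

/-- A word is reduced if its length is the length of the permutation that it represents. -/
def IsReduced (l : List (Fin (d - 1))) : Prop := len (wordPerm l) = l.length

open Classical in
/-- A reduced word of a permutation, obtained by removing right descents one at a time. -/
noncomputable def redWord (w : Equiv.Perm (Fin d)) : List (Fin (d - 1)) :=
  if h : w = 1 then [] else
    redWord (w * simple (exists_descent h).choose) ++ [(exists_descent h).choose]
  termination_by len w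
  decreasing_by
    have := len_mul_simple_of_gt (exists_descent h).choose_spec
    omega

@[simp] theorem redWord_one : redWord (1 : Equiv.Perm (Fin d)) = [] := by
  rw [redWord, dif_pos rfl]

theorem exists_redWord_eq {w : Equiv.Perm (Fin d)} (hw : w ≠ 1) :
    ∃ r, w (hi r) < w (lo r) ∧ redWord w = redWord (w * simple r) ++ [r] := by
  refine ⟨_, (exists_descent hw).choose_spec, ?_⟩
  conv_lhs => rw [redWord, dif_neg hw]

/-- Induction on permutations along the chosen reduced words. -/
theorem redWord_induction {motive : Equiv.Perm (Fin d) → Prop} (one : motive 1)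
    (step : ∀ w r, w (hi r) < w (lo r) → redWord w = redWord (w * simple r) ++ [r] →
      motive (w * simple r) → motive w) (w : Equiv.Perm (Fin d)) : motive w := by
  induction h : len w using Nat.strong_induction_on generalizing w with
  | _ n ih =>
    by_cases hw : w = 1
    · exact hw ▸ one
    · obtain ⟨r, hr, he⟩ := exists_redWord_eq hw
      have := len_mul_simple_of_gt hr
      exact step w r hr he (ih _ (by omega) _ rfl)

theorem wordPerm_redWord (w : Equiv.Perm (Fin d)) : wordPerm (redWord w) = w := by
  induction w using redWord_induction with
  | one => simp
  | step w r _ he ih => rw [he, wordPerm_concat, ih, mul_assoc, simple_mul_self, mul_one]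

theorem length_redWord (w : Equiv.Perm (Fin d)) : (redWord w).length = len w := by
  induction w using redWord_induction with
  | one => simp [len_one]
  | step w r hr he ih =>
    have := len_mul_simple_of_gt hr
    rw [he, List.length_append, ih, List.length_singleton, this]

theorem isReduced_redWord (w : Equiv.Perm (Fin d)) : IsReduced (redWord w) := by
  rw [IsReduced, wordPerm_redWord, length_redWord]

theorem IsReduced.of_cons {r : Fin (d - 1)} {l : List (Fin (d - 1))} (h : IsReduced (r :: l)) :
    IsReduced l := by
  refine (len_wordPerm_le l).antisymm ?_
  have h1 : wordPerm (r :: redWord (wordPerm l)) = wordPerm (r :: l) := by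
    simp [wordPerm_redWord]
  have h2 := len_wordPerm_le (r :: redWord (wordPerm l))
  rw [h1, h, List.length_cons, List.length_cons, length_redWord] at h2
  omega

theorem IsReduced.of_concat {r : Fin (d - 1)} {l : List (Fin (d - 1))} (h : IsReduced (l ++ [r])) :
    IsReduced l := by
  refine (len_wordPerm_le l).antisymm ?_
  have h2 := len_mul_simple_le (wordPerm l) r
  rw [← wordPerm_concat, h, List.length_append, List.length_singleton] at h2
  omega

/-- The last letter of a reduced word is a right descent. -/
theorem IsReduced.descent {r : Fin (d - 1)} {l : List (Fin (d - 1))} (h : IsReduced (l ++ [r])) :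
    wordPerm (l ++ [r]) (hi r) < wordPerm (l ++ [r]) (lo r) := by
  rcases lt_or_gt_of_ne ((wordPerm l).injective.ne (lo_ne_hi r)) with h' | h'
  · simpa [wordPerm_concat] using h'
  · have h1 := len_mul_simple_of_gt h'
    have h2 := len_wordPerm_le l
    rw [← wordPerm_concat, h, List.length_append, List.length_singleton] at h1
    omega

end Words

/-! ### The filtration of a KLR algebra by the number of crossings -/

section Filtration

variable (k : Type w) [Field k] {V : Type u} {β : V →₀ ℕ}

theorem comp_perm_mem_seqs {i : Fin β.degree → V} (hi : i ∈ seqs β)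
    (w : Equiv.Perm (Fin β.degree)) : i ∘ w ∈ seqs β := by
  change (∑ a, Finsupp.single (i (w a)) 1 = β)
  rw [Equiv.sum_comp w (fun a => Finsupp.single (i a) 1)]
  exact hi

/-- The sequence `w(i)`, whose entry at the position `w a` is the entry of `i` at `a`. -/
def permSeq (w : Equiv.Perm (Fin β.degree)) (i : seqs β) : seqs β :=
  ⟨i.1 ∘ ⇑w⁻¹, comp_perm_mem_seqs i.2 _⟩

theorem permSeq_apply (w : Equiv.Perm (Fin β.degree)) (i : seqs β) (a : Fin β.degree) :
    (permSeq w i).1 a = i.1 (w⁻¹ a) := rfl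

@[simp] theorem permSeq_one (i : seqs β) : permSeq 1 i = i := rfl

theorem permSeq_mul (w w' : Equiv.Perm (Fin β.degree)) (i : seqs β) :
    permSeq (w * w') i = permSeq w (permSeq w' i) :=
  Subtype.ext (funext fun a => by simp [permSeq_apply])

theorem permSeq_simple (r : Fin (β.degree - 1)) (i : seqs β) :
    (permSeq (simple r) i).1 = swapSeq r i.1 := by
  rw [swapSeq_eq, ← simple_inv]; rfl

theorem permSeq_simple_simple (r : Fin (β.degree - 1)) (i : seqs β) :
    permSeq (simple r) (permSeq (simple r) i) = i := by
  rw [← permSeq_mul, simple_mul_self, permSeq_one]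

variable [Quiver.{v} V]

theorem tau_mul_e (r : Fin (β.degree - 1)) (i : seqs β) :
    tau k (seqs β) r * e k i = e k (permSeq (simple r) i) * tau k (seqs β) r :=
  (relations_alg k).tau_e r i _ (permSeq_simple r i)

theorem e_mul_tau (r : Fin (β.degree - 1)) (i : seqs β) :
    e k i * tau k (seqs β) r = tau k (seqs β) r * e k (permSeq (simple r) i) := by
  rw [tau_mul_e, permSeq_simple_simple]

theorem eq_sum_mul_e (a : Block k β) : a = ∑ i, a * e k i := by
  rw [← Finset.mul_sum, (relations_alg k).sum_e, mul_one]

variable (β) in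
/-- The subalgebra generated by the `x_r` and the idempotents `e(i)`. -/
noncomputable def polySub : Subalgebra k (Block k β) :=
  Algebra.adjoin k (Set.range (x k (seqs β)) ∪ Set.range (e k (S := seqs β)))

theorem x_mem_polySub (r : Fin β.degree) : x k (seqs β) r ∈ polySub k β :=
  Algebra.subset_adjoin (Or.inl ⟨r, rfl⟩)

theorem e_mem_polySub (i : seqs β) : e k i ∈ polySub k β :=
  Algebra.subset_adjoin (Or.inr ⟨i, rfl⟩)

theorem klrQ_mem {A : Type*} [Ring A] [Algebra k A] (Y : Subalgebra k A) (i j : V) {a b : A}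
    (ha : a ∈ Y) (hb : b ∈ Y) : klrQ i j a b ∈ Y := by
  unfold klrQ
  split_ifs
  · exact zero_mem _
  · exact mul_mem (pow_mem (sub_mem hb ha) _) (pow_mem (sub_mem ha hb) _)

theorem klrDiff_mem {A : Type*} [Ring A] [Algebra k A] (Y : Subalgebra k A) (i j : V) {a b c : A}
    (ha : a ∈ Y) (hb : b ∈ Y) (hc : c ∈ Y) : klrDiff i j a b c ∈ Y := by
  unfold klrDiff
  split_ifs
  · exact zero_mem _
  · exact mul_mem (pow_mem (neg_mem (one_mem _)) _) (sum_mem fun m _ =>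
      mul_mem (pow_mem (sub_mem hc hb) _) (pow_mem (sub_mem ha hb) _))

theorem tau_sq_mem (r : Fin (β.degree - 1)) :
    tau k (seqs β) r * tau k (seqs β) r ∈ polySub k β := by
  rw [eq_sum_mul_e k (tau k (seqs β) r * tau k (seqs β) r)]
  refine sum_mem fun i _ => ?_
  rw [(relations_alg k).tau_sq]
  exact mul_mem (klrQ_mem k _ _ _ (x_mem_polySub k _) (x_mem_polySub k _)) (e_mem_polySub k _)

theorem braid_mem {r s : Fin (β.degree - 1)} (h : s.1 = r.1 + 1) :
    tau k (seqs β) s * tau k (seqs β) r * tau k (seqs β) s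
      - tau k (seqs β) r * tau k (seqs β) s * tau k (seqs β) r ∈ polySub k β := by
  rw [eq_sum_mul_e k (_ - _)]
  refine sum_mem fun i _ => ?_
  rw [(relations_alg k).braid r s h]
  refine mul_mem ?_ (e_mem_polySub k _)
  split_ifs
  · exact klrDiff_mem k _ _ _ (x_mem_polySub k _) (x_mem_polySub k _) (x_mem_polySub k _)
  · exact zero_mem _

/-- Moving `x_a` past a crossing: the corrections are combinations of idempotents. -/
theorem x_mul_tau (a : Fin β.degree) (r : Fin (β.degree - 1)) :
    ∃ y ∈ polySub k β,
      x k (seqs β) a * tau k (seqs β) r = tau k (seqs β) r * x k (seqs β) (simple r a) + y := by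
  classical
  have R := relations_alg k (S := seqs β)
  rcases eq_or_ne a (hi r) with rfl | h1
  · refine ⟨∑ i : seqs β, (if i.1 (lo r) = i.1 (hi r) then 1 else 0) * e k i,
      sum_mem fun i _ => mul_mem ?_ (e_mem_polySub k _), ?_⟩
    · split_ifs
      exacts [one_mem _, zero_mem _]
    · rw [eq_sum_mul_e k (x k (seqs β) (hi r) * tau k (seqs β) r), simple_hi,
        eq_sum_mul_e k (tau k (seqs β) r * x k (seqs β) (lo r)), ← Finset.sum_add_distrib]
      exact Finset.sum_congr rfl fun i _ => by rw [R.x_hi_tau, add_mul]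
  rcases eq_or_ne a (lo r) with rfl | h2
  · refine ⟨-∑ i : seqs β, (if i.1 (lo r) = i.1 (hi r) then 1 else 0) * e k i,
      neg_mem (sum_mem fun i _ => mul_mem ?_ (e_mem_polySub k _)), ?_⟩
    · split_ifs
      exacts [one_mem _, zero_mem _]
    · rw [← sub_eq_add_neg, eq_sub_iff_add_eq,
        eq_sum_mul_e k (x k (seqs β) (lo r) * tau k (seqs β) r), simple_lo,
        eq_sum_mul_e k (tau k (seqs β) r * x k (seqs β) (hi r)), ← Finset.sum_add_distrib]
      exact Finset.sum_congr rfl fun i _ => by rw [R.tau_x_hi, add_mul]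
  · exact ⟨0, zero_mem _, by rw [add_zero, simple_of_ne h2 h1, R.tau_x r a h2 h1]⟩

/-- Moving a polynomial past a crossing. -/
theorem polySub_mul_tau {y : Block k β} (hy : y ∈ polySub k β) (r : Fin (β.degree - 1)) :
    ∃ y' ∈ polySub k β, ∃ y'' ∈ polySub k β,
      y * tau k (seqs β) r = tau k (seqs β) r * y' + y'' := by
  induction hy using Algebra.adjoin_induction with
  | mem y hy =>
    rcases hy with ⟨a, rfl⟩ | ⟨i, rfl⟩
    · obtain ⟨y, hy, h⟩ := x_mul_tau k a r
      exact ⟨_, x_mem_polySub k _, y, hy, h⟩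
    · exact ⟨_, e_mem_polySub k _, 0, zero_mem _, by rw [add_zero, e_mul_tau]⟩
  | algebraMap c =>
    exact ⟨algebraMap _ _ c, Subalgebra.algebraMap_mem _ _, 0, zero_mem _, by
      rw [add_zero, Algebra.commutes]⟩
  | add a b _ _ iha ihb =>
    obtain ⟨a', ha', a'', ha'', ha⟩ := iha
    obtain ⟨b', hb', b'', hb'', hb⟩ := ihb
    refine ⟨_, add_mem ha' hb', _, add_mem ha'' hb'', ?_⟩
    rw [add_mul, ha, hb, mul_add]; abel
  | mul a b hma _ iha ihb =>
    obtain ⟨a', ha', a'', ha'', ha⟩ := iha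
    obtain ⟨b', hb', b'', hb'', hb⟩ := ihb
    refine ⟨_, mul_mem ha' hb', _, add_mem (mul_mem ha'' hb') (mul_mem hma hb''), ?_⟩
    rw [mul_assoc, hb, mul_add, ← mul_assoc, ha, add_mul, mul_assoc]; abel

/-- The product of the crossings of a word. -/
noncomputable def wordTau (l : List (Fin (β.degree - 1))) : Block k β :=
  (l.map (tau k (seqs β))).prod

@[simp] theorem wordTau_nil : wordTau k ([] : List (Fin (β.degree - 1))) = 1 := rfl

@[simp] theorem wordTau_cons (r : Fin (β.degree - 1)) (l : List (Fin (β.degree - 1))) :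
    wordTau k (r :: l) = tau k _ r * wordTau k l := by simp [wordTau]

theorem wordTau_append (l l' : List (Fin (β.degree - 1))) :
    wordTau k (l ++ l') = wordTau k l * wordTau k l' := by simp [wordTau]

theorem wordTau_concat (l : List (Fin (β.degree - 1))) (r : Fin (β.degree - 1)) :
    wordTau k (l ++ [r]) = wordTau k l * tau k _ r := by simp [wordTau]

theorem wordTau_mul_e (l : List (Fin (β.degree - 1))) (i : seqs β) :
    wordTau k l * e k i = e k (permSeq (wordPerm l) i) * wordTau k l := by
  induction l with
  | nil => simp
  | cons r l ih =>
    rw [wordTau_cons, mul_assoc, ih, ← mul_assoc, tau_mul_e, mul_assoc, wordPerm_cons, permSeq_mul]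

variable (β) in
/-- The span of the products of fewer than `n` crossings with polynomials. -/
noncomputable def filt (n : ℕ) : Submodule k (Block k β) :=
  Submodule.span k {a | ∃ l : List (Fin (β.degree - 1)), ∃ y ∈ polySub k β,
    l.length < n ∧ a = wordTau k l * y}

theorem wordTau_mul_mem_filt {n : ℕ} {l : List (Fin (β.degree - 1))} (h : l.length < n)
    {y : Block k β} (hy : y ∈ polySub k β) : wordTau k l * y ∈ filt k β n :=
  Submodule.subset_span ⟨l, y, hy, h, rfl⟩

theorem filt_mono {m n : ℕ} (h : m ≤ n) : filt k β m ≤ filt k β n := by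
  refine Submodule.span_mono ?_
  rintro _ ⟨l, y, hy, hl, rfl⟩
  exact ⟨l, y, hy, hl.trans_le h, rfl⟩

variable {k}

theorem filt_mul_polySub {n : ℕ} {a y : Block k β} (ha : a ∈ filt k β n) (hy : y ∈ polySub k β) :
    a * y ∈ filt k β n := by
  induction ha using Submodule.span_induction with
  | mem a ha =>
    obtain ⟨l, z, hz, hl, rfl⟩ := ha
    rw [mul_assoc]
    exact wordTau_mul_mem_filt k hl (mul_mem hz hy)
  | zero => rw [zero_mul]; exact zero_mem _
  | add a b _ _ iha ihb => rw [add_mul]; exact add_mem iha ihb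
  | smul c a _ iha => rw [smul_mul_assoc]; exact Submodule.smul_mem _ _ iha

theorem filt_mul_tau {n : ℕ} {a : Block k β} (ha : a ∈ filt k β n) (r : Fin (β.degree - 1)) :
    a * tau k _ r ∈ filt k β (n + 1) := by
  induction ha using Submodule.span_induction with
  | mem a ha =>
    obtain ⟨l, z, hz, hl, rfl⟩ := ha
    obtain ⟨y', hy', y'', hy'', h⟩ := polySub_mul_tau k hz r
    rw [mul_assoc, h, mul_add, ← mul_assoc, ← wordTau_concat]
    exact add_mem (wordTau_mul_mem_filt k (by simpa using hl) hy')
      (wordTau_mul_mem_filt k (by omega) hy'')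
  | zero => rw [zero_mul]; exact zero_mem _
  | add a b _ _ iha ihb => rw [add_mul]; exact add_mem iha ihb
  | smul c a _ iha => rw [smul_mul_assoc]; exact Submodule.smul_mem _ _ iha

variable (k)

/-- The two halves of the comparison of words of length `n`: words that are not reduced can be
shortened, and reduced words of the same permutation agree up to shorter words. -/
def WordsComparable (β : V →₀ ℕ) (n : ℕ) : Prop :=
  (∀ l : List (Fin (β.degree - 1)), l.length = n → ¬ IsReduced l → wordTau k l ∈ filt k β n) ∧
  ∀ l l' : List (Fin (β.degree - 1)), l.length = n → IsReduced l → IsReduced l' →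
    wordPerm l = wordPerm l' → wordTau k l - wordTau k l' ∈ filt k β n

variable {k}

/-- A word that ends in `r` may be compared with another reduced word that ends in `r`, since the
words without `r` are shorter. -/
theorem tau_sub_of_descent {n : ℕ} (ih : WordsComparable k β n) {l c : List (Fin (β.degree - 1))}
    {r : Fin (β.degree - 1)} (hn : l.length = n) (hl : IsReduced (l ++ [r])) (hc : IsReduced c)
    (h : wordPerm c = wordPerm (l ++ [r]) * simple r) :
    wordTau k (l ++ [r]) - wordTau k c * tau k _ r ∈ filt k β (n + 1) := by
  rw [wordTau_concat, ← sub_mul]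
  refine filt_mul_tau (ih.2 l c hn hl.of_concat hc ?_) r
  rw [h, wordPerm_concat, mul_assoc, simple_mul_self, mul_one]

/-- The comparison of two reduced words of the same permutation that end in different letters `p`
and `q`: both are compared with words that end in a common braid or commutation relation of the two
letters. -/
theorem wordTau_sub_of_lt {n : ℕ} (ih : WordsComparable k β n)
    {l l' : List (Fin (β.degree - 1))} {p q : Fin (β.degree - 1)} (hpq : p < q)
    (hn : l.length = n) (hn' : l'.length = n)
    (hl : IsReduced (l ++ [p])) (hl' : IsReduced (l' ++ [q]))
    (h : wordPerm (l ++ [p]) = wordPerm (l' ++ [q])) :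
    wordTau k (l ++ [p]) - wordTau k (l' ++ [q]) ∈ filt k β (n + 1) := by
  have dp := hl.descent
  have dq := hl'.descent
  have hln : len (wordPerm (l ++ [p])) = n + 1 := by rw [hl, List.length_append, hn]; rfl
  rw [← h] at dq
  set w := wordPerm (l ++ [p]) with hw
  have lp := len_mul_simple_of_gt dp
  have lq := len_mul_simple_of_gt dq
  have hpq' := Fin.lt_def.1 hpq
  by_cases hadj : q.1 = p.1 + 1
  · have e1 : lo q = hi p := Fin.ext hadj
    have n1 : hi q ≠ lo p := Fin.ne_of_val_ne (by simp only [hi_val, lo_val]; omega)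
    have n2 : hi q ≠ hi p := Fin.ne_of_val_ne (by simp only [hi_val]; omega)
    have n3 : lo p ≠ lo q := Fin.ne_of_val_ne (by simp only [lo_val]; omega)
    have n4 : lo p ≠ hi q := n1.symm
    have lpq := len_mul_simple_of_gt (w := w * simple p) (r := q) (by
      rw [Equiv.Perm.mul_apply, Equiv.Perm.mul_apply, e1, simple_hi, simple_of_ne n1 n2]
      exact (e1 ▸ dq).trans dp)
    have lqp := len_mul_simple_of_gt (w := w * simple q) (r := p) (by
      rw [Equiv.Perm.mul_apply, Equiv.Perm.mul_apply, ← e1, simple_lo, simple_of_ne n3 n4]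
      exact dq.trans (e1 ▸ dp))
    have lpqp := len_mul_simple_of_gt (w := w * simple p * simple q) (r := p) (by
      rw [Equiv.Perm.mul_apply, Equiv.Perm.mul_apply, Equiv.Perm.mul_apply, Equiv.Perm.mul_apply,
        ← e1, simple_lo, simple_of_ne n3 n4, simple_of_ne n1 n2, simple_lo, ← e1]
      exact dq)
    -- `c p q p` and `c q p q` are reduced words of `w`
    set c := redWord (w * simple p * simple q * simple p) with hc
    have hcl : c.length = len (w * simple p * simple q * simple p) := length_redWord _
    have hcw : wordPerm c = w * simple p * simple q * simple p := wordPerm_redWord _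
    have p1 : wordPerm (c ++ [p] ++ [q]) = w * simple p := by
      simp only [wordPerm_concat, hcw, mul_assoc, simple_mul_self, mul_one]
    have p2 : wordPerm (c ++ [q] ++ [p]) = w * simple q := by
      simp only [wordPerm_concat, hcw, mul_assoc]
      rw [← mul_assoc (simple p) (simple q), ← mul_assoc, ← mul_assoc, ← mul_assoc, ← mul_assoc,
        mul_assoc w, mul_assoc w, ← simple_braid hadj]
      simp only [mul_assoc, simple_mul_self, mul_one]
    have r1 : IsReduced (c ++ [p] ++ [q]) := by
      rw [IsReduced, p1, List.length_append, List.length_append, hcl]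
      simp only [List.length_singleton]; omega
    have r2 : IsReduced (c ++ [q] ++ [p]) := by
      rw [IsReduced, p2, List.length_append, List.length_append, hcl]
      simp only [List.length_singleton]; omega
    have t1 := tau_sub_of_descent ih hn hl r1 p1
    have t2 := tau_sub_of_descent ih hn' hl' r2 (by rw [p2, ← h])
    have t3 : wordTau k c * (tau k (seqs β) q * tau k (seqs β) p * tau k (seqs β) q
        - tau k (seqs β) p * tau k (seqs β) q * tau k (seqs β) p) ∈ filt k β (n + 1) :=
      wordTau_mul_mem_filt k (by omega) (braid_mem k hadj)
    have := sub_mem (sub_mem t1 t2) t3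
    simp only [wordTau_concat] at this ⊢
    convert this using 1
    noncomm_ring
  · have n1 : lo q ≠ lo p := Fin.ne_of_val_ne (by simp only [lo_val]; omega)
    have n2 : lo q ≠ hi p := Fin.ne_of_val_ne (by simp only [hi_val, lo_val]; omega)
    have n3 : hi q ≠ lo p := Fin.ne_of_val_ne (by simp only [hi_val, lo_val]; omega)
    have n4 : hi q ≠ hi p := Fin.ne_of_val_ne (by simp only [hi_val]; omega)
    have hcomm := simple_commute (r := p) (s := q) (by omega)
    have lpq := len_mul_simple_of_gt (w := w * simple p) (r := q) (by
      rw [Equiv.Perm.mul_apply, Equiv.Perm.mul_apply, simple_of_ne n1 n2, simple_of_ne n3 n4]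
      exact dq)
    -- `c q p` and `c p q` are reduced words of `w`
    set c := redWord (w * simple p * simple q) with hc
    have hcl : c.length = len (w * simple p * simple q) := length_redWord _
    have hcw : wordPerm c = w * simple p * simple q := wordPerm_redWord _
    have p1 : wordPerm (c ++ [q]) = w * simple p := by
      simp only [wordPerm_concat, hcw, mul_assoc, simple_mul_self, mul_one]
    have p2 : wordPerm (c ++ [p]) = w * simple q := by
      rw [wordPerm_concat, hcw, mul_assoc w, hcomm]
      simp only [mul_assoc, simple_mul_self, mul_one]
    have r1 : IsReduced (c ++ [q]) := by
      rw [IsReduced, p1, List.length_append, hcl]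
      simp only [List.length_singleton]; omega
    have r2 : IsReduced (c ++ [p]) := by
      rw [IsReduced, p2, List.length_append, hcl]
      simp only [List.length_singleton]; omega
    have t1 := tau_sub_of_descent ih hn hl r1 p1
    have t2 := tau_sub_of_descent ih hn' hl' r2 (by rw [p2, ← h])
    have := sub_mem t1 t2
    have hc' := (relations_alg k (S := seqs β)).tau_tau p q (by omega)
    simp only [wordTau_concat, mul_assoc, hc'] at this ⊢
    convert this using 1
    abel

theorem wordsComparable (n : ℕ) : WordsComparable k β n := by
  induction n with
  | zero =>
    refine ⟨fun l hl hr => ?_, fun l l' hl hr hr' h => ?_⟩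
    · rw [List.length_eq_zero_iff] at hl
      exact absurd (by rw [hl]; exact len_one) hr
    · rw [List.length_eq_zero_iff] at hl
      have : l'.length = 0 := by rw [← hr', ← h, hr, hl]; rfl
      rw [List.length_eq_zero_iff] at this
      rw [hl, this, sub_self]; exact zero_mem _
  | succ n ih =>
    constructor
    · intro l hl hr
      rcases List.eq_nil_or_concat l with rfl | ⟨l, r, rfl⟩
      · exact absurd len_one hr
      rw [List.concat_eq_append] at hl hr ⊢
      simp only [List.length_append, List.length_singleton, Nat.add_right_cancel_iff] at hl
      by_cases h1 : IsReduced l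
      · have hd : wordPerm l (hi r) < wordPerm l (lo r) := by
          rcases lt_or_gt_of_ne ((wordPerm l).injective.ne (lo_ne_hi r)) with h' | h'
          · refine absurd ?_ hr
            rw [IsReduced, wordPerm_concat, len_mul_simple h', h1, List.length_append]; rfl
          · exact h'
        have hlen := len_mul_simple_of_gt hd
        -- `r` is a descent of `l`, so `l` may be replaced by a word `c r`,
        -- and `τ_r ^ 2` is a polynomial
        set c := redWord (wordPerm l * simple r) with hc
        have hcw : wordPerm (c ++ [r]) = wordPerm l := by
          rw [wordPerm_concat, wordPerm_redWord, mul_assoc, simple_mul_self, mul_one]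
        have hcl : c.length = len (wordPerm l * simple r) := length_redWord _
        have h1' : len (wordPerm l) = n := h1.trans hl
        have hcr : IsReduced (c ++ [r]) := by
          rw [IsReduced, hcw, List.length_append, hcl, List.length_singleton, hlen]
        have t1 := filt_mul_tau (ih.2 l (c ++ [r]) hl h1 hcr hcw.symm) r
        have t2 := wordTau_mul_mem_filt k (n := n + 1) (l := c) (by omega) (tau_sq_mem k r)
        have := add_mem t1 t2
        rw [wordTau_concat, sub_mul, mul_assoc (wordTau k c), sub_add_cancel,
          ← wordTau_concat] at this
        exact this
      · rw [wordTau_concat]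
        exact filt_mul_tau (ih.1 l hl h1) r
    · intro l l' hl hr hr' h
      have hl' : l'.length = n + 1 := by rw [← hr', ← h, hr, hl]
      rcases List.eq_nil_or_concat l with rfl | ⟨l, p, rfl⟩
      · simp at hl
      rcases List.eq_nil_or_concat l' with rfl | ⟨l', q, rfl⟩
      · simp at hl'
      rw [List.concat_eq_append] at *
      rw [List.concat_eq_append] at *
      simp only [List.length_append, List.length_singleton, Nat.add_right_cancel_iff] at hl hl'
      rcases lt_trichotomy p q with hpq | rfl | hpq
      · exact wordTau_sub_of_lt ih hpq hl hl' hr hr' h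
      · rw [wordTau_concat, wordTau_concat, ← sub_mul]
        refine filt_mul_tau (ih.2 l l' hl hr.of_concat hr'.of_concat ?_) p
        rw [wordPerm_concat, wordPerm_concat] at h
        exact mul_right_cancel h
      · rw [← neg_sub]
        exact neg_mem (wordTau_sub_of_lt ih hpq hl' hl hr' hr h.symm)

/-- A word that is not reduced is a combination of shorter words. -/
theorem wordTau_mem_filt_of_not_isReduced {l : List (Fin (β.degree - 1))} (h : ¬ IsReduced l) :
    wordTau k l ∈ filt k β l.length := (wordsComparable _).1 l rfl h

/-- Reduced words of the same permutation agree up to shorter words. -/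
theorem wordTau_sub_mem_filt {l l' : List (Fin (β.degree - 1))} (hl : IsReduced l)
    (hl' : IsReduced l') (h : wordPerm l = wordPerm l') :
    wordTau k l - wordTau k l' ∈ filt k β l.length :=
  (wordsComparable _).2 l l' rfl hl hl' h

theorem exists_mem_filt (a : Block k β) : ∃ n, a ∈ filt k β n := by
  have hx : ∀ y ∈ polySub k β, y ∈ filt k β 1 := fun y hy => by
    simpa using wordTau_mul_mem_filt k (n := 1) (l := []) (by simp) hy
  have key : ∀ a : Block k β, ∀ n, ∀ b ∈ filt k β n, ∃ m, b * a ∈ filt k β m := by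
    intro a
    induction a using alg_induction with
    | he i => exact fun n b hb => ⟨n, filt_mul_polySub hb (e_mem_polySub k i)⟩
    | hx r => exact fun n b hb => ⟨n, filt_mul_polySub hb (x_mem_polySub k r)⟩
    | ht r => exact fun n b hb => ⟨_, filt_mul_tau hb r⟩
    | hc c => exact fun n b hb => ⟨n, filt_mul_polySub hb (Subalgebra.algebraMap_mem _ c)⟩
    | ha a a' iha iha' =>
      intro n b hb
      obtain ⟨m, hm⟩ := iha n b hb
      obtain ⟨m', hm'⟩ := iha' n b hb
      exact ⟨max m m', by
        rw [mul_add]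
        exact add_mem (filt_mono k (le_max_left _ _) hm) (filt_mono k (le_max_right _ _) hm')⟩
    | hm a a' iha iha' =>
      intro n b hb
      obtain ⟨m, hm⟩ := iha n b hb
      obtain ⟨m', hm'⟩ := iha' m _ hm
      exact ⟨m', by rwa [← mul_assoc]⟩
  obtain ⟨m, hm⟩ := key a 1 1 (hx 1 (one_mem _))
  exact ⟨m, by rwa [one_mul] at hm⟩

end Filtration

/-! ### Polynomials in the generators `x_r` -/

section Polynomials

/-- Polynomials can be evaluated at commuting elements of a noncommutative algebra. -/
theorem exists_mvPolynomial_hom {k : Type w} [Field k] {A : Type*} [Ring A] [Algebra k A]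
    {σ : Type*} (g : σ → A) (h : ∀ r s, g r * g s = g s * g r) :
    ∃ f : MvPolynomial σ k →ₐ[k] A, ∀ r, f (MvPolynomial.X r) = g r := by
  have hc := Algebra.isMulCommutative_adjoin k (s := Set.range g) (by
    rintro _ ⟨r, rfl⟩ _ ⟨s, rfl⟩
    exact h r s)
  let : CommRing (Algebra.adjoin k (Set.range g)) :=
    { (inferInstance : Ring (Algebra.adjoin k (Set.range g))) with
      mul_comm := hc.is_comm.comm }
  refine ⟨(Algebra.adjoin k (Set.range g)).val.comp
    (MvPolynomial.aeval fun r => ⟨g r, Algebra.subset_adjoin ⟨r, rfl⟩⟩), fun r => ?_⟩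
  simp

variable (k : Type w) [Field k] {V : Type u} [Quiver.{v} V] (β : V →₀ ℕ)

/-- The evaluation of polynomials at the commuting elements `x_r`. -/
noncomputable def polyHom : MvPolynomial (Fin β.degree) k →ₐ[k] Block k β :=
  (exists_mvPolynomial_hom (x k (seqs β)) (relations_alg k).x_x).choose

@[simp] theorem polyHom_X (r : Fin β.degree) : polyHom k β (MvPolynomial.X r) = x k (seqs β) r :=
  (exists_mvPolynomial_hom (x k (seqs β)) (relations_alg k).x_x).choose_spec r

variable {β}

theorem polyHom_mul_e (p : MvPolynomial (Fin β.degree) k) (i : seqs β) :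
    polyHom k β p * e k i = e k i * polyHom k β p := by
  induction p using MvPolynomial.induction_on with
  | C c => rw [← MvPolynomial.algebraMap_eq, AlgHom.commutes, Algebra.commutes]
  | add p q hp hq => rw [map_add, add_mul, mul_add, hp, hq]
  | mul_X p r hp =>
    rw [map_mul, polyHom_X, mul_assoc, (relations_alg k).x_e, ← mul_assoc, hp, mul_assoc]

/-- On a single idempotent, each element of the subalgebra is a polynomial in the `x_r`. -/
theorem exists_polyHom_mul_e {y : Block k β} (hy : y ∈ polySub k β) (i : seqs β) :
    ∃ p, y * e k i = polyHom k β p * e k i := by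
  classical
  induction hy using Algebra.adjoin_induction with
  | mem y hy =>
    rcases hy with ⟨r, rfl⟩ | ⟨j, rfl⟩
    · exact ⟨MvPolynomial.X r, by rw [polyHom_X]⟩
    · by_cases h : j = i
      · exact ⟨1, by rw [h, e_mul_self, map_one, one_mul]⟩
      · exact ⟨0, by rw [e_mul_ne k h, map_zero, zero_mul]⟩
  | algebraMap c => exact ⟨algebraMap _ _ c, by rw [AlgHom.commutes]⟩
  | add a b _ _ ha hb =>
    obtain ⟨p, hp⟩ := ha
    obtain ⟨q, hq⟩ := hb
    exact ⟨p + q, by rw [add_mul, hp, hq, map_add, add_mul]⟩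
  | mul a b _ _ ha hb =>
    obtain ⟨p, hp⟩ := ha
    obtain ⟨q, hq⟩ := hb
    refine ⟨p * q, ?_⟩
    rw [mul_assoc, hq, polyHom_mul_e, ← mul_assoc, hp, map_mul, mul_assoc, mul_assoc,
      polyHom_mul_e]

end Polynomials

/-! ### Divided differences -/

section Demazure

open MvPolynomial

variable {k : Type w} [Field k] {n : ℕ}

@[simp] theorem rename_simple_simple (r : Fin (n - 1)) (f : MvPolynomial (Fin n) k) :
    rename (simple r) (rename (simple r) f) = f := by
  rw [rename_rename]
  have : (simple r : Fin n → Fin n) ∘ simple r = id := funext fun a => simple_simple r a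
  rw [this, rename_id_apply]

theorem X_hi_sub_X_lo_ne_zero (r : Fin (n - 1)) :
    (X (hi r) - X (lo r) : MvPolynomial (Fin n) k) ≠ 0 :=
  sub_ne_zero.2 fun h => lo_ne_hi r (X_injective h).symm

theorem X_sub_dvd_sub_rename (r : Fin (n - 1)) (f : MvPolynomial (Fin n) k) :
    (X (hi r) - X (lo r) : MvPolynomial (Fin n) k) ∣ f - rename (simple r) f := by
  induction f using MvPolynomial.induction_on with
  | C c => simp
  | add p q hp hq =>
    rw [map_add, add_sub_add_comm]
    exact dvd_add hp hq
  | mul_X p a hp =>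
    have ha : (X (hi r) - X (lo r) : MvPolynomial (Fin n) k) ∣ X a - X (simple r a) := by
      rcases eq_or_ne a (lo r) with rfl | h1
      · rw [simple_lo]; exact (dvd_sub_comm).1 (dvd_refl _)
      rcases eq_or_ne a (hi r) with rfl | h2
      · rw [simple_hi]
      · rw [simple_of_ne h1 h2, sub_self]; exact dvd_zero _
    have : p * X a - rename (simple r) (p * X a)
        = p * (X a - X (simple r a)) + (p - rename (simple r) p) * X (simple r a) := by
      rw [map_mul, rename_X]; ring
    rw [this]
    exact dvd_add (ha.mul_left _) (hp.mul_right _)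

/-- The divided difference `(f - s_r f) / (x_{r+1} - x_r)`. -/
noncomputable def dem (r : Fin (n - 1)) : MvPolynomial (Fin n) k →ₗ[k] MvPolynomial (Fin n) k where
  toFun f := (X_sub_dvd_sub_rename r f).choose
  map_add' f g := mul_left_cancel₀ (X_hi_sub_X_lo_ne_zero r) (by
    rw [mul_add, ← (X_sub_dvd_sub_rename r (f + g)).choose_spec,
      ← (X_sub_dvd_sub_rename r f).choose_spec, ← (X_sub_dvd_sub_rename r g).choose_spec,
      map_add]; ring)
  map_smul' c f := mul_left_cancel₀ (X_hi_sub_X_lo_ne_zero r) (by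
    rw [RingHom.id_apply, mul_smul_comm, ← (X_sub_dvd_sub_rename r (c • f)).choose_spec,
      ← (X_sub_dvd_sub_rename r f).choose_spec, map_smul, smul_sub])

theorem dem_spec (r : Fin (n - 1)) (f : MvPolynomial (Fin n) k) :
    (X (hi r) - X (lo r)) * dem r f = f - rename (simple r) f :=
  (X_sub_dvd_sub_rename r f).choose_spec.symm

theorem eq_dem {r : Fin (n - 1)} {f g : MvPolynomial (Fin n) k}
    (h : (X (hi r) - X (lo r)) * g = f - rename (simple r) f) : g = dem r f :=
  mul_left_cancel₀ (X_hi_sub_X_lo_ne_zero r) (h.trans (dem_spec r f).symm)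

end Demazure

/-! ### The operators of single crossings -/

section Cross

open MvPolynomial

variable {k : Type w} [Field k] {V : Type u} [Quiver.{v} V] {n : ℕ}

open Classical in
/-- The operator by which the crossing of two strands labelled `a` and `b` (from left to right)
acts on polynomials: a divided difference if `a = b`, and otherwise the exchange of the variables,
multiplied by `(x_{r+1} - x_r) ^ h_{b,a}`. -/
noncomputable def cross (a b : V) (r : Fin (n - 1)) :
    MvPolynomial (Fin n) k →ₗ[k] MvPolynomial (Fin n) k :=
  if a = b then dem r else
    LinearMap.mulLeft k ((X (hi r) - X (lo r)) ^ arrowCount b a) ∘ₗ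
      (rename (simple r)).toLinearMap

theorem cross_self (a : V) (r : Fin (n - 1)) : cross (k := k) a a r = dem r := if_pos rfl

theorem cross_of_ne {a b : V} (h : a ≠ b) (r : Fin (n - 1)) (f : MvPolynomial (Fin n) k) :
    cross a b r f = (X (hi r) - X (lo r)) ^ arrowCount b a * rename (simple r) f := by
  rw [cross, if_neg h]; rfl

open Classical in
theorem cross_X_hi (a b : V) (r : Fin (n - 1)) (f : MvPolynomial (Fin n) k) :
    cross a b r (X (hi r) * f) = X (lo r) * cross a b r f + if a = b then f else 0 := by
  split_ifs with h
  · subst h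
    rw [cross_self]
    refine (eq_dem ?_).symm
    rw [map_mul, rename_X, simple_hi]
    linear_combination X (lo r) * dem_spec r f
  · rw [cross_of_ne h, cross_of_ne h, map_mul, rename_X, simple_hi]; ring

open Classical in
theorem X_hi_mul_cross (a b : V) (r : Fin (n - 1)) (f : MvPolynomial (Fin n) k) :
    X (hi r) * cross a b r f = cross a b r (X (lo r) * f) + if a = b then f else 0 := by
  split_ifs with h
  · subst h
    rw [cross_self, ← sub_eq_iff_eq_add]
    refine eq_dem ?_
    rw [map_mul, rename_X, simple_lo]
    linear_combination X (hi r) * dem_spec r f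
  · rw [cross_of_ne h, cross_of_ne h, map_mul, rename_X, simple_lo]; ring

theorem cross_X_of_ne (a b : V) {r : Fin (n - 1)} {s : Fin n} (h1 : s ≠ lo r) (h2 : s ≠ hi r)
    (f : MvPolynomial (Fin n) k) : cross a b r (X s * f) = X s * cross a b r f := by
  by_cases h : a = b
  · subst h
    rw [cross_self]
    refine (eq_dem ?_).symm
    rw [map_mul, rename_X, simple_of_ne h1 h2]
    linear_combination X s * dem_spec r f
  · rw [cross_of_ne h, cross_of_ne h, map_mul, rename_X, simple_of_ne h1 h2]; ring

theorem cross_cross (a b : V) (r : Fin (n - 1)) (f : MvPolynomial (Fin n) k) :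
    cross b a r (cross a b r f) = klrQ a b (X (lo r)) (X (hi r)) * f := by
  by_cases h : a = b
  · subst h
    rw [cross_self, klrQ, if_pos rfl, zero_mul]
    refine (eq_dem ?_).symm
    refine mul_left_cancel₀ (X_hi_sub_X_lo_ne_zero r) ?_
    have h1 := dem_spec r f
    have h2 := congrArg (rename (simple r)) h1
    simp only [map_mul, map_sub, rename_X, simple_hi, simple_lo, rename_simple_simple] at h2
    linear_combination -h1 - h2
  · rw [cross_of_ne (Ne.symm h), cross_of_ne h, klrQ, if_neg h]
    simp only [map_mul, map_pow, map_sub, rename_X, simple_hi, simple_lo, rename_simple_simple]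
    ring

/-- A form of the operators of crossings that is uniform in the two cases. -/
theorem cross_form (a b : V) (r : Fin (n - 1)) : ∃ δ A B : MvPolynomial (Fin n) k,
    δ ≠ 0 ∧ A ≠ 0 ∧ ∀ f, δ * cross a b r f = A * rename (simple r) f + B * f := by
  by_cases h : a = b
  · subst h
    refine ⟨_, -1, 1, X_hi_sub_X_lo_ne_zero r, by simp, fun f => ?_⟩
    rw [cross_self, dem_spec]; ring
  · exact ⟨1, _, 0, one_ne_zero, pow_ne_zero (arrowCount b a) (X_hi_sub_X_lo_ne_zero r), fun f => by
      rw [cross_of_ne h]; ring⟩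

theorem rename_simple_commute {r s : Fin (n - 1)} (h : r.1 + 1 < s.1)
    (f : MvPolynomial (Fin n) k) :
    rename (simple r) (rename (simple s) f) = rename (simple s) (rename (simple r) f) := by
  rw [rename_rename, rename_rename, ← Equiv.Perm.coe_mul, ← Equiv.Perm.coe_mul, simple_commute h]

theorem rename_simple_braid {r s : Fin (n - 1)} (h : s.1 = r.1 + 1)
    (f : MvPolynomial (Fin n) k) :
    rename (simple s) (rename (simple r) (rename (simple s) f))
      = rename (simple r) (rename (simple s) (rename (simple r) f)) := by
  simp only [rename_rename, ← Equiv.Perm.coe_mul, simple_braid h, ← mul_assoc]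

/-- A divided difference at `s` is determined by its product with `x_{s+1} - x_s`, and
multiplication by this difference commutes with the other crossing. -/
theorem cross_commute (a b c e : V) {r s : Fin (n - 1)} (h : r.1 + 1 < s.1)
    (f : MvPolynomial (Fin n) k) :
    cross a b r (cross c e s f) = cross c e s (cross a b r f) := by
  have n1 : lo s ≠ lo r := Fin.ne_of_val_ne (by simp only [lo_val]; omega)
  have n2 : lo s ≠ hi r := Fin.ne_of_val_ne (by simp only [hi_val, lo_val]; omega)
  have n3 : hi s ≠ lo r := Fin.ne_of_val_ne (by simp only [hi_val, lo_val]; omega)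
  have n4 : hi s ≠ hi r := Fin.ne_of_val_ne (by simp only [hi_val]; omega)
  by_cases hce : c = e
  · subst hce
    rw [cross_self]
    refine eq_dem ?_
    rw [sub_mul, ← cross_X_of_ne a b n3 n4, ← cross_X_of_ne a b n1 n2, ← map_sub, ← sub_mul,
      dem_spec, map_sub]
    congr 1
    by_cases hab : a = b
    · subst hab
      rw [cross_self]
      refine (eq_dem ?_).symm
      have := congrArg (rename (simple s)) (dem_spec r f)
      simp only [map_mul, map_sub, rename_X] at this
      rw [simple_of_ne n2.symm n4.symm, simple_of_ne n1.symm n3.symm] at this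
      rw [this, rename_simple_commute h]
    · rw [cross_of_ne hab, cross_of_ne hab, rename_simple_commute h]
      simp only [map_mul, map_sub, map_pow, rename_X]
      rw [simple_of_ne n2.symm n4.symm, simple_of_ne n1.symm n3.symm]
  · rw [cross_of_ne hce, cross_of_ne hce]
    by_cases hab : a = b
    · subst hab
      rw [cross_self]
      refine (eq_dem ?_).symm
      have := congrArg (rename (simple s)) (dem_spec r f)
      simp only [map_mul, map_sub, map_pow, rename_X] at this ⊢
      rw [simple_of_ne n2.symm n4.symm, simple_of_ne n1.symm n3.symm] at this
      rw [simple_of_ne n1 n2, simple_of_ne n3 n4, rename_simple_commute h]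
      linear_combination (X (hi s) - X (lo s)) ^ arrowCount e c * this
    · rw [cross_of_ne hab, cross_of_ne hab]
      simp only [map_mul, map_sub, map_pow, rename_X]
      rw [simple_of_ne n2.symm n4.symm, simple_of_ne n1.symm n3.symm, simple_of_ne n1 n2,
        simple_of_ne n3 n4, rename_simple_commute h]
      ring

open Classical in
/-- The braid relation, with its correction term, for the operators of crossings. The denominators
of the divided differences are cleared, after which both sides are combinations of the permutations
of `f`. -/
theorem cross_braid (a b c : V) {r s : Fin (n - 1)} (h : s.1 = r.1 + 1)
    (f : MvPolynomial (Fin n) k) :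
    cross a b s (cross a c r (cross b c s f)) - cross b c r (cross a c s (cross a b r f))
      = (if a = c then klrDiff a b (X (lo r)) (X (hi r)) (X (hi s)) else 0) * f := by
  have hlo : lo s = hi r := Fin.ext h
  have n1 : hi s ≠ lo r := Fin.ne_of_val_ne (by simp only [hi_val, lo_val]; omega)
  have n2 : hi s ≠ hi r := Fin.ne_of_val_ne (by simp only [hi_val]; omega)
  set x1 : MvPolynomial (Fin n) k := X (lo r) with hx1
  set x2 : MvPolynomial (Fin n) k := X (hi r) with hx2
  set x3 : MvPolynomial (Fin n) k := X (hi s) with hx3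
  have hs2 : (X (lo s) : MvPolynomial (Fin n) k) = x2 := by rw [hlo]
  set s1 : MvPolynomial (Fin n) k →ₐ[k] MvPolynomial (Fin n) k := rename (simple r) with hs1
  set s2 : MvPolynomial (Fin n) k →ₐ[k] MvPolynomial (Fin n) k := rename (simple s) with hss2
  have e11 : s1 x1 = x2 := by rw [hs1, hx1, rename_X, simple_lo]
  have e12 : s1 x2 = x1 := by rw [hs1, hx2, rename_X, simple_hi]
  have e13 : s1 x3 = x3 := by rw [hs1, hx3, rename_X, simple_of_ne n1 n2]
  have e21 : s2 x1 = x1 := by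
    rw [hss2, hx1, rename_X, simple_of_ne (hlo ▸ lo_ne_hi r) n1.symm]
  have e22 : s2 x2 = x3 := by rw [hss2, ← hs2, rename_X, simple_lo]
  have e23 : s2 x3 = x2 := by rw [hss2, hx3, rename_X, simple_hi, hs2]
  have q1 : ∀ g, s1 (s1 g) = g := rename_simple_simple r
  have q2 : ∀ g, s2 (s2 g) = g := rename_simple_simple s
  have qb : ∀ g, s2 (s1 (s2 g)) = s1 (s2 (s1 g)) := rename_simple_braid h
  have z12 : x2 - x1 ≠ 0 := X_hi_sub_X_lo_ne_zero r
  have z23 : x3 - x2 ≠ 0 := hs2 ▸ X_hi_sub_X_lo_ne_zero s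
  have z13 : x3 - x1 ≠ 0 := sub_ne_zero.2 fun h => n1 (X_injective h)
  have d1 : ∀ g, (x2 - x1) * dem r g = g - s1 g := dem_spec r
  have d2 : ∀ g, (x3 - x2) * dem s g = g - s2 g := fun g => by rw [← hs2]; exact dem_spec s g
  have c1 : ∀ {a b : V} (_ : a ≠ b) g, cross a b r g = (x2 - x1) ^ arrowCount b a * s1 g :=
    fun h g => cross_of_ne h r g
  have c2 : ∀ {a b : V} (_ : a ≠ b) g, cross a b s g = (x3 - x2) ^ arrowCount b a * s2 g :=
    fun h g => by rw [← hs2]; exact cross_of_ne h s g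
  -- the relations obtained from the defining ones by applying transpositions
  have d1s2 : ∀ g, (x3 - x1) * s2 (dem r g) = s2 g - s2 (s1 g) := fun g => by
    simpa only [map_mul, map_sub, e22, e21] using congrArg s2 (d1 g)
  have d1s12 : ∀ g, (x3 - x2) * s1 (s2 (dem r g)) = s1 (s2 g) - s1 (s2 (s1 g)) := fun g => by
    simpa only [map_mul, map_sub, e13, e11] using congrArg s1 (d1s2 g)
  have d2s1 : ∀ g, (x3 - x1) * s1 (dem s g) = s1 g - s1 (s2 g) := fun g => by
    simpa only [map_mul, map_sub, e13, e12] using congrArg s1 (d2 g)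
  have d2s21 : ∀ g, (x2 - x1) * s2 (s1 (dem s g)) = s2 (s1 g) - s1 (s2 (s1 g)) := fun g => by
    rw [← qb]
    simpa only [map_mul, map_sub, e23, e21] using congrArg s2 (d2s1 g)
  have d1s1 : ∀ g, s1 (dem r g) = dem r g := fun g => by
    refine mul_left_cancel₀ z12 ?_
    have := congrArg s1 (d1 g)
    simp only [map_mul, map_sub, e11, e12, q1] at this
    linear_combination -this - d1 g
  have d2s2 : ∀ g, s2 (dem s g) = dem s g := fun g => by
    refine mul_left_cancel₀ z23 ?_
    have := congrArg s2 (d2 g)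
    simp only [map_mul, map_sub, e22, e23, q2] at this
    linear_combination -this - d2 g
  by_cases hac : a = c
  · subst hac
    rw [if_pos rfl]
    by_cases hab : a = b
    · subst hab
      simp only [cross_self, klrDiff, if_true, zero_mul]
      rw [sub_eq_zero]
      refine mul_left_cancel₀ (mul_ne_zero (mul_ne_zero (mul_ne_zero z12 z13) z23)
        (mul_ne_zero z12 z23)) ?_
      -- both triple products are the antisymmetrisation of `f` divided by the Vandermonde product
      have hA : (x2 - x1) * (x3 - x1) * (x3 - x2) * dem s (dem r (dem s f))
          = f - s1 f - s2 f + s1 (s2 f) + s2 (s1 f) - s1 (s2 (s1 f)) := by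
        refine mul_left_cancel₀ z23 ?_
        have h1 := d2 (dem r (dem s f))
        have h2 := d1 (dem s f)
        have h3 := d1s2 (dem s f)
        rw [d2s2] at h3
        have h4 := d2 f
        have h5 := d2s1 f
        have h6 := d2s21 f
        linear_combination (x2 - x1) * (x3 - x1) * (x3 - x2) * h1
          + (x3 - x1) * (x3 - x2) * h2 - (x2 - x1) * (x3 - x2) * h3
          + ((x3 - x1) - (x2 - x1)) * h4 - (x3 - x2) * h5 + (x3 - x2) * h6
      have hB : (x2 - x1) * (x3 - x1) * (x3 - x2) * dem r (dem s (dem r f))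
          = f - s1 f - s2 f + s1 (s2 f) + s2 (s1 f) - s1 (s2 (s1 f)) := by
        refine mul_left_cancel₀ z12 ?_
        have h1 := d1 (dem s (dem r f))
        have h2 := d2 (dem r f)
        have h3 := d2s1 (dem r f)
        rw [d1s1] at h3
        have h4 := d1 f
        have h5 := d1s2 f
        have h6 := d1s12 f
        linear_combination (x2 - x1) * (x3 - x1) * (x3 - x2) * h1
          + (x3 - x1) * (x2 - x1) * h2 - (x2 - x1) * (x3 - x2) * h3
          + ((x3 - x1) - (x3 - x2)) * h4 - (x2 - x1) * h5 + (x2 - x1) * h6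
      linear_combination (x2 - x1) * (x3 - x2) * (hA - hB)
    · refine mul_left_cancel₀ z13 ?_
      rw [← mul_assoc, mul_klrDiff, klrQ, klrQ, if_neg hab, if_neg hab, cross_self, cross_self,
        c2 hab, c2 (Ne.symm hab), c1 hab, c1 (Ne.symm hab)]
      have h1 := d1s2 ((x3 - x2) ^ arrowCount a b * s2 f)
      have h2 := d2s1 ((x2 - x1) ^ arrowCount b a * s1 f)
      simp only [map_mul, map_pow, map_sub, e11, e12, e13, e21, e22, e23, q1, q2, qb] at h1 h2
      linear_combination (x3 - x2) ^ arrowCount b a * h1 - (x2 - x1) ^ arrowCount a b * h2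
  · rw [if_neg hac, zero_mul, sub_eq_zero]
    by_cases hab : a = b
    · subst hab
      rw [cross_self, cross_self, c1 hac, c2 hac, c2 hac, c1 hac]
      refine mul_left_cancel₀ z23 ?_
      rw [d2]
      have h1 := d1s12 f
      simp only [map_mul, map_pow, map_sub, e12, e13, e21, e22, e23, qb]
      linear_combination -((x2 - x1) ^ arrowCount c a * (x3 - x1) ^ arrowCount c a) * h1
    · by_cases hbc : b = c
      · subst hbc
        rw [cross_self, cross_self, c1 hac, c2 hac, c2 hac, c1 hac]
        refine mul_left_cancel₀ z12 ?_
        rw [d1]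
        have h1 := d2s21 f
        simp only [map_mul, map_pow, map_sub, e11, e12, e13, e21, e22]
        linear_combination ((x3 - x2) ^ arrowCount b a * (x3 - x1) ^ arrowCount b a) * h1
      · rw [c1 hac, c2 hac, c1 hab, c2 hab, c1 hbc, c2 hbc]
        simp only [map_mul, map_pow, map_sub, e11, e12, e13, e21, e22, e23, qb]
        ring

end Cross

/-! ### The polynomial representation -/

section PolRep

open MvPolynomial

variable (k : Type w) [Field k] {V : Type u} (β : V →₀ ℕ)

/-- The space of the polynomial representation: a polynomial for each sequence. -/
abbrev PolSpace : Type _ := seqs β → MvPolynomial (Fin β.degree) k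

open Classical in
/-- The projection by which `e(i)` acts. -/
noncomputable def polE (i : seqs β) : Module.End k (PolSpace k β) :=
  LinearMap.single k _ i ∘ₗ LinearMap.proj i

/-- The multiplication by a polynomial. -/
noncomputable def polMul : MvPolynomial (Fin β.degree) k →ₐ[k] Module.End k (PolSpace k β) :=
  Algebra.lsmul k k (PolSpace k β)

variable {β}

open Classical in
theorem polE_single (i j : seqs β) (f : MvPolynomial (Fin β.degree) k) :
    polE k β i (Pi.single j f) = if j = i then Pi.single j f else 0 := by
  unfold polE
  split_ifs with h
  · subst h; simp
  · simp [Pi.single_eq_of_ne (Ne.symm h)]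

theorem polE_apply_self (i : seqs β) (F : PolSpace k β) : polE k β i F i = F i := by
  classical
  simp [polE]

open Classical in
theorem polMul_single (p f : MvPolynomial (Fin β.degree) k) (j : seqs β) :
    polMul k β p (Pi.single j f) = Pi.single j (p * f) := by
  rw [polMul, Algebra.lsmul_coe, ← smul_eq_mul, Pi.single_smul]

theorem polMul_apply (p : MvPolynomial (Fin β.degree) k) (F : PolSpace k β) (j : seqs β) :
    polMul k β p F j = p * F j := rfl

theorem permSeq_simple_lo (r : Fin (β.degree - 1)) (i : seqs β) :
    (permSeq (simple r) i).1 (lo r) = i.1 (hi r) := by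
  rw [permSeq_apply, simple_inv, simple_lo]

theorem permSeq_simple_hi (r : Fin (β.degree - 1)) (i : seqs β) :
    (permSeq (simple r) i).1 (hi r) = i.1 (lo r) := by
  rw [permSeq_apply, simple_inv, simple_hi]

theorem permSeq_simple_of_ne {r : Fin (β.degree - 1)} {a : Fin β.degree} (h1 : a ≠ lo r)
    (h2 : a ≠ hi r) (i : seqs β) : (permSeq (simple r) i).1 a = i.1 a := by
  rw [permSeq_apply, simple_inv, simple_of_ne h1 h2]

theorem permSeq_simple_of_eq {r : Fin (β.degree - 1)} {i : seqs β} (h : i.1 (lo r) = i.1 (hi r)) :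
    permSeq (simple r) i = i := by
  refine Subtype.ext (funext fun a => ?_)
  rcases eq_or_ne a (lo r) with rfl | h1
  · rw [permSeq_simple_lo, h]
  rcases eq_or_ne a (hi r) with rfl | h2
  · rw [permSeq_simple_hi, h]
  · rw [permSeq_simple_of_ne h1 h2]

open Classical in
theorem mul_polE_ext {A B : Module.End k (PolSpace k β)} {i : seqs β}
    (h : ∀ f, A (Pi.single i f) = B (Pi.single i f)) : A * polE k β i = B * polE k β i := by
  refine LinearMap.pi_ext fun j f => ?_
  rw [Module.End.mul_apply, Module.End.mul_apply, polE_single]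
  split_ifs with hj
  · rw [hj, h]
  · rw [map_zero, map_zero]

variable [Quiver.{v} V]

variable (β) in
/-- The operator by which `τ_r` acts. -/
noncomputable def polTau (r : Fin (β.degree - 1)) : Module.End k (PolSpace k β) :=
  LinearMap.pi fun j => cross (j.1 (hi r)) (j.1 (lo r)) r ∘ₗ LinearMap.proj (permSeq (simple r) j)

theorem polTau_apply (r : Fin (β.degree - 1)) (F : PolSpace k β) (j : seqs β) :
    polTau k β r F j = cross (j.1 (hi r)) (j.1 (lo r)) r (F (permSeq (simple r) j)) := rfl

open Classical in
theorem polTau_single (r : Fin (β.degree - 1)) (i : seqs β) (f : MvPolynomial (Fin β.degree) k) :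
    polTau k β r (Pi.single i f)
      = Pi.single (permSeq (simple r) i) (cross (i.1 (lo r)) (i.1 (hi r)) r f) := by
  funext j
  rw [polTau_apply]
  by_cases h : j = permSeq (simple r) i
  · subst h
    rw [permSeq_simple_simple, Pi.single_eq_same, Pi.single_eq_same, permSeq_simple_hi,
      permSeq_simple_lo]
  · rw [Pi.single_eq_of_ne h, Pi.single_eq_of_ne, map_zero]
    rintro rfl
    exact h (permSeq_simple_simple r j).symm

theorem relations_pol :
    Relations k (polE k β) (fun r => polMul k β (X r)) (polTau k β) := by
  classical
  refine ⟨?_, ?_, ?_, ?_, ?_, ?_, ?_, ?_, ?_, ?_, ?_, ?_⟩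
  · intro i
    refine LinearMap.pi_ext fun j f => ?_
    rw [Module.End.mul_apply, polE_single]
    split_ifs with h
    · rw [polE_single, if_pos h]
    · rw [map_zero]
  · intro i i' hne
    refine LinearMap.pi_ext fun j f => ?_
    rw [Module.End.mul_apply, polE_single]
    split_ifs with h
    · rw [polE_single, if_neg (fun h' => hne (h'.symm.trans h)), LinearMap.zero_apply]
    · rw [map_zero, LinearMap.zero_apply]
  · refine LinearMap.pi_ext fun j f => ?_
    simp [LinearMap.sum_apply, polE_single]
  · intro r i
    refine LinearMap.pi_ext fun j f => ?_
    rw [Module.End.mul_apply, Module.End.mul_apply, polMul_single, polE_single, polE_single]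
    split_ifs with h
    · rw [polMul_single]
    · rw [map_zero]
  · intro r i i' hi'
    have hi'' : i' = permSeq (simple r) i := Subtype.ext (hi'.trans (permSeq_simple r i).symm)
    refine LinearMap.pi_ext fun j f => ?_
    rw [Module.End.mul_apply, Module.End.mul_apply, polTau_single, polE_single, polE_single]
    by_cases h : j = i
    · rw [if_pos h, if_pos (by rw [hi'', h]), polTau_single]
    · rw [if_neg h, if_neg, map_zero]
      intro h'
      rw [hi''] at h'
      exact h (by rw [← permSeq_simple_simple r j, h', permSeq_simple_simple])
  · intro r s
    rw [← map_mul, ← map_mul, mul_comm]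
  · intro r i
    refine mul_polE_ext k fun f => ?_
    simp only [Module.End.mul_apply, LinearMap.add_apply, polMul_single, polTau_single, cross_X_hi,
      Pi.single_add]
    congr 1
    split_ifs with h
    · rw [Module.End.one_apply, permSeq_simple_of_eq h]
    · rw [LinearMap.zero_apply, Pi.single_zero]
  · intro r i
    refine mul_polE_ext k fun f => ?_
    simp only [Module.End.mul_apply, LinearMap.add_apply, polMul_single, polTau_single,
      X_hi_mul_cross, Pi.single_add]
    congr 1
    split_ifs with h
    · rw [Module.End.one_apply, permSeq_simple_of_eq h]
    · rw [LinearMap.zero_apply, Pi.single_zero]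
  · intro r s h1 h2
    refine LinearMap.pi_ext fun j f => ?_
    simp only [Module.End.mul_apply, polMul_single, polTau_single, cross_X_of_ne _ _ h1 h2]
  · intro r s h
    have n1 : lo s ≠ lo r := Fin.ne_of_val_ne (by simp only [lo_val]; omega)
    have n2 : lo s ≠ hi r := Fin.ne_of_val_ne (by simp only [hi_val, lo_val]; omega)
    have n3 : hi s ≠ lo r := Fin.ne_of_val_ne (by simp only [hi_val, lo_val]; omega)
    have n4 : hi s ≠ hi r := Fin.ne_of_val_ne (by simp only [hi_val]; omega)
    refine LinearMap.pi_ext fun j f => ?_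
    simp only [Module.End.mul_apply, polTau_single]
    rw [permSeq_simple_of_ne n1 n2, permSeq_simple_of_ne n3 n4,
      permSeq_simple_of_ne n1.symm n3.symm, permSeq_simple_of_ne n2.symm n4.symm,
      cross_commute _ _ _ _ h, ← permSeq_mul, ← permSeq_mul,
      simple_commute h]
  · intro r i
    refine mul_polE_ext k fun f => ?_
    have hq := map_klrQ (I := V) (polMul k β).toRingHom (i.1 (lo r)) (i.1 (hi r)) (X (lo r))
      (X (hi r))
    simp only [AlgHom.toRingHom_eq_coe, RingHom.coe_coe] at hq
    rw [← hq, polMul_single, Module.End.mul_apply, polTau_single, polTau_single,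
      permSeq_simple_lo, permSeq_simple_hi, cross_cross, permSeq_simple_simple]
  · intro r s h i
    have hlo : lo s = hi r := Fin.ext h
    have n1 : hi s ≠ lo r := Fin.ne_of_val_ne (by simp only [hi_val, lo_val]; omega)
    have n2 : hi s ≠ hi r := Fin.ne_of_val_ne (by simp only [hi_val]; omega)
    have n3 : lo r ≠ lo s := hlo ▸ lo_ne_hi r
    refine mul_polE_ext k fun f => ?_
    have hq := map_klrDiff (I := V) (polMul k β).toRingHom (i.1 (lo r)) (i.1 (hi r)) (X (lo r))
      (X (hi r)) (X (hi s))
    simp only [AlgHom.toRingHom_eq_coe, RingHom.coe_coe] at hq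
    have hif : (if i.1 (lo r) = i.1 (hi s) then klrDiff (i.1 (lo r)) (i.1 (hi r))
        (polMul k β (X (lo r))) (polMul k β (X (hi r))) (polMul k β (X (hi s))) else 0)
        = polMul k β (if i.1 (lo r) = i.1 (hi s) then klrDiff (i.1 (lo r)) (i.1 (hi r))
          (X (lo r)) (X (hi r)) (X (hi s)) else 0) := by
      rw [apply_ite (polMul k β), map_zero, hq]
    have hp : permSeq (simple s) (permSeq (simple r) (permSeq (simple s) i))
        = permSeq (simple r) (permSeq (simple s) (permSeq (simple r) i)) := by
      simp only [← permSeq_mul, ← mul_assoc, simple_braid h]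
    rw [hif, polMul_single]
    simp only [LinearMap.sub_apply, Module.End.mul_apply, polTau_single]
    have rl := permSeq_simple_lo (β := β) r
    have rm := permSeq_simple_hi (β := β) r
    have rh := permSeq_simple_of_ne (β := β) (r := r) n1 n2
    have sl := permSeq_simple_of_ne (β := β) (r := s) n3 n1.symm
    have sm := permSeq_simple_lo (β := β) s
    have sh := permSeq_simple_hi (β := β) s
    rw [hlo] at sm sh
    rw [hp, ← Pi.single_sub]
    simp only [hlo, rl, rm, rh, sl, sm, sh, cross_braid _ _ _ h]
    split_ifs with hac
    · congr 1
      refine Subtype.ext (funext fun a => ?_)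
      rcases eq_or_ne a (lo r) with rfl | h1
      · rw [rl, sm, rh, hac]
      rcases eq_or_ne a (hi r) with rfl | h2
      · rw [rm, sl, rl]
      rcases eq_or_ne a (hi s) with rfl | h3
      · rw [rh, sh, rm, hac]
      · rw [permSeq_simple_of_ne h1 h2, permSeq_simple_of_ne (hlo ▸ h2) h3,
          permSeq_simple_of_ne h1 h2]
    · rw [zero_mul, Pi.single_zero, Pi.single_zero]

variable (β) in
/-- The polynomial representation of the KLR algebra. -/
noncomputable def polRep : Block k β →ₐ[k] Module.End k (PolSpace k β) :=
  (exists_lift (relations_pol k (β := β))).choose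

@[simp] theorem polRep_e (i : seqs β) : polRep k β (e k i) = polE k β i :=
  (exists_lift (relations_pol k (β := β))).choose_spec.1 i

@[simp] theorem polRep_x (r : Fin β.degree) : polRep k β (x k _ r) = polMul k β (X r) :=
  (exists_lift (relations_pol k (β := β))).choose_spec.2.1 r

@[simp] theorem polRep_tau (r : Fin (β.degree - 1)) : polRep k β (tau k _ r) = polTau k β r :=
  (exists_lift (relations_pol k (β := β))).choose_spec.2.2 r

end PolRep

/-! ### Linear independence of the operators of reduced words -/

section Independence

open MvPolynomial

variable (k : Type w) [Field k] {V : Type u} [Quiver.{v} V] {β : V →₀ ℕ}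

/-- The operator on polynomials by which the crossings of a word act on the sequence `i`. -/
noncomputable def wordOp (i : seqs β) : List (Fin (β.degree - 1)) →
    MvPolynomial (Fin β.degree) k →ₗ[k] MvPolynomial (Fin β.degree) k
  | [] => LinearMap.id
  | r :: l => cross ((permSeq (wordPerm l) i).1 (lo r)) ((permSeq (wordPerm l) i).1 (hi r)) r ∘ₗ
      wordOp i l

open Classical in
theorem polRep_wordTau_single (l : List (Fin (β.degree - 1))) (i : seqs β)
    (f : MvPolynomial (Fin β.degree) k) :
    polRep k β (wordTau k l) (Pi.single i f)
      = Pi.single (permSeq (wordPerm l) i) (wordOp k i l f) := by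
  induction l with
  | nil => simp [wordOp]
  | cons r l ih =>
    rw [wordTau_cons, map_mul, Module.End.mul_apply, ih, polRep_tau, polTau_single, wordPerm_cons,
      permSeq_mul]
    rfl

theorem polRep_polyHom (p : MvPolynomial (Fin β.degree) k) :
    polRep k β (polyHom k β p) = polMul k β p := by
  rw [← AlgHom.comp_apply]
  congr 1
  refine MvPolynomial.algHom_ext fun r => ?_
  rw [AlgHom.comp_apply, polyHom_X, polRep_x]

/-- After clearing denominators, the operator of a word for `w` is a combination of permutations
of the variables, with the leading term `w` if the word is reduced, and all other terms of smaller
length. -/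
theorem wordOp_expansion (i : seqs β) (l : List (Fin (β.degree - 1))) :
    ∃ D : MvPolynomial (Fin β.degree) k, ∃ c : Equiv.Perm (Fin β.degree) →
        MvPolynomial (Fin β.degree) k, D ≠ 0 ∧
      (∀ v, c v ≠ 0 → v = wordPerm l ∨ ∃ l', l'.length < l.length ∧ wordPerm l' = v) ∧
      (IsReduced l → c (wordPerm l) ≠ 0) ∧
      ∀ f, D * wordOp k i l f = ∑ v, c v * rename v f := by
  classical
  induction l with
  | nil =>
    refine ⟨1, fun v => if v = 1 then 1 else 0, one_ne_zero, fun v hv => Or.inl ?_,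
      fun _ => by simp, fun f => ?_⟩
    · by_contra h
      exact hv (if_neg h)
    · simp [wordOp]
  | cons r l ih =>
    obtain ⟨D, c, hD, hc, hlead, hf⟩ := ih
    obtain ⟨δ, A, B, hδ, hA, hcr⟩ := cross_form (k := k) ((permSeq (wordPerm l) i).1 (lo r))
      ((permSeq (wordPerm l) i).1 (hi r)) r
    have hinj : Function.Injective (rename (simple r) : MvPolynomial (Fin β.degree) k →ₐ[k] _) :=
      rename_injective _ (simple r).injective
    have hsD : rename (simple r) D ≠ 0 := (map_ne_zero_iff _ hinj).2 hD
    refine ⟨δ * D * rename (simple r) D, fun v => A * D * rename (simple r) (c (simple r * v))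
      + B * rename (simple r) D * c v, mul_ne_zero (mul_ne_zero hδ hD) hsD, ?_, ?_, ?_⟩
    · intro v hv
      by_cases h1 : c v = 0
      · have h2 : c (simple r * v) ≠ 0 := fun h2 => hv (by simp only [h1, h2, map_zero]; ring)
        rcases hc _ h2 with h | ⟨l', hl', h⟩
        · left
          rw [wordPerm_cons, ← h, ← mul_assoc, simple_mul_self, one_mul]
        · refine Or.inr ⟨r :: l', by simpa using hl', ?_⟩
          rw [wordPerm_cons, h, ← mul_assoc, simple_mul_self, one_mul]
      · right
        rcases hc _ h1 with h | ⟨l', hl', h⟩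
        · exact ⟨l, by simp, h.symm⟩
        · exact ⟨l', by simp only [List.length_cons]; omega, h⟩
    · intro hr
      have hz : c (wordPerm (r :: l)) = 0 := by
        by_contra hne
        rcases hc _ hne with h | ⟨l', hl', h⟩
        · have := len_wordPerm_le l
          rw [← h, hr, List.length_cons] at this
          omega
        · have := len_wordPerm_le l'
          rw [h, hr, List.length_cons] at this
          omega
      change A * D * rename (simple r) (c (simple r * wordPerm (r :: l)))
        + B * rename (simple r) D * c (wordPerm (r :: l)) ≠ 0
      rw [hz, mul_zero, add_zero, wordPerm_cons, ← mul_assoc (simple r), simple_mul_self, one_mul]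
      exact mul_ne_zero (mul_ne_zero hA hD) ((map_ne_zero_iff _ hinj).2 (hlead hr.of_cons))
    · intro f
      have h1 := congrArg (rename (simple r)) (hf f)
      rw [map_mul, map_sum, ← Equiv.sum_comp (Equiv.mulLeft (simple r))] at h1
      have h2 : ∀ v : Equiv.Perm (Fin β.degree),
          rename (simple r) (c (Equiv.mulLeft (simple r) v)
            * rename (Equiv.mulLeft (simple r) v) f)
          = rename (simple r) (c (simple r * v)) * rename v f := fun v => by
        rw [map_mul, rename_rename, Equiv.coe_mulLeft, ← Equiv.Perm.coe_mul, ← mul_assoc,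
          simple_mul_self, one_mul]
      simp only [h2] at h1
      change δ * D * rename (simple r) D * cross _ _ r (wordOp k i l f) = _
      simp only [add_mul, mul_assoc, Finset.sum_add_distrib, ← Finset.mul_sum]
      rw [← h1, ← hf f]
      linear_combination D * rename (simple r) D * hcr (wordOp k i l f)

/-- The permutations of the variables are linearly independent over polynomials, by Dedekind. -/
theorem eq_zero_of_sum_rename {σ : Type*} [Fintype σ] [DecidableEq σ]
    (c : Equiv.Perm σ → MvPolynomial σ k) (h : ∀ f, ∑ v, c v * rename v f = 0)
    (v : Equiv.Perm σ) : c v = 0 := by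
  have hl := linearIndependent_monoidHom (MvPolynomial σ k) (MvPolynomial σ k)
  have hinj : Function.Injective fun v : Equiv.Perm σ =>
      ((rename v : MvPolynomial σ k →ₐ[k] MvPolynomial σ k) :
        MvPolynomial σ k →* MvPolynomial σ k) := by
    intro v v' hv
    refine Equiv.ext fun a => X_injective (R := k) ?_
    have := DFunLike.congr_fun hv (X a)
    simpa using this
  have := Fintype.linearIndependent_iff.1 (hl.comp _ hinj) c (funext fun f => ?_) v
  · exact this
  · simpa [Finset.sum_apply] using h f

/-- A combination of the operators `τ_w p_w` that vanishes has `p_w = 0`: for `w` of maximal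
length with `p_w ≠ 0`, the permutation `w` of the variables occurs in the expansion of no other
term. -/
theorem independent_wordOp (i : seqs β)
    (p : Equiv.Perm (Fin β.degree) → MvPolynomial (Fin β.degree) k)
    (h : ∀ f, ∑ w, wordOp k i (redWord w) (p w * f) = 0) : p = 0 := by
  classical
  by_contra hp
  choose D c hD hc hlead hf using fun w => wordOp_expansion k i (redWord (d := β.degree) w)
  obtain ⟨w₀, hw₀⟩ : ∃ w, p w ≠ 0 := by
    by_contra! h'
    exact hp (funext h')
  -- a permutation of maximal length among those that occur
  obtain ⟨w, hw, hmax⟩ := Finset.exists_max_image (Finset.univ.filter fun w => p w ≠ 0) len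
    ⟨w₀, by simpa using hw₀⟩
  have hw : p w ≠ 0 := by simpa using hw
  -- the products of the denominators of the other terms
  let E : Equiv.Perm (Fin β.degree) → MvPolynomial (Fin β.degree) k :=
    fun w => ∏ w' ∈ Finset.univ.erase w, D w'
  have hE : ∀ w, E w ≠ 0 := fun w => Finset.prod_ne_zero_iff.2 fun w' _ => hD w'
  have hED : ∀ w, E w * D w = ∏ w', D w' := fun w => Finset.prod_erase_mul _ _ (Finset.mem_univ w)
  have key := eq_zero_of_sum_rename k
    (fun v => ∑ w', E w' * c w' v * rename v (p w')) (fun f => ?_) w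
  · rw [Finset.sum_eq_single w] at key
    · have h2 := hlead w (isReduced_redWord w)
      rw [wordPerm_redWord] at h2
      exact mul_ne_zero (mul_ne_zero (hE w) h2)
        ((map_ne_zero_iff _ (rename_injective _ w.injective)).2 hw) key
    · intro w' _ hne
      by_cases hp' : p w' = 0
      · rw [hp', map_zero, mul_zero]
      · have hle := hmax w' (by simpa using hp')
        have : c w' w = 0 := by
          by_contra hcn
          rcases hc w' w hcn with h1 | ⟨l', hl', h1⟩
          · exact hne (by rw [h1, wordPerm_redWord])
          · have := len_wordPerm_le l'
            rw [h1] at this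
            rw [length_redWord] at hl'
            omega
        rw [this, mul_zero, zero_mul]
    · simp
  · have h1 : (∏ w', D w') * ∑ w', wordOp k i (redWord w') (p w' * f) = 0 := by rw [h, mul_zero]
    rw [Finset.mul_sum] at h1
    rw [← h1]
    simp only [Finset.sum_mul]
    rw [Finset.sum_comm]
    refine Finset.sum_congr rfl fun w' _ => ?_
    rw [← hED w', mul_assoc, hf, Finset.mul_sum]
    refine Finset.sum_congr rfl fun v _ => ?_
    rw [map_mul]; ring

variable (β) in
/-- The coefficients of a combination of the elements `τ_w p(x) e(i)`. -/
abbrev Coeffs : Type _ := Equiv.Perm (Fin β.degree) → seqs β → MvPolynomial (Fin β.degree) k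

/-- The combination of the elements `τ_w p(x) e(i)` with given coefficients. -/
noncomputable def combine : Coeffs k β →ₗ[k] Block k β where
  toFun p := ∑ w, ∑ i, wordTau k (redWord w) * polyHom k β (p w i) * e k i
  map_add' p q := by
    simp only [Pi.add_apply, map_add, mul_add, add_mul, Finset.sum_add_distrib]
  map_smul' c p := by
    simp only [Pi.smul_apply, map_smul, mul_smul_comm, smul_mul_assoc, Finset.smul_sum,
      RingHom.id_apply]

theorem combine_apply (p : Coeffs k β) :
    combine k p = ∑ w, ∑ i, wordTau k (redWord w) * polyHom k β (p w i) * e k i := rfl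

open Classical in
theorem combine_single (w : Equiv.Perm (Fin β.degree)) (i : seqs β)
    (p : MvPolynomial (Fin β.degree) k) :
    combine k (Pi.single w (Pi.single i p)) = wordTau k (redWord w) * polyHom k β p * e k i := by
  rw [combine_apply, Finset.sum_eq_single w, Finset.sum_eq_single i, Pi.single_eq_same,
    Pi.single_eq_same]
  · intro j _ hj
    rw [Pi.single_eq_same, Pi.single_eq_of_ne hj, map_zero, mul_zero, zero_mul]
  · simp
  · intro w' _ hw
    simp [Pi.single_eq_of_ne hw]
  · simp

/-- The elements `τ_w p(x) e(i)` are independent as operators on polynomials. -/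
theorem polRep_combine_injective {p : Coeffs k β} (h : polRep k β (combine k p) = 0) : p = 0 := by
  classical
  have key : ∀ i, (fun w => p w i) = 0 := fun i => independent_wordOp k i _ fun f => by
    have h1 := congrArg (fun T : Module.End k (PolSpace k β) => ∑ j, T (Pi.single i f) j) h
    simp only [combine_apply, map_sum, map_mul, polRep_e, polRep_polyHom, LinearMap.sum_apply,
      Module.End.mul_apply, polE_single, apply_ite (polMul k β _), map_zero, polMul_single,
      apply_ite (polRep k β _), polRep_wordTau_single, Finset.sum_ite_eq, Finset.mem_univ, if_true,
      LinearMap.zero_apply, Pi.zero_apply, Finset.sum_const_zero, Finset.sum_apply] at h1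
    rw [Finset.sum_comm] at h1
    simpa using h1
  exact funext fun w => funext fun i => congrFun (key i) w

theorem filt_le_range_combine (n : ℕ) : filt k β n ≤ LinearMap.range (combine k (β := β)) := by
  classical
  induction n with
  | zero =>
    refine Submodule.span_le.2 ?_
    rintro _ ⟨l, y, hy, hl, rfl⟩
    exact absurd hl (Nat.not_lt_zero _)
  | succ n ih =>
    refine Submodule.span_le.2 ?_
    rintro _ ⟨l, y, hy, hl, rfl⟩
    have hle : filt k β l.length ≤ filt k β n := filt_mono k (by omega)
    by_cases hr : IsReduced l
    · have h1 := ih (hle (filt_mul_polySub (wordTau_sub_mem_filt (k := k) hr (isReduced_redWord _)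
        (wordPerm_redWord (wordPerm l)).symm) hy))
      rw [sub_mul] at h1
      refine (Submodule.sub_mem_iff_left _ ?_).1 h1
      rw [eq_sum_mul_e k (_ * y)]
      refine sum_mem fun i _ => ?_
      obtain ⟨p, hp⟩ := exists_polyHom_mul_e k hy i
      rw [mul_assoc, hp, ← mul_assoc]
      exact ⟨_, combine_single k _ _ _⟩
    · exact ih (hle (filt_mul_polySub (wordTau_mem_filt_of_not_isReduced hr) hy))

/-- The elements `τ_w p(x) e(i)` span the KLR algebra. -/
theorem combine_surjective : Function.Surjective (combine k (β := β)) := fun a => by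
  obtain ⟨n, hn⟩ := exists_mem_filt a
  exact filt_le_range_combine k n hn

/-- The polynomial representation is faithful. -/
theorem polRep_injective : Function.Injective (polRep k β) := by
  rw [injective_iff_map_eq_zero]
  intro a ha
  obtain ⟨p, rfl⟩ := combine_surjective k a
  rw [polRep_combine_injective k ha, map_zero]

end Independence

end KLR

/-! ### Combinatorics of the doubling map on sequences -/

section DoublingCombinatorics

open KLR

variable {I : Type u} (I₁ : Set I)

theorem dblVertex_of_mem {i : I} (h : i ∈ I₁) :
    dblVertex I₁ i = [.one ⟨i, h⟩, .two ⟨i, h⟩] := dif_pos h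

theorem dblVertex_of_notMem {i : I} (h : i ∉ I₁) : dblVertex I₁ i = [.zero ⟨i, h⟩] := dif_neg h

theorem dblList_cons (i : I) (l : List I) :
    dblList I₁ (i :: l) = dblVertex I₁ i ++ dblList I₁ l := by simp [dblList]

theorem dblList_append (l l' : List I) :
    dblList I₁ (l ++ l') = dblList I₁ l ++ dblList I₁ l' := by simp [dblList]

theorem dblList_injective : Function.Injective (dblList I₁) := by
  intro l
  induction l with
  | nil =>
    intro l' h
    cases l' with
    | nil => rfl
    | cons a l' =>
      by_cases ha : a ∈ I₁
      · simp [dblList, dblVertex_of_mem I₁ ha] at h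
      · simp [dblList, dblVertex_of_notMem I₁ ha] at h
  | cons b l ih =>
    intro l' h
    cases l' with
    | nil =>
      by_cases hb : b ∈ I₁
      · simp [dblList, dblVertex_of_mem I₁ hb] at h
      · simp [dblList, dblVertex_of_notMem I₁ hb] at h
    | cons a l' =>
      rw [dblList_cons, dblList_cons] at h
      by_cases ha : a ∈ I₁ <;> by_cases hb : b ∈ I₁
      · rw [dblVertex_of_mem I₁ ha, dblVertex_of_mem I₁ hb] at h
        simp only [List.cons_append, List.nil_append, List.cons.injEq, DoubledVertex.one.injEq,
          Subtype.mk.injEq] at h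
        rw [h.1, ih h.2.2]
      · rw [dblVertex_of_mem I₁ ha, dblVertex_of_notMem I₁ hb] at h
        simp at h
      · rw [dblVertex_of_notMem I₁ ha, dblVertex_of_mem I₁ hb] at h
        simp at h
      · rw [dblVertex_of_notMem I₁ ha, dblVertex_of_notMem I₁ hb] at h
        simp only [List.cons_append, List.nil_append, List.cons.injEq, DoubledVertex.zero.injEq,
          Subtype.mk.injEq] at h
        rw [h.1, ih h.2]

theorem dblDim_single (i : I) (n : ℕ) : dblDim I₁ (Finsupp.single i n)
    = n • ((dblVertex I₁ i).map fun v => Finsupp.single v 1).sum := by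
  rw [dblDim, Finsupp.sum_single_index (by simp)]

theorem dblDim_zero_apply (α : I →₀ ℕ) (i : (I₁ᶜ : Set I)) : dblDim I₁ α (.zero i) = α i := by
  classical
  induction α using Finsupp.induction_linear with
  | zero => simp [dblDim]
  | add f g hf hg => rw [dblDim_add, Finsupp.add_apply, hf, hg, Finsupp.add_apply]
  | single a n =>
    rw [dblDim_single]
    by_cases ha : a ∈ I₁
    · have : a ≠ i := fun h => i.2 (h ▸ ha)
      simp [dblVertex_of_mem I₁ ha, this]
    · simp [dblVertex_of_notMem I₁ ha, Finsupp.single_apply, Subtype.ext_iff]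

theorem dblDim_one_apply (α : I →₀ ℕ) (i : I₁) : dblDim I₁ α (.one i) = α i := by
  classical
  induction α using Finsupp.induction_linear with
  | zero => simp [dblDim]
  | add f g hf hg => rw [dblDim_add, Finsupp.add_apply, hf, hg, Finsupp.add_apply]
  | single a n =>
    rw [dblDim_single]
    by_cases ha : a ∈ I₁
    · simp [dblVertex_of_mem I₁ ha, Finsupp.single_apply, Subtype.ext_iff]
    · have : a ≠ i := fun h => ha (h ▸ i.2)
      simp [dblVertex_of_notMem I₁ ha, this]

theorem dblDim_two_apply (α : I →₀ ℕ) (i : I₁) : dblDim I₁ α (.two i) = α i := by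
  classical
  induction α using Finsupp.induction_linear with
  | zero => simp [dblDim]
  | add f g hf hg => rw [dblDim_add, Finsupp.add_apply, hf, hg, Finsupp.add_apply]
  | single a n =>
    rw [dblDim_single]
    by_cases ha : a ∈ I₁
    · simp [dblVertex_of_mem I₁ ha, Finsupp.single_apply, Subtype.ext_iff]
    · have : a ≠ i := fun h => ha (h ▸ i.2)
      simp [dblVertex_of_notMem I₁ ha, this]

theorem dblDim_injective : Function.Injective (dblDim I₁) := by
  intro α β h
  ext i
  by_cases hi : i ∈ I₁
  · rw [← dblDim_one_apply I₁ α ⟨i, hi⟩, h, dblDim_one_apply]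
  · rw [← dblDim_zero_apply I₁ α ⟨i, hi⟩, h, dblDim_zero_apply]

/-! ### Positions in a doubled sequence -/

variable {I₁} {α : I →₀ ℕ}

theorem dblPos_zero (i : seqs α) : dblPos I₁ i 0 = 0 := rfl

theorem dblPos_succ (i : seqs α) (r : Fin α.degree) :
    dblPos I₁ i (r.1 + 1) = dblPos I₁ i r.1 + (dblVertex I₁ (i.1 r)).length := by
  have h : r.1 < (List.ofFn i.1).length := by simp
  rw [dblPos, dblPos, ← List.take_append_getElem h, dblList_append, List.length_append]
  simp [dblList]

theorem dblPos_succ_of_mem {i : seqs α} {r : Fin α.degree} (h : i.1 r ∈ I₁) :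
    dblPos I₁ i (r.1 + 1) = dblPos I₁ i r.1 + 2 := by
  rw [dblPos_succ, dblVertex_of_mem I₁ h]; rfl

theorem dblPos_succ_of_notMem {i : seqs α} {r : Fin α.degree} (h : i.1 r ∉ I₁) :
    dblPos I₁ i (r.1 + 1) = dblPos I₁ i r.1 + 1 := by
  rw [dblPos_succ, dblVertex_of_notMem I₁ h]; rfl

theorem dblPos_degree (i : seqs α) : dblPos I₁ i α.degree = (dblDim I₁ α).degree := by
  rw [← dblList_length I₁ i, dblPos, List.take_of_length_le (by simp)]

theorem dblPos_lt_succ (i : seqs α) (r : Fin α.degree) :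
    dblPos I₁ i r.1 < dblPos I₁ i (r.1 + 1) := by
  by_cases h : i.1 r ∈ I₁
  · rw [dblPos_succ_of_mem h]; omega
  · rw [dblPos_succ_of_notMem h]; omega

theorem dblPos_mono (i : seqs α) {m n : ℕ} (h : m ≤ n) : dblPos I₁ i m ≤ dblPos I₁ i n := by
  obtain ⟨c, rfl⟩ := Nat.exists_eq_add_of_le h
  rw [dblPos, dblPos, List.take_add, dblList_append, List.length_append]
  omega

theorem dblPos_succ_le (i : seqs α) {r s : Fin α.degree} (h : r < s) :
    dblPos I₁ i (r.1 + 1) ≤ dblPos I₁ i s.1 := dblPos_mono i h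

theorem dblPos_succ_le_degree (i : seqs α) (r : Fin α.degree) :
    dblPos I₁ i (r.1 + 1) ≤ (dblDim I₁ α).degree :=
  (dblPos_mono i r.2).trans (dblPos_degree i).le

theorem dblPos_lt_degree (i : seqs α) (r : Fin α.degree) :
    dblPos I₁ i r.1 < (dblDim I₁ α).degree :=
  (dblPos_lt_succ i r).trans_le (dblPos_succ_le_degree i r)

theorem dblPos_add_one_lt_degree {i : seqs α} {r : Fin α.degree} (h : i.1 r ∈ I₁) :
    dblPos I₁ i r.1 + 1 < (dblDim I₁ α).degree := by
  have := dblPos_succ_le_degree (I₁ := I₁) i r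
  rw [dblPos_succ_of_mem h] at this
  omega

/-- The position in `φ(i)` at which the image of the `r`-th entry of `i` starts. -/
noncomputable def startPos (I₁ : Set I) (i : seqs α) (r : Fin α.degree) :
    Fin (dblDim I₁ α).degree := ⟨dblPos I₁ i r.1, dblPos_lt_degree i r⟩

theorem startPos_val (i : seqs α) (r : Fin α.degree) :
    (startPos I₁ i r).1 = dblPos I₁ i r.1 := rfl

theorem dblSeq_apply_add (i : seqs α) (r : Fin α.degree) {m : ℕ}
    (hm : m < (dblVertex I₁ (i.1 r)).length) {a : Fin (dblDim I₁ α).degree}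
    (ha : a.1 = dblPos I₁ i r.1 + m) : (dblSeq I₁ i).1 a = (dblVertex I₁ (i.1 r))[m] := by
  have h : r.1 < (List.ofFn i.1).length := by simp
  have hl : dblList I₁ (List.ofFn i.1) = dblList I₁ ((List.ofFn i.1).take r.1) ++
      (dblVertex I₁ (i.1 r) ++ dblList I₁ ((List.ofFn i.1).drop (r.1 + 1))) := by
    rw [← dblList_cons, ← dblList_append]
    congr 1
    have h1 : i.1 r = (List.ofFn i.1)[r.1] := by simp
    rw [h1, ← List.drop_eq_getElem_cons h, List.take_append_drop]
  change (dblList I₁ (List.ofFn i.1))[a.1]'_ = _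
  have h2 : ∀ (l : List (DoubledVertex I I₁)) (n : ℕ) (hn : n < l.length),
      l = dblList I₁ ((List.ofFn i.1).take r.1) ++
      (dblVertex I₁ (i.1 r) ++ dblList I₁ ((List.ofFn i.1).drop (r.1 + 1))) →
      n = dblPos I₁ i r.1 + m → l[n] = (dblVertex I₁ (i.1 r))[m] := by
    rintro l n hn rfl rfl
    rw [List.getElem_append_right (by unfold dblPos; omega), List.getElem_append_left]
    · congr 1
      unfold dblPos
      omega
    · unfold dblPos
      omega
  exact h2 _ _ _ hl ha

theorem dblSeq_of_notMem {i : seqs α} {r : Fin α.degree} (h : i.1 r ∉ I₁)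
    {a : Fin (dblDim I₁ α).degree} (ha : a.1 = dblPos I₁ i r.1) :
    (dblSeq I₁ i).1 a = .zero ⟨i.1 r, h⟩ := by
  rw [dblSeq_apply_add (m := 0) i r (by simp [dblVertex_of_notMem I₁ h]) ha]
  simp [dblVertex_of_notMem I₁ h]

theorem dblSeq_one {i : seqs α} {r : Fin α.degree} (h : i.1 r ∈ I₁)
    {a : Fin (dblDim I₁ α).degree} (ha : a.1 = dblPos I₁ i r.1) :
    (dblSeq I₁ i).1 a = .one ⟨i.1 r, h⟩ := by
  rw [dblSeq_apply_add (m := 0) i r (by simp [dblVertex_of_mem I₁ h]) ha]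
  simp [dblVertex_of_mem I₁ h]

theorem dblSeq_two {i : seqs α} {r : Fin α.degree} (h : i.1 r ∈ I₁)
    {a : Fin (dblDim I₁ α).degree} (ha : a.1 = dblPos I₁ i r.1 + 1) :
    (dblSeq I₁ i).1 a = .two ⟨i.1 r, h⟩ := by
  rw [dblSeq_apply_add (m := 1) i r (by simp [dblVertex_of_mem I₁ h]) ha]
  simp [dblVertex_of_mem I₁ h]

theorem exists_dblPos_le_lt (i : seqs α) (a : Fin (dblDim I₁ α).degree) :
    ∃ r : Fin α.degree, dblPos I₁ i r.1 ≤ a.1 ∧ a.1 < dblPos I₁ i (r.1 + 1) := by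
  classical
  have hex : ∃ n, a.1 < dblPos I₁ i n := ⟨α.degree, by rw [dblPos_degree]; exact a.2⟩
  have hpos : Nat.find hex ≠ 0 := fun h => by
    have := Nat.find_spec hex
    rw [h, dblPos_zero] at this
    omega
  obtain ⟨m, hm⟩ := Nat.exists_eq_succ_of_ne_zero hpos
  have hle : Nat.find hex ≤ α.degree := Nat.find_min' hex (by rw [dblPos_degree]; exact a.2)
  refine ⟨⟨m, by omega⟩, ?_, ?_⟩
  · exact not_lt.1 (Nat.find_min hex (m := m) (by omega))
  · have := Nat.find_spec hex
    rwa [hm] at this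

/-- The index of the entry of `i` from whose image the entry of `φ(i)` at `a` comes. -/
noncomputable def blk (I₁ : Set I) (i : seqs α) (a : Fin (dblDim I₁ α).degree) : Fin α.degree :=
  (exists_dblPos_le_lt i a).choose

theorem dblPos_blk_le (i : seqs α) (a : Fin (dblDim I₁ α).degree) :
    dblPos I₁ i (blk I₁ i a).1 ≤ a.1 := (exists_dblPos_le_lt i a).choose_spec.1

theorem lt_dblPos_blk_succ (i : seqs α) (a : Fin (dblDim I₁ α).degree) :
    a.1 < dblPos I₁ i ((blk I₁ i a).1 + 1) := (exists_dblPos_le_lt i a).choose_spec.2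

theorem blk_eq {i : seqs α} {a : Fin (dblDim I₁ α).degree} {r : Fin α.degree}
    (h1 : dblPos I₁ i r.1 ≤ a.1) (h2 : a.1 < dblPos I₁ i (r.1 + 1)) : blk I₁ i a = r := by
  have h3 := dblPos_blk_le i a
  have h4 := lt_dblPos_blk_succ i a
  rcases lt_trichotomy (blk I₁ i a) r with h | h | h
  · have := dblPos_succ_le (I₁ := I₁) i h
    omega
  · exact h
  · have := dblPos_succ_le (I₁ := I₁) i h
    omega

theorem blk_eq_of_val_eq {i : seqs α} {a : Fin (dblDim I₁ α).degree} {r : Fin α.degree}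
    (h : a.1 = dblPos I₁ i r.1) : blk I₁ i a = r :=
  blk_eq h.ge (h ▸ dblPos_lt_succ i r)

theorem blk_eq_of_val_eq_succ {i : seqs α} {a : Fin (dblDim I₁ α).degree} {r : Fin α.degree}
    (hr : i.1 r ∈ I₁) (h : a.1 = dblPos I₁ i r.1 + 1) : blk I₁ i a = r :=
  blk_eq (by omega) (by rw [dblPos_succ_of_mem hr]; omega)

@[simp] theorem blk_startPos (i : seqs α) (r : Fin α.degree) :
    blk I₁ i (startPos I₁ i r) = r := blk_eq_of_val_eq rfl

theorem val_eq_or (i : seqs α) (a : Fin (dblDim I₁ α).degree) :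
    a = startPos I₁ i (blk I₁ i a) ∨
      (i.1 (blk I₁ i a) ∈ I₁ ∧ a.1 = dblPos I₁ i (blk I₁ i a).1 + 1) := by
  have h3 := dblPos_blk_le i a
  have h4 := lt_dblPos_blk_succ i a
  by_cases h : i.1 (blk I₁ i a) ∈ I₁
  · rw [dblPos_succ_of_mem h] at h4
    rcases eq_or_lt_of_le h3 with h5 | h5
    · exact Or.inl (Fin.ext h5.symm)
    · exact Or.inr ⟨h, by omega⟩
  · rw [dblPos_succ_of_notMem h] at h4
    exact Or.inl (Fin.ext (by rw [startPos_val]; omega))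

theorem startPos_injective (i : seqs α) : Function.Injective (startPos I₁ i) := fun r s h => by
  rw [← blk_startPos i r, h, blk_startPos]

/-! ### Positions after the exchange of two adjacent entries -/

theorem dblPos_permSeq_of_le (i : seqs α) (r : Fin (α.degree - 1)) {n : ℕ} (h : n ≤ r.1) :
    dblPos I₁ (permSeq (simple r) i) n = dblPos I₁ i n := by
  induction n with
  | zero => rfl
  | succ n ih =>
    have hn : n < α.degree := by have := r.2; omega
    rw [dblPos_succ _ ⟨n, hn⟩, dblPos_succ _ ⟨n, hn⟩, ih (by omega),
      permSeq_simple_of_ne (Fin.ne_of_val_ne (by rw [lo_val]; dsimp only; omega))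
        (Fin.ne_of_val_ne (by rw [hi_val]; dsimp only; omega))]

theorem dblPos_permSeq_hi (i : seqs α) (r : Fin (α.degree - 1)) :
    dblPos I₁ (permSeq (simple r) i) (r.1 + 1)
      = dblPos I₁ i r.1 + (dblVertex I₁ (i.1 (hi r))).length := by
  have h := dblPos_succ (I₁ := I₁) (permSeq (simple r) i) (lo r)
  rwa [permSeq_simple_lo, lo_val, dblPos_permSeq_of_le i r le_rfl] at h

theorem dblPos_add_two (i : seqs α) (r : Fin (α.degree - 1)) :
    dblPos I₁ i (r.1 + 2) = dblPos I₁ i r.1 + (dblVertex I₁ (i.1 (lo r))).length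
      + (dblVertex I₁ (i.1 (hi r))).length := by
  have h := dblPos_succ (I₁ := I₁) i (hi r)
  have h' := dblPos_succ (I₁ := I₁) i (lo r)
  rw [lo_val] at h'
  rwa [hi_val, h'] at h

theorem dblPos_permSeq_of_ge (i : seqs α) (r : Fin (α.degree - 1)) {n : ℕ} (h : r.1 + 2 ≤ n)
    (hn : n ≤ α.degree) : dblPos I₁ (permSeq (simple r) i) n = dblPos I₁ i n := by
  induction n, h using Nat.le_induction with
  | base =>
    rw [dblPos_add_two, dblPos_add_two, permSeq_simple_lo, permSeq_simple_hi,
      dblPos_permSeq_of_le i r le_rfl]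
    omega
  | succ n h ih =>
    rw [dblPos_succ _ ⟨n, hn⟩, dblPos_succ _ ⟨n, hn⟩, ih (by omega),
      permSeq_simple_of_ne (Fin.ne_of_val_ne (by rw [lo_val]; dsimp only; omega))
        (Fin.ne_of_val_ne (by rw [hi_val]; dsimp only; omega))]

/-! ### Well-ordered sequences are doubled sequences -/

theorem dblSeq_injective : Function.Injective (dblSeq I₁ : seqs α → _) := by
  intro i j h
  have h1 : dblList I₁ (List.ofFn i.1) = dblList I₁ (List.ofFn j.1) := by
    refine List.ext_getElem (by rw [dblList_length, dblList_length]) fun n h1 h2 => ?_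
    have h3 := congrArg Subtype.val h
    exact congrFun h3 ⟨n, by rwa [dblList_length] at h1⟩
  exact Subtype.ext (List.ofFn_injective (dblList_injective I₁ h1))

theorem isWellOrdered_dblSeq (i : seqs α) :
    IsWellOrdered (DoubledVertex.one (I₁ := I₁)) DoubledVertex.two (dblSeq I₁ i).1 := by
  intro a j ha
  have hb := val_eq_or i a
  set r := blk I₁ i a with hr
  by_cases h : i.1 r ∈ I₁
  · rcases hb with h1 | ⟨-, h1⟩
    · have h2 : a.1 = dblPos I₁ i r.1 := congrArg Fin.val h1
      refine ⟨by rw [h2]; exact dblPos_add_one_lt_degree h, ?_⟩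
      rw [dblSeq_one h h2] at ha
      rw [dblSeq_two h (by dsimp only; rw [h2]), DoubledVertex.one.inj ha]
    · rw [dblSeq_two h h1] at ha
      cases ha
  · rcases hb with h1 | ⟨h1, -⟩
    · rw [dblSeq_of_notMem h (congrArg Fin.val h1)] at ha
      cases ha
    · exact absurd h1 h

/-- The property of being well-ordered, for lists. -/
def ListWellOrdered (l : List (DoubledVertex I I₁)) : Prop :=
  ∀ (n : ℕ) (h : n < l.length) (j : I₁), l[n] = .one j → ∃ h' : n + 1 < l.length, l[n + 1] = .two j

theorem ListWellOrdered.tail {v : DoubledVertex I I₁} {l : List (DoubledVertex I I₁)}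
    (h : ListWellOrdered (v :: l)) : ListWellOrdered l := by
  intro n hn j hj
  obtain ⟨h', h2⟩ := h (n + 1) (by simpa using hn) j (by simpa using hj)
  exact ⟨by simpa using h', by simpa using h2⟩

theorem ListWellOrdered.exists_eq_cons {j : I₁} {l : List (DoubledVertex I I₁)}
    (h : ListWellOrdered (.one j :: l)) : ∃ l', l = .two j :: l' := by
  obtain ⟨h', h2⟩ := h 0 (by simp) j rfl
  cases l with
  | nil => simp at h'
  | cons a l => exact ⟨l, by simpa using h2⟩

/-- The dimension vector of a list. -/
noncomputable def listWeight {V : Type u} (l : List V) : V →₀ ℕ :=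
  (l.map fun v => Finsupp.single v 1).sum

theorem listWeight_cons {V : Type u} (a : V) (l : List V) :
    listWeight (a :: l) = Finsupp.single a 1 + listWeight l := by simp [listWeight]

theorem ListWellOrdered.weight_le (n : ℕ) : ∀ l : List (DoubledVertex I I₁), l.length ≤ n →
    ListWellOrdered l → ∀ j, listWeight l (.one j) ≤ listWeight l (.two j) := by
  classical
  induction n with
  | zero =>
    intro l hl _ j
    rw [Nat.le_zero, List.length_eq_zero_iff] at hl
    simp [hl, listWeight]
  | succ n ih =>
    intro l hl h j
    cases l with
    | nil => simp [listWeight]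
    | cons v l =>
      rw [List.length_cons] at hl
      have h1 := ih l (by omega) h.tail j
      cases v with
      | zero i => simpa [listWeight_cons] using h1
      | one i =>
        obtain ⟨l', rfl⟩ := h.exists_eq_cons
        rw [List.length_cons] at hl
        have h2 := ih l' (by omega) h.tail.tail j
        simp only [listWeight_cons, Finsupp.add_apply, Finsupp.single_apply,
          DoubledVertex.one.injEq, DoubledVertex.two.injEq, reduceCtorEq, if_false]
        omega
      | two i =>
        simp only [listWeight_cons, Finsupp.add_apply, Finsupp.single_apply, reduceCtorEq,
          if_false]
        omega

theorem ListWellOrdered.exists_dblList (n : ℕ) : ∀ l : List (DoubledVertex I I₁), l.length ≤ n →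
    ListWellOrdered l → (∀ j, listWeight l (.one j) = listWeight l (.two j)) →
    ∃ l', dblList I₁ l' = l := by
  classical
  induction n with
  | zero =>
    intro l hl _ _
    rw [Nat.le_zero, List.length_eq_zero_iff] at hl
    exact ⟨[], by rw [hl]; rfl⟩
  | succ n ih =>
    intro l hl h hw
    cases l with
    | nil => exact ⟨[], rfl⟩
    | cons v l =>
      rw [List.length_cons] at hl
      cases v with
      | zero i =>
        obtain ⟨l', rfl⟩ := ih l (by omega) h.tail fun j => by
          simpa [listWeight_cons] using hw j
        exact ⟨i :: l', by rw [dblList_cons, dblVertex_of_notMem I₁ i.2]; rfl⟩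
      | one i =>
        obtain ⟨l, rfl⟩ := h.exists_eq_cons
        rw [List.length_cons] at hl
        obtain ⟨l', rfl⟩ := ih l (by omega) h.tail.tail fun j => by
          have := hw j
          simp only [listWeight_cons, Finsupp.add_apply, Finsupp.single_apply,
            DoubledVertex.one.injEq, DoubledVertex.two.injEq, reduceCtorEq, if_false] at this
          omega
        exact ⟨i :: l', by rw [dblList_cons, dblVertex_of_mem I₁ i.2]; rfl⟩
      | two i =>
        have h1 := ListWellOrdered.weight_le n l (by omega) h.tail i
        have h2 := hw i
        simp only [listWeight_cons, Finsupp.add_apply, Finsupp.single_apply,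
          reduceCtorEq, if_false, if_true] at h2
        omega

/-- The well-ordered sequences of weight `ᾱ` are the doubled sequences. -/
theorem exists_dblSeq_eq {j : seqs (dblDim I₁ α)}
    (h : IsWellOrdered (DoubledVertex.one (I₁ := I₁)) DoubledVertex.two j.1) :
    ∃ i : seqs α, dblSeq I₁ i = j := by
  have hw : listWeight (List.ofFn j.1) = dblDim I₁ α := weight_ofFn j
  have hwo : ListWellOrdered (List.ofFn j.1) := by
    intro n hn i hi
    have hn' : n < (dblDim I₁ α).degree := by simpa using hn
    obtain ⟨h', h2⟩ := h ⟨n, hn'⟩ i (by simpa using hi)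
    exact ⟨by simpa using h', by simpa using h2⟩
  obtain ⟨l, hl⟩ := ListWellOrdered.exists_dblList _ _ le_rfl hwo fun i => by
    rw [hw, dblDim_one_apply, dblDim_two_apply]
  have hlw : listWeight l = α := by
    refine dblDim_injective I₁ ?_
    rw [← hw, ← hl]
    exact (dblList_weight I₁ l).symm
  have hlen : l.length = α.degree := by rw [← hlw]; exact (degree_weight l).symm
  have hof : List.ofFn (fun r : Fin α.degree => l.get (Fin.cast hlen.symm r)) = l := by
    refine List.ext_getElem (by simp [hlen]) fun n h1 h2 => by simp
  refine ⟨⟨fun r => l.get (Fin.cast hlen.symm r), ?_⟩, ?_⟩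
  · change ∑ r, Finsupp.single _ 1 = α
    conv_rhs => rw [← hlw, ← hof]
    rw [listWeight, List.map_ofFn, List.sum_ofFn]
    rfl
  · refine Subtype.ext (funext fun a => ?_)
    change (dblList I₁ (List.ofFn (fun r : Fin α.degree => l.get (Fin.cast hlen.symm r))))[a.1]'_
      = j.1 a
    simp only [hof, hl, List.getElem_ofFn]

end DoublingCombinatorics

namespace KLR

/-! ### Balanced KLR algebras as quotients -/

section BalancedApi

variable {k : Type w} [Field k]

theorem toCorner_add {A : Type*} [Ring A] [Algebra k A] {ε : A} (hε : IsIdempotentElem ε)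
    (a b : A) : toCorner hε (a + b) = toCorner hε a + toCorner hε b :=
  Subtype.ext (by
    change ε * (a + b) * ε = ε * a * ε + ε * b * ε
    rw [mul_add, add_mul])

theorem toCorner_smul {A : Type*} [Ring A] [Algebra k A] {ε : A} (hε : IsIdempotentElem ε)
    (c : k) (a : A) : toCorner hε (c • a) = c • toCorner hε a :=
  Subtype.ext (by
    change ε * (c • a) * ε = c • (ε * a * ε)
    rw [mul_smul_comm, smul_mul_assoc])

theorem toCorner_mul {A : Type*} [Ring A] {ε : A} (hε : IsIdempotentElem ε)
    (a b : A) : toCorner hε a * toCorner hε b = toCorner hε (a * ε * b) :=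
  Subtype.ext (by
    change (ε * a * ε) * (ε * b * ε) = ε * (a * ε * b) * ε
    simp only [← mul_assoc, mul_assoc _ ε ε, hε.eq])

theorem toCorner_val {A : Type*} [Ring A] {ε : A} (hε : IsIdempotentElem ε) (a : A) :
    (toCorner hε a).1 = ε * a * ε := rfl

theorem toCorner_one {A : Type*} [Ring A] {ε : A} (hε : IsIdempotentElem ε) :
    toCorner hε 1 = 1 :=
  Subtype.ext (by
    change ε * 1 * ε = ε
    rw [mul_one, hε.eq])

theorem toCorner_surjective {A : Type*} [Ring A] {ε : A} (hε : IsIdempotentElem ε) :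
    Function.Surjective (toCorner hε) := by
  rintro ⟨_, a, rfl⟩
  exact ⟨a, rfl⟩

variable (k) {V : Type u} [Quiver.{v} V] {J : Type*} (one two : J → V) (β : V →₀ ℕ)

theorem toBalanced_surjective : Function.Surjective (toBalanced k one two β) := by
  intro y
  obtain ⟨z, rfl⟩ := (unIdeal k one two β).ringCon.mk'_surjective y
  obtain ⟨a, rfl⟩ := toCorner_surjective (ordIdem_isIdempotentElem k one two β) z
  exact ⟨a, rfl⟩

/-- The class map as a linear map. -/
noncomputable def toBalancedLin : Block k β →ₗ[k] Balanced k one two β where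
  toFun := toBalanced k one two β
  map_add' a b := by
    unfold toBalanced
    rw [toCorner_add (k := k)]
    rfl
  map_smul' c a := by
    unfold toBalanced
    rw [toCorner_smul]
    rfl

theorem toBalancedLin_apply (a : Block k β) :
    toBalancedLin k one two β a = toBalanced k one two β a := rfl

theorem toBalanced_one : toBalanced k one two β 1 = 1 := by
  unfold toBalanced
  rw [toCorner_one]
  rfl

theorem toBalanced_mul_of_mul_ordIdem {a : Block k β} (ha : a * ordIdem k one two β = a)
    (b : Block k β) :
    toBalanced k one two β (a * b) = toBalanced k one two β a * toBalanced k one two β b := by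
  conv_lhs => rw [← ha]
  unfold toBalanced
  rw [← toCorner_mul]
  rfl

theorem toBalanced_eq_zero {i : seqs β} (hi : IsUnordered one two i.1) (a b : Block k β) :
    toBalanced k one two β (a * e k i * b) = 0 := by
  have h : toCorner (ordIdem_isIdempotentElem k one two β) (a * e k i * b)
      ∈ unIdeal k one two β := TwoSidedIdeal.subset_span ⟨i, a, b, hi, rfl⟩
  exact (RingCon.eq _).2 ((TwoSidedIdeal.mem_iff _ _).1 h)

open Classical in
theorem e_mul_ordIdem (i : seqs β) : e k i * ordIdem k one two β
    = if IsWellOrdered one two i.1 then e k i else 0 :=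
  e_mul_eSum k {i : seqs β | IsWellOrdered one two i.1} i

open Classical in
theorem ordIdem_mul_e (i : seqs β) : ordIdem k one two β * e k i
    = if IsWellOrdered one two i.1 then e k i else 0 :=
  eSum_mul_e k {i : seqs β | IsWellOrdered one two i.1} i

theorem toBalanced_e_mul_eq_zero {i : seqs β} (hi : ¬ IsWellOrdered one two i.1) (a : Block k β) :
    toBalanced k one two β (e k i * a) = 0 := by
  have h : toCorner (ordIdem_isIdempotentElem k one two β) (e k i * a) = 0 := Subtype.ext (by
    rw [toCorner_val, ← mul_assoc, ordIdem_mul_e, if_neg hi, zero_mul, zero_mul]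
    rfl)
  unfold toBalanced
  rw [h]
  rfl

variable {k one two β}

/-- The universal property of the balanced algebra as a quotient of `𝐞 R_β 𝐞`. -/
theorem exists_balanced_lift {B : Type*} [Ring B] [Algebra k B] (f : OrdCorner k one two β →ₐ[k] B)
    (hf : ∀ (i : seqs β) (a b : Block k β), IsUnordered one two i.1 →
      f (toCorner (ordIdem_isIdempotentElem k one two β) (a * e k i * b)) = 0) :
    ∃ g : Balanced k one two β →ₐ[k] B, ∀ a, g (toBalanced k one two β a)
      = f (toCorner (ordIdem_isIdempotentElem k one two β) a) := by
  have hle : unIdeal k one two β ≤ TwoSidedIdeal.ker f := by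
    refine TwoSidedIdeal.span_le.2 ?_
    rintro _ ⟨i, a, b, hi, rfl⟩
    exact (TwoSidedIdeal.mem_ker f).2 (hf i a b hi)
  have hle' : (unIdeal k one two β).ringCon ≤ RingCon.ker f.toRingHom := by
    intro x y hxy
    rw [TwoSidedIdeal.rel_iff] at hxy
    have := (TwoSidedIdeal.mem_ker f).1 (hle hxy)
    rw [map_sub, sub_eq_zero] at this
    exact this
  exact ⟨RingCon.liftₐ _ f hle', fun a => rfl⟩

end BalancedApi

/-! ### Polynomials that vanish on all matchings -/

section Vanishing

open MvPolynomial

variable (k : Type w) [Field k] {I : Type u} {I₁ : Set I} {α : I →₀ ℕ}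

/-- The vertices of the form `i²`. -/
def IsTwo {I : Type u} {I₁ : Set I} : DoubledVertex I I₁ → Prop
  | .two _ => True
  | _ => False

/-- A map `c` from the positions of a sequence to labels is a matching of the sequence if every
entry `i²` has the label of an entry `i¹` to the left of it, and labels are shared in no other
way. Setting variables with the same label equal defines a linear subspace for each matching. -/
structure IsMatching {m n : ℕ} (j : Fin m → DoubledVertex I I₁) (c : Fin m → Fin n) : Prop where
  ne (a b : Fin m) (hab : a ≠ b) (h : IsTwo (j a) ↔ IsTwo (j b)) : c a ≠ c b
  pair (b : Fin m) (v : I₁) (h : j b = .two v) : ∃ a, a < b ∧ j a = .one v ∧ c a = c b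

theorem arrowCount_one_two [Quiver.{v} I] (v : I₁) :
    arrowCount (DoubledVertex.one v) (DoubledVertex.two v : DoubledVertex I I₁) = 1 := by
  change Nat.card (ULift (PLift (v = v))) = 1
  simp

variable (I₁ α) in
/-- The families of polynomials that vanish on the linear subspaces of all matchings. -/
noncomputable def vanishing : Submodule k (PolSpace k (dblDim I₁ α)) where
  carrier := {F | ∀ (j : seqs (dblDim I₁ α)) (c : Fin (dblDim I₁ α).degree → Fin α.degree),
    IsMatching j.1 c → rename c (F j) = 0}
  add_mem' hF hG j c hc := by rw [Pi.add_apply, map_add, hF j c hc, hG j c hc, add_zero]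
  zero_mem' j c _ := map_zero _
  smul_mem' a F hF j c hc := by rw [Pi.smul_apply, map_smul, hF j c hc, smul_zero]

theorem mem_vanishing {F : PolSpace k (dblDim I₁ α)} : F ∈ vanishing k I₁ α ↔
    ∀ (j : seqs (dblDim I₁ α)) (c : Fin (dblDim I₁ α).degree → Fin α.degree),
      IsMatching j.1 c → rename c (F j) = 0 := Iff.rfl

/-- The exchange of two adjacent entries transports matchings, except when a matched pair `i¹, i²`
at these positions is reversed. -/
theorem IsMatching.comp_simple {m n : ℕ} {j : Fin m → DoubledVertex I I₁} {c : Fin m → Fin n}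
    (hc : IsMatching j c) (r : Fin (m - 1))
    (h : ¬ ∃ v, j (lo r) = .one v ∧ j (hi r) = .two v ∧ c (lo r) = c (hi r)) :
    IsMatching (j ∘ simple r) (c ∘ simple r) := by
  refine ⟨fun a b hab hj => hc.ne _ _ ((simple r).injective.ne hab) hj, fun b v hb => ?_⟩
  obtain ⟨a, hab, ha, hcab⟩ := hc.pair _ v hb
  refine ⟨simple r a, ?_, by simpa using ha, by simpa using hcab⟩
  have := simple_lt (r := r) hab ?_
  · simpa using this
  · rintro ⟨h1, h2⟩
    refine h ⟨v, by rw [← h1]; exact ha, ?_, ?_⟩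
    · rw [← h2]; exact hb
    · rw [← h1, ← h2]; exact hcab

theorem X_sub_X_ne_zero {n : ℕ} {a b : Fin n} (h : a ≠ b) :
    (X b - X a : MvPolynomial (Fin n) k) ≠ 0 :=
  sub_ne_zero.2 fun h' => h (X_injective h').symm

/-- A crossing transports the condition for a matching to that for the matching with two positions
exchanged. If these positions hold a matched pair `i¹, i²`, the exchange is no matching, but the
arrow `i¹ → i²` contributes a factor `x_{r+1} - x_r`, which vanishes on the subspace. -/
theorem polTau_mem_vanishing [Quiver.{v} I] {F : PolSpace k (dblDim I₁ α)}
    (hF : F ∈ vanishing k I₁ α) (r : Fin ((dblDim I₁ α).degree - 1)) :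
    polTau k (dblDim I₁ α) r F ∈ vanishing k I₁ α := by
  rw [mem_vanishing] at hF ⊢
  intro j c hc
  have hj : (permSeq (simple r) j).1 = j.1 ∘ simple r := permSeq_simple r j
  rw [polTau_apply]
  set f := F (permSeq (simple r) j) with hf
  by_cases heq : j.1 (hi r) = j.1 (lo r)
  · have hjj : permSeq (simple r) j = j := permSeq_simple_of_eq heq.symm
    rw [heq, cross_self]
    -- on equal labels `x_{r+1} - x_r` does not vanish on the subspace, so it can be cancelled
    have h1 := congrArg (rename c) (dem_spec r f)
    have hcs : IsMatching (permSeq (simple r) j).1 (c ∘ simple r) := by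
      rw [hj]
      refine hc.comp_simple r ?_
      rintro ⟨v, h1, h2, -⟩
      rw [h1, h2] at heq
      cases heq
    have hne : c (lo r) ≠ c (hi r) := hc.ne _ _ (lo_ne_hi r) (by rw [heq])
    rw [map_mul, map_sub, map_sub, rename_X, rename_X, rename_rename, hF _ _ hcs,
      hF _ c (by rw [hjj]; exact hc), sub_self] at h1
    exact (mul_eq_zero.1 h1).resolve_left (X_sub_X_ne_zero k hne)
  · rw [cross_of_ne heq, map_mul, rename_rename]
    by_cases hex : ∃ v, j.1 (lo r) = .one v ∧ j.1 (hi r) = .two v ∧ c (lo r) = c (hi r)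
    · obtain ⟨v, h1, h2, h3⟩ := hex
      rw [h1, h2, arrowCount_one_two, pow_one, map_sub, rename_X, rename_X, h3, sub_self, zero_mul]
    · rw [hF _ _ (by rw [hj]; exact hc.comp_simple r hex), mul_zero]

/-- The vanishing families form a subrepresentation of the polynomial representation. -/
theorem polRep_mem_vanishing [Quiver.{v} I] (a : Block k (dblDim I₁ α)) :
    ∀ {F}, F ∈ vanishing k I₁ α → polRep k _ a F ∈ vanishing k I₁ α := by
  classical
  induction a using alg_induction with
  | he i =>
    intro F hF j c hc
    rw [polRep_e]
    by_cases h : j = i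
    · rw [h, polE_apply_self]
      exact hF i c (h ▸ hc)
    · simp [polE, Pi.single_eq_of_ne h]
  | hx r =>
    intro F hF j c hc
    rw [polRep_x, polMul_apply, map_mul, hF j c hc, mul_zero]
  | ht r =>
    intro F hF
    rw [polRep_tau]
    exact polTau_mem_vanishing k hF r
  | hc c =>
    intro F hF
    rw [AlgHom.commutes, Module.algebraMap_end_apply]
    exact Submodule.smul_mem _ _ hF
  | ha a b ha hb =>
    intro F hF
    rw [map_add]
    exact add_mem (ha hF) (hb hF)
  | hm a b ha hb =>
    intro F hF
    rw [map_mul]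
    exact ha (hb hF)

/-- An unordered sequence has no matching, since its entries `i²` in some initial segment are too
many to be matched. -/
theorem not_isMatching_of_isUnordered {m n : ℕ} {j : Fin m → DoubledVertex I I₁}
    (hj : IsUnordered DoubledVertex.one DoubledVertex.two j) (c : Fin m → Fin n) :
    ¬ IsMatching j c := by
  classical
  intro hc
  obtain ⟨r, hr⟩ := hj
  refine absurd hr (not_lt.2 ?_)
  have hex : ∀ b, j b ∈ Set.range DoubledVertex.two → ∃ a, a < b ∧
      j a ∈ Set.range DoubledVertex.one ∧ c a = c b := by
    rintro b ⟨v, hv⟩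
    obtain ⟨a, h1, h2, h3⟩ := hc.pair b v hv.symm
    exact ⟨a, h1, ⟨v, h2.symm⟩, h3⟩
  choose! g hg1 hg2 hg3 using hex
  refine Finset.card_le_card_of_injOn g ?_ ?_
  · intro b hb
    simp only [Finset.coe_filter, Finset.mem_univ, true_and, Set.mem_ofPred_eq] at hb ⊢
    exact ⟨(hg1 b hb.2).le.trans hb.1, hg2 b hb.2⟩
  · intro b hb b' hb' hbb
    simp only [Finset.coe_filter, Finset.mem_univ, true_and, Set.mem_ofPred_eq] at hb hb'
    by_contra hne
    refine hc.ne b b' hne ?_ ?_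
    · obtain ⟨v, hv⟩ := hb.2
      obtain ⟨v', hv'⟩ := hb'.2
      rw [← hv, ← hv']
      exact Iff.rfl
    · rw [← hg3 b hb.2, ← hg3 b' hb'.2, hbb]

theorem mem_vanishing_of_isUnordered {F : PolSpace k (dblDim I₁ α)}
    (hF : ∀ j : seqs (dblDim I₁ α), ¬ IsUnordered DoubledVertex.one DoubledVertex.two j.1 →
      F j = 0) : F ∈ vanishing k I₁ α := by
  intro j c hc
  rw [hF j fun h => not_isMatching_of_isUnordered h c hc, map_zero]

theorem not_isTwo_dblSeq (i : seqs α) {a : Fin (dblDim I₁ α).degree} {r : Fin α.degree}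
    (ha : a.1 = dblPos I₁ i r.1) : ¬ IsTwo ((dblSeq I₁ i).1 a) := by
  by_cases h : i.1 r ∈ I₁
  · rw [dblSeq_one h ha]; exact id
  · rw [dblSeq_of_notMem h ha]; exact id

theorem isTwo_dblSeq (i : seqs α) {a : Fin (dblDim I₁ α).degree} {r : Fin α.degree}
    (h : i.1 r ∈ I₁) (ha : a.1 = dblPos I₁ i r.1 + 1) : IsTwo ((dblSeq I₁ i).1 a) := by
  rw [dblSeq_two h ha]; trivial

theorem isMatching_blk (i : seqs α) : IsMatching (dblSeq I₁ i).1 (blk I₁ i) := by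
  constructor
  · intro a b hab hj hblk
    rcases val_eq_or i a with ha | ⟨ha, ha'⟩ <;> rcases val_eq_or i b with hb | ⟨hb, hb'⟩
    · exact hab (by rw [ha, hb, hblk])
    · exact not_isTwo_dblSeq i (congrArg Fin.val ha) (hj.2 (isTwo_dblSeq i hb hb'))
    · exact not_isTwo_dblSeq i (congrArg Fin.val hb) (hj.1 (isTwo_dblSeq i ha ha'))
    · exact hab (Fin.ext (by rw [ha', hb', hblk]))
  · intro b v hb
    rcases val_eq_or i b with h | ⟨h, h'⟩
    · refine absurd ?_ (not_isTwo_dblSeq i (congrArg Fin.val h))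
      rw [hb]; trivial
    · refine ⟨startPos I₁ i (blk I₁ i b), Fin.lt_def.2 (by rw [startPos_val]; omega), ?_, by simp⟩
      rw [dblSeq_two h h'] at hb
      rw [dblSeq_one h rfl, DoubledVertex.two.inj hb]

/-- A matching of `φ(i)` matches each entry `i²` with the entry `i¹` next to it. -/
theorem IsMatching.eq_startPos_blk {i : seqs α} {n : ℕ} {c : Fin (dblDim I₁ α).degree → Fin n}
    (hc : IsMatching (dblSeq I₁ i).1 c) (a : Fin (dblDim I₁ α).degree) :
    c a = c (startPos I₁ i (blk I₁ i a)) := by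
  induction a using WellFoundedLT.induction with
  | ind b ih =>
    rcases val_eq_or i b with h | ⟨h, h'⟩
    · rw [← h]
    · obtain ⟨a, hab, ha, hcab⟩ := hc.pair b _ (dblSeq_two h h')
      rcases val_eq_or i a with h1 | ⟨h1, h1'⟩
      · by_cases hblk : blk I₁ i a = blk I₁ i b
        · rw [← hblk, ← h1, hcab]
        · exfalso
          have hmem : i.1 (blk I₁ i a) ∈ I₁ := by
            by_contra hn
            rw [dblSeq_of_notMem hn (congrArg Fin.val h1)] at ha
            cases ha
          let b' : Fin (dblDim I₁ α).degree := ⟨_, dblPos_add_one_lt_degree hmem⟩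
          have hb' : b'.1 = dblPos I₁ i (blk I₁ i a).1 + 1 := rfl
          have hav := congrArg Fin.val h1
          rw [startPos_val] at hav
          have hbb : b'.1 < b.1 := by
            have hab' := Fin.lt_def.1 hab
            have hlt : blk I₁ i a < blk I₁ i b := by
              rcases lt_trichotomy (blk I₁ i a) (blk I₁ i b) with h2 | h2 | h2
              · exact h2
              · exact absurd h2 hblk
              · have := dblPos_succ_le (I₁ := I₁) i h2
                rw [dblPos_succ_of_mem h] at this
                omega
            have := dblPos_succ_le (I₁ := I₁) i hlt
            rw [dblPos_succ_of_mem hmem] at this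
            omega
          have h2 := ih b' (Fin.lt_def.2 hbb)
          rw [blk_eq_of_val_eq_succ hmem hb', ← h1, hcab] at h2
          refine hc.ne b' b (fun h3 => hbb.ne (congrArg Fin.val h3)) ?_ h2
          exact iff_of_true (isTwo_dblSeq i hmem hb') (isTwo_dblSeq i h h')
      · have := isTwo_dblSeq i h1 h1'
        rw [ha] at this
        exact this.elim

/-- For a family supported on doubled sequences, only the matching of adjacent entries has to be
tested, by `IsMatching.eq_startPos_blk`. -/
theorem mem_vanishing_of_blk {F : PolSpace k (dblDim I₁ α)}
    (hF : ∀ j, (∀ i : seqs α, dblSeq I₁ i ≠ j) → F j = 0)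
    (hF' : ∀ i : seqs α, rename (blk I₁ i) (F (dblSeq I₁ i)) = 0) : F ∈ vanishing k I₁ α := by
  intro j c hc
  by_cases h : ∃ i : seqs α, dblSeq I₁ i = j
  · obtain ⟨i, rfl⟩ := h
    have hcomp : c = (c ∘ startPos I₁ i) ∘ blk I₁ i := funext hc.eq_startPos_blk
    rw [hcomp, ← rename_rename, hF', map_zero]
  · rw [hF j (not_exists.1 h), map_zero]

/-! ### The action of the balanced algebra on polynomials -/

variable (I₁ α) in
/-- The restriction of a family of polynomials for `Γ̄` to the doubled sequences and to the
diagonals on which the variables of each pair `i¹, i²` agree. -/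
noncomputable def restrictPol : PolSpace k (dblDim I₁ α) →ₗ[k] PolSpace k α :=
  LinearMap.pi fun i => (rename (blk I₁ i)).toLinearMap ∘ₗ LinearMap.proj (dblSeq I₁ i)

open Classical in
variable (I₁ α) in
/-- A section of `restrictPol`, which uses the variable of the first vertex of each pair. -/
noncomputable def extendPol : PolSpace k α →ₗ[k] PolSpace k (dblDim I₁ α) :=
  ∑ i, LinearMap.single k _ (dblSeq I₁ i) ∘ₗ (rename (startPos I₁ i)).toLinearMap ∘ₗ
    LinearMap.proj i

theorem restrictPol_apply (F : PolSpace k (dblDim I₁ α)) (i : seqs α) :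
    restrictPol k I₁ α F i = rename (blk I₁ i) (F (dblSeq I₁ i)) := rfl

open Classical in
theorem extendPol_single (i : seqs α) (f : MvPolynomial (Fin α.degree) k) :
    extendPol k I₁ α (Pi.single i f) = Pi.single (dblSeq I₁ i) (rename (startPos I₁ i) f) := by
  rw [extendPol, LinearMap.sum_apply, Finset.sum_eq_single i]
  · simp
  · intro i' _ h
    simp [Pi.single_eq_of_ne h]
  · simp

theorem extendPol_apply_dblSeq (F : PolSpace k α) (i : seqs α) :
    extendPol k I₁ α F (dblSeq I₁ i) = rename (startPos I₁ i) (F i) := by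
  classical
  rw [extendPol, LinearMap.sum_apply, Finset.sum_apply, Finset.sum_eq_single i]
  · simp
  · intro i' _ h
    simp [Pi.single_eq_of_ne (dblSeq_injective.ne h.symm)]
  · simp

theorem extendPol_apply_eq_zero (F : PolSpace k α) {j : seqs (dblDim I₁ α)}
    (hj : ∀ i : seqs α, dblSeq I₁ i ≠ j) : extendPol k I₁ α F j = 0 := by
  classical
  rw [extendPol, LinearMap.sum_apply, Finset.sum_apply]
  refine Finset.sum_eq_zero fun i _ => ?_
  simp [Pi.single_eq_of_ne (hj i).symm]

theorem blk_comp_startPos (i : seqs α) : blk I₁ i ∘ startPos I₁ i = id :=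
  funext (blk_startPos i)

theorem restrictPol_extendPol (F : PolSpace k α) :
    restrictPol k I₁ α (extendPol k I₁ α F) = F := funext fun i => by
  rw [restrictPol_apply, extendPol_apply_dblSeq, rename_rename, blk_comp_startPos, rename_id_apply]

theorem restrictPol_eq_zero {F : PolSpace k (dblDim I₁ α)} (hF : F ∈ vanishing k I₁ α) :
    restrictPol k I₁ α F = 0 := funext fun i => hF _ _ (isMatching_blk i)

/-- Modulo the vanishing families, a family that is supported on the doubled sequences is determined
by its restriction. -/
theorem sub_extendPol_restrictPol_mem {F : PolSpace k (dblDim I₁ α)}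
    (hF : ∀ j, (∀ i : seqs α, dblSeq I₁ i ≠ j) → F j = 0) :
    F - extendPol k I₁ α (restrictPol k I₁ α F) ∈ vanishing k I₁ α := by
  refine mem_vanishing_of_blk k (fun j hj => ?_) fun i => ?_
  · rw [Pi.sub_apply, hF j hj, extendPol_apply_eq_zero k _ hj, sub_zero]
  · rw [Pi.sub_apply, map_sub, extendPol_apply_dblSeq, restrictPol_apply, rename_rename,
      blk_comp_startPos, rename_id_apply, sub_self]

theorem exists_dblSeq_eq_iff {j : seqs (dblDim I₁ α)} :
    (∃ i : seqs α, dblSeq I₁ i = j) ↔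
      IsWellOrdered (DoubledVertex.one (I₁ := I₁)) DoubledVertex.two j.1 :=
  ⟨by rintro ⟨i, rfl⟩; exact isWellOrdered_dblSeq i, exists_dblSeq_eq⟩

variable [Quiver.{v} I]

variable (I₁ α) in
/-- The idempotent `𝐞` of the doubled quiver. -/
noncomputable abbrev dblIdem : Block k (dblDim I₁ α) :=
  ordIdem k (DoubledVertex.one (I₁ := I₁)) DoubledVertex.two (dblDim I₁ α)

open Classical in
theorem polRep_dblIdem_apply (F : PolSpace k (dblDim I₁ α)) (j : seqs (dblDim I₁ α)) :
    polRep k _ (dblIdem k I₁ α) F j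
      = if IsWellOrdered (DoubledVertex.one (I₁ := I₁)) DoubledVertex.two j.1 then F j else 0 := by
  have h : polRep k _ (dblIdem k I₁ α) F j = polRep k _ (e k j * dblIdem k I₁ α) F j := by
    rw [map_mul, Module.End.mul_apply, polRep_e, polE_apply_self]
  rw [h, e_mul_ordIdem]
  split_ifs
  · rw [polRep_e, polE_apply_self]
  · rw [map_zero]; rfl

theorem polRep_dblIdem_extendPol (F : PolSpace k α) :
    polRep k _ (dblIdem k I₁ α) (extendPol k I₁ α F) = extendPol k I₁ α F := by
  classical
  funext j
  rw [polRep_dblIdem_apply]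
  split_ifs with h
  · rfl
  · rw [← exists_dblSeq_eq_iff, not_exists] at h
    rw [extendPol_apply_eq_zero k F h]

variable (I₁ α) in
/-- The operator on the polynomials for `Γ` by which an element of `R_ᾱ` acts. -/
noncomputable def dblAct : Block k (dblDim I₁ α) →ₗ[k] Module.End k (PolSpace k α) where
  toFun a := restrictPol k I₁ α ∘ₗ polRep k _ a ∘ₗ extendPol k I₁ α
  map_add' a b := by rw [map_add, LinearMap.add_comp, LinearMap.comp_add]
  map_smul' c a := by rw [map_smul, LinearMap.smul_comp, LinearMap.comp_smul, RingHom.id_apply]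

theorem dblAct_apply (a : Block k (dblDim I₁ α)) (F : PolSpace k α) :
    dblAct k I₁ α a F = restrictPol k I₁ α (polRep k _ a (extendPol k I₁ α F)) := rfl

/-- Multiplicativity on `𝐞 R 𝐞`: inserting a restriction followed by an extension changes a family
supported on the doubled sequences by a vanishing family, and `a` preserves the vanishing
families. -/
theorem dblAct_mul_idem_mul (a b : Block k (dblDim I₁ α)) :
    dblAct k I₁ α (a * dblIdem k I₁ α * b) = dblAct k I₁ α a * dblAct k I₁ α b := by
  classical
  refine LinearMap.ext fun F => ?_
  rw [Module.End.mul_apply, dblAct_apply, dblAct_apply, dblAct_apply, ← sub_eq_zero,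
    mul_assoc, map_mul, Module.End.mul_apply, ← map_sub, ← map_sub]
  refine restrictPol_eq_zero k (polRep_mem_vanishing k a ?_)
  have h : restrictPol k I₁ α (polRep k _ b (extendPol k I₁ α F))
      = restrictPol k I₁ α (polRep k _ (dblIdem k I₁ α * b) (extendPol k I₁ α F)) := by
    funext i
    rw [map_mul, Module.End.mul_apply, restrictPol_apply, restrictPol_apply, polRep_dblIdem_apply,
      if_pos (isWellOrdered_dblSeq i)]
  rw [h]
  refine sub_extendPol_restrictPol_mem k fun j hj => ?_
  rw [map_mul, Module.End.mul_apply, polRep_dblIdem_apply, if_neg]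
  rw [← exists_dblSeq_eq_iff, not_exists]
  exact hj

theorem dblAct_one : dblAct k I₁ α 1 = 1 := LinearMap.ext fun F => by
  rw [dblAct_apply, map_one, Module.End.one_apply, restrictPol_extendPol, Module.End.one_apply]

theorem dblAct_idem : dblAct k I₁ α (dblIdem k I₁ α) = 1 := LinearMap.ext fun F => by
  rw [dblAct_apply, polRep_dblIdem_extendPol, restrictPol_extendPol, Module.End.one_apply]

/-- Everything at an unordered sequence is a vanishing family. -/
theorem dblAct_eq_zero {i : seqs (dblDim I₁ α)}
    (hi : IsUnordered DoubledVertex.one DoubledVertex.two i.1) (a b : Block k (dblDim I₁ α)) :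
    dblAct k I₁ α (a * e k i * b) = 0 := LinearMap.ext fun F => by
  classical
  rw [dblAct_apply, map_mul, map_mul]
  refine restrictPol_eq_zero k (polRep_mem_vanishing k a ?_)
  refine mem_vanishing_of_isUnordered k fun j hj => ?_
  rw [polRep_e, polE]
  have : j ≠ i := fun h => hj (h ▸ hi)
  simp [Pi.single_eq_of_ne this]

/-- The action of `R_ᾱ` on polynomials modulo the vanishing families induces an action of the
balanced algebra on the polynomials for `Γ`. -/
theorem exists_balancedRep : ∃ θ : DoubledBalanced k I₁ α →ₐ[k] Module.End k (PolSpace k α),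
    ∀ a, θ (cls k I₁ a) = dblAct k I₁ α a := by
  have hid : IsIdempotentElem (dblIdem k I₁ α) := ordIdem_isIdempotentElem k _ _ _
  have hsandwich : ∀ a, dblAct k I₁ α (dblIdem k I₁ α * a * dblIdem k I₁ α)
      = dblAct k I₁ α a := fun a => by
    have h1 := dblAct_mul_idem_mul k (dblIdem k I₁ α * a) 1
    have h2 := dblAct_mul_idem_mul k 1 a
    rw [one_mul, dblAct_one, one_mul] at h2
    rw [← h2, ← mul_one (_ * _ * _), h1, dblAct_one, mul_one]
  let f : OrdCorner k (DoubledVertex.one (I₁ := I₁)) DoubledVertex.two (dblDim I₁ α) →ₐ[k]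
      Module.End k (PolSpace k α) := AlgHom.ofLinearMap
    { toFun := fun y => dblAct k I₁ α y.1
      map_add' := fun y z => map_add (dblAct k I₁ α) y.1 z.1
      map_smul' := fun c y => map_smul (dblAct k I₁ α) c y.1 }
    (dblAct_idem k)
    (fun y z => by
      obtain ⟨b, hb⟩ := toCorner_surjective hid z
      change dblAct k I₁ α (y.1 * z.1) = dblAct k I₁ α y.1 * dblAct k I₁ α z.1
      rw [← dblAct_mul_idem_mul, ← hb, toCorner_val]
      simp only [← mul_assoc]
      rw [mul_assoc y.1 (dblIdem k I₁ α) (dblIdem k I₁ α), hid.eq])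
  obtain ⟨θ, hθ⟩ := exists_balanced_lift f fun i a b hi => by
    change dblAct k I₁ α (dblIdem k I₁ α * (a * e k i * b) * dblIdem k I₁ α) = 0
    rw [hsandwich, dblAct_eq_zero k hi]
  refine ⟨θ, fun a => (hθ a).trans (hsandwich a)⟩

end Vanishing

/-! ### Words of crossings that exchange two blocks -/

section StarWords

variable {I : Type u} {I₁ : Set I} {α : I →₀ ℕ}

theorem dblPos_block_bound (r : Fin (α.degree - 1)) (i : seqs α) :
    dblPos I₁ i r.1 + (dblVertex I₁ (i.1 (lo r))).length
      + (dblVertex I₁ (i.1 (hi r))).length ≤ (dblDim I₁ α).degree := by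
  rw [← dblPos_add_two, ← dblPos_degree (I₁ := I₁) i]
  exact dblPos_mono i (by have := r.2; omega)

theorem length_dblVertex_of_mem {v : I} (h : v ∈ I₁) : (dblVertex I₁ v).length = 2 := by
  rw [dblVertex_of_mem I₁ h]; rfl

theorem length_dblVertex_of_notMem {v : I} (h : v ∉ I₁) : (dblVertex I₁ v).length = 1 := by
  rw [dblVertex_of_notMem I₁ h]; rfl

open Classical in
variable (I₁) in
/-- The positions of the crossings in `τ*_r e(φ(i))`. -/
noncomputable def starPositions (r : Fin (α.degree - 1)) (i : seqs α) : List ℕ :=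
  let p := dblPos I₁ i r.1
  if i.1 (lo r) ∈ I₁ then
    if i.1 (hi r) ∈ I₁ then [p + 1, p + 2, p, p + 1] else [p, p + 1]
  else
    if i.1 (hi r) ∈ I₁ then [p + 1, p] else [p]

theorem starPositions_lt (r : Fin (α.degree - 1)) (i : seqs α) {n : ℕ}
    (hn : n ∈ starPositions I₁ r i) : n < (dblDim I₁ α).degree - 1 := by
  have hb := dblPos_block_bound (I₁ := I₁) r i
  unfold starPositions at hn
  split_ifs at hn with h1 h2 h2 <;>
  · simp only [length_dblVertex_of_mem, length_dblVertex_of_notMem, h1, h2, not_false_eq_true]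
      at hb
    simp only [List.mem_cons, List.not_mem_nil, or_false] at hn
    omega

variable (I₁) in
/-- The word of the crossings in `τ*_r e(φ(i))`. -/
noncomputable def starWord (r : Fin (α.degree - 1)) (i : seqs α) :
    List (Fin ((dblDim I₁ α).degree - 1)) :=
  (starPositions I₁ r i).pmap Fin.mk fun _ hn => starPositions_lt r i hn

theorem starWord_of_mem_of_mem {r : Fin (α.degree - 1)} {i : seqs α} (h1 : i.1 (lo r) ∈ I₁)
    (h2 : i.1 (hi r) ∈ I₁) : ∃ q0 q1 q2, q0.1 = dblPos I₁ i r.1 ∧ q1.1 = dblPos I₁ i r.1 + 1 ∧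
      q2.1 = dblPos I₁ i r.1 + 2 ∧ starWord I₁ r i = [q1, q2, q0, q1] := by
  have hs : starPositions I₁ r i = [dblPos I₁ i r.1 + 1, dblPos I₁ i r.1 + 2, dblPos I₁ i r.1,
      dblPos I₁ i r.1 + 1] := by simp [starPositions, h1, h2]
  have hb := fun n => starPositions_lt (I₁ := I₁) r i (n := n)
  rw [hs] at hb
  refine ⟨⟨dblPos I₁ i r.1, hb _ (by simp)⟩, ⟨dblPos I₁ i r.1 + 1, hb _ (by simp)⟩,
    ⟨dblPos I₁ i r.1 + 2, hb _ (by simp)⟩, rfl, rfl, rfl, ?_⟩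
  simp [starWord, hs]

theorem starWord_of_mem_of_notMem {r : Fin (α.degree - 1)} {i : seqs α} (h1 : i.1 (lo r) ∈ I₁)
    (h2 : i.1 (hi r) ∉ I₁) : ∃ q0 q1, q0.1 = dblPos I₁ i r.1 ∧ q1.1 = dblPos I₁ i r.1 + 1 ∧
      starWord I₁ r i = [q0, q1] := by
  have hs : starPositions I₁ r i = [dblPos I₁ i r.1, dblPos I₁ i r.1 + 1] := by
    simp [starPositions, h1, h2]
  have hb := fun n => starPositions_lt (I₁ := I₁) r i (n := n)
  rw [hs] at hb
  refine ⟨⟨dblPos I₁ i r.1, hb _ (by simp)⟩, ⟨dblPos I₁ i r.1 + 1, hb _ (by simp)⟩, rfl, rfl, ?_⟩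
  simp [starWord, hs]

theorem starWord_of_notMem_of_mem {r : Fin (α.degree - 1)} {i : seqs α} (h1 : i.1 (lo r) ∉ I₁)
    (h2 : i.1 (hi r) ∈ I₁) : ∃ q0 q1, q0.1 = dblPos I₁ i r.1 ∧ q1.1 = dblPos I₁ i r.1 + 1 ∧
      starWord I₁ r i = [q1, q0] := by
  have hs : starPositions I₁ r i = [dblPos I₁ i r.1 + 1, dblPos I₁ i r.1] := by
    simp [starPositions, h1, h2]
  have hb := fun n => starPositions_lt (I₁ := I₁) r i (n := n)
  rw [hs] at hb
  refine ⟨⟨dblPos I₁ i r.1, hb _ (by simp)⟩, ⟨dblPos I₁ i r.1 + 1, hb _ (by simp)⟩, rfl, rfl, ?_⟩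
  simp [starWord, hs]

theorem starWord_of_notMem_of_notMem {r : Fin (α.degree - 1)} {i : seqs α}
    (h1 : i.1 (lo r) ∉ I₁) (h2 : i.1 (hi r) ∉ I₁) : ∃ q0, q0.1 = dblPos I₁ i r.1 ∧
      starWord I₁ r i = [q0] := by
  have hs : starPositions I₁ r i = [dblPos I₁ i r.1] := by
    simp [starPositions, h1, h2]
  have hb := fun n => starPositions_lt (I₁ := I₁) r i (n := n)
  rw [hs] at hb
  refine ⟨⟨dblPos I₁ i r.1, hb _ (by simp)⟩, rfl, ?_⟩
  simp [starWord, hs]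

/-- The permutation `w` of the positions of `φ(i)` moves the blocks of `φ(i)` as the permutation `σ`
moves the entries of `i`. -/
def IsBlockPerm (w : Equiv.Perm (Fin (dblDim I₁ α).degree)) (σ : Equiv.Perm (Fin α.degree))
    (i : seqs α) : Prop :=
  ∀ (t : Fin α.degree) (m : ℕ) (_ : m < (dblVertex I₁ (i.1 t)).length)
    (a : Fin (dblDim I₁ α).degree), a.1 = dblPos I₁ i t.1 + m →
      (w a).1 = dblPos I₁ (permSeq σ i) (σ t).1 + m

theorem permSeq_apply_perm (σ : Equiv.Perm (Fin α.degree)) (i : seqs α) (t : Fin α.degree) :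
    (permSeq σ i).1 (σ t) = i.1 t := by
  rw [permSeq_apply, ← Equiv.Perm.mul_apply, inv_mul_cancel, Equiv.Perm.one_apply]

theorem exists_eq_dblPos_add (i : seqs α) (a : Fin (dblDim I₁ α).degree) :
    ∃ (t : Fin α.degree) (m : ℕ), m < (dblVertex I₁ (i.1 t)).length ∧
      a.1 = dblPos I₁ i t.1 + m := by
  have h1 := dblPos_blk_le i a
  have h2 := lt_dblPos_blk_succ i a
  rw [dblPos_succ] at h2
  exact ⟨blk I₁ i a, a.1 - dblPos I₁ i (blk I₁ i a).1, by omega, by omega⟩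

theorem isBlockPerm_one (i : seqs α) : IsBlockPerm (I₁ := I₁) 1 1 i := fun _ _ _ _ ha => ha

theorem IsBlockPerm.mul {w w' : Equiv.Perm (Fin (dblDim I₁ α).degree)}
    {σ σ' : Equiv.Perm (Fin α.degree)} {i : seqs α} (h' : IsBlockPerm w' σ' (permSeq σ i))
    (h : IsBlockPerm w σ i) : IsBlockPerm (w' * w) (σ' * σ) i := by
  intro t m hm a ha
  rw [permSeq_mul]
  exact h' (σ t) m (by rwa [permSeq_apply_perm]) (w a) (h t m hm a ha)

theorem IsBlockPerm.unique {w w' : Equiv.Perm (Fin (dblDim I₁ α).degree)}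
    {σ : Equiv.Perm (Fin α.degree)} {i : seqs α} (h : IsBlockPerm w σ i)
    (h' : IsBlockPerm w' σ i) : w = w' := by
  refine Equiv.ext fun a => Fin.ext ?_
  obtain ⟨t, m, hm, ha⟩ := exists_eq_dblPos_add i a
  rw [h t m hm a ha, h' t m hm a ha]

theorem IsBlockPerm.permSeq_dblSeq {w : Equiv.Perm (Fin (dblDim I₁ α).degree)}
    {σ : Equiv.Perm (Fin α.degree)} {i : seqs α} (h : IsBlockPerm w σ i) :
    permSeq w (dblSeq I₁ i) = dblSeq I₁ (permSeq σ i) := by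
  refine Subtype.ext (funext fun b => ?_)
  obtain ⟨a, rfl⟩ := w.surjective b
  rw [permSeq_apply_perm]
  obtain ⟨t, m, hm, ha⟩ := exists_eq_dblPos_add i a
  have hm' : m < (dblVertex I₁ ((permSeq σ i).1 (σ t))).length := by rwa [permSeq_apply_perm]
  rw [dblSeq_apply_add i t hm ha, dblSeq_apply_add _ (σ t) hm' (h t m hm a ha)]
  simp only [permSeq_apply_perm]

theorem IsBlockPerm.blk_apply {w : Equiv.Perm (Fin (dblDim I₁ α).degree)}
    {σ : Equiv.Perm (Fin α.degree)} {i : seqs α} (h : IsBlockPerm w σ i)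
    (a : Fin (dblDim I₁ α).degree) : blk I₁ (permSeq σ i) (w a) = σ (blk I₁ i a) := by
  have h1 := dblPos_blk_le i a
  have h2 := lt_dblPos_blk_succ i a
  rw [dblPos_succ] at h2
  have h3 := h (blk I₁ i a) (a.1 - dblPos I₁ i (blk I₁ i a).1) (by omega) a (by omega)
  refine blk_eq (by omega) ?_
  rw [dblPos_succ, permSeq_apply_perm]
  omega

theorem dblPos_permSeq_simple (i : seqs α) (r : Fin (α.degree - 1)) (t : Fin α.degree) :
    dblPos I₁ (permSeq (simple r) i) (simple r t).1 =
      if t = lo r then dblPos I₁ i r.1 + (dblVertex I₁ (i.1 (hi r))).length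
      else if t = hi r then dblPos I₁ i r.1 else dblPos I₁ i t.1 := by
  split_ifs with h1 h2
  · rw [h1, simple_lo, hi_val, dblPos_permSeq_hi]
  · rw [h2, simple_hi, lo_val, dblPos_permSeq_of_le i r le_rfl]
  · rw [simple_of_ne h1 h2]
    have h1' : t.1 ≠ r.1 := fun h => h1 (Fin.ext h)
    have h2' : t.1 ≠ r.1 + 1 := fun h => h2 (Fin.ext h)
    rcases lt_or_gt_of_ne h1' with h | h
    · exact dblPos_permSeq_of_le i r h.le
    · exact dblPos_permSeq_of_ge i r (by omega) t.2.le

/-- The exchange of `p` and `p + 1`. -/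
def natSwap (p a : ℕ) : ℕ := if a = p then p + 1 else if a = p + 1 then p else a

theorem simple_val_eq_natSwap {d : ℕ} (r : Fin (d - 1)) (a : Fin d) :
    (simple r a).1 = natSwap r.1 a.1 := simple_val r a

theorem natSwap_of_ne {p a : ℕ} (h : a ≠ p) (h' : a ≠ p + 1) : natSwap p a = a := by
  rw [natSwap, if_neg h, if_neg h']

/-- The crossings in `τ*_r e(φ(i))` exchange the two blocks and keep the order within each of
them. -/
theorem isBlockPerm_starWord (r : Fin (α.degree - 1)) (i : seqs α) :
    IsBlockPerm (I₁ := I₁) (wordPerm (starWord I₁ r i)) (simple r) i := by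
  intro t m hm a ha
  rw [dblPos_permSeq_simple]
  have hlh : dblPos I₁ i (hi r).1 = dblPos I₁ i r.1 + (dblVertex I₁ (i.1 (lo r))).length :=
    dblPos_succ i (lo r)
  have hout : t ≠ lo r → t ≠ hi r → a.1 < dblPos I₁ i r.1 ∨ dblPos I₁ i r.1
      + (dblVertex I₁ (i.1 (lo r))).length + (dblVertex I₁ (i.1 (hi r))).length ≤ a.1 := by
    intro h1 h2
    have h1' : t.1 ≠ r.1 := fun h => h1 (Fin.ext h)
    have h2' : t.1 ≠ r.1 + 1 := fun h => h2 (Fin.ext h)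
    rcases lt_or_gt_of_ne h1' with h | h
    · left
      have h3 := dblPos_mono (I₁ := I₁) i (show t.1 + 1 ≤ r.1 from h)
      rw [dblPos_succ] at h3
      omega
    · right
      have h3 := dblPos_mono (I₁ := I₁) i (show r.1 + 2 ≤ t.1 by omega)
      rw [dblPos_add_two] at h3
      omega
  by_cases h1 : i.1 (lo r) ∈ I₁ <;> by_cases h2 : i.1 (hi r) ∈ I₁
  · obtain ⟨q0, q1, q2, e0, e1, e2, hw⟩ := starWord_of_mem_of_mem h1 h2
    simp only [hw, wordPerm_cons, wordPerm_nil, mul_one, Equiv.Perm.mul_apply,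
      simple_val_eq_natSwap, e0, e1, e2]
    rw [length_dblVertex_of_mem h1] at hlh hout
    rw [length_dblVertex_of_mem h2] at hout ⊢
    split_ifs with h3 h4
    · subst h3
      rw [length_dblVertex_of_mem h1] at hm
      rw [ha, lo_val]
      interval_cases m <;> simp +arith [natSwap]
    · subst h4
      rw [length_dblVertex_of_mem h2] at hm
      rw [ha, hlh]
      interval_cases m <;> simp +arith [natSwap]
    · have := hout h3 h4
      rw [← ha]
      simp only [natSwap_of_ne (show a.1 ≠ dblPos I₁ i r.1 by omega)
        (show a.1 ≠ dblPos I₁ i r.1 + 1 by omega),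
        natSwap_of_ne (show a.1 ≠ dblPos I₁ i r.1 + 1 by omega)
        (show a.1 ≠ dblPos I₁ i r.1 + 1 + 1 by omega),
        natSwap_of_ne (show a.1 ≠ dblPos I₁ i r.1 + 2 by omega)
        (show a.1 ≠ dblPos I₁ i r.1 + 2 + 1 by omega)]
  · obtain ⟨q0, q1, e0, e1, hw⟩ := starWord_of_mem_of_notMem h1 h2
    simp only [hw, wordPerm_cons, wordPerm_nil, mul_one, Equiv.Perm.mul_apply,
      simple_val_eq_natSwap, e0, e1]
    rw [length_dblVertex_of_mem h1] at hlh hout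
    rw [length_dblVertex_of_notMem h2] at hout ⊢
    split_ifs with h3 h4
    · subst h3
      rw [length_dblVertex_of_mem h1] at hm
      rw [ha, lo_val]
      interval_cases m <;> simp +arith [natSwap]
    · subst h4
      rw [length_dblVertex_of_notMem h2] at hm
      rw [ha, hlh]
      interval_cases m
      simp +arith [natSwap]
    · have := hout h3 h4
      rw [← ha]
      simp only [natSwap_of_ne (show a.1 ≠ dblPos I₁ i r.1 by omega)
        (show a.1 ≠ dblPos I₁ i r.1 + 1 by omega),
        natSwap_of_ne (show a.1 ≠ dblPos I₁ i r.1 + 1 by omega)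
        (show a.1 ≠ dblPos I₁ i r.1 + 1 + 1 by omega)]
  · obtain ⟨q0, q1, e0, e1, hw⟩ := starWord_of_notMem_of_mem h1 h2
    simp only [hw, wordPerm_cons, wordPerm_nil, mul_one, Equiv.Perm.mul_apply,
      simple_val_eq_natSwap, e0, e1]
    rw [length_dblVertex_of_notMem h1] at hlh hout
    rw [length_dblVertex_of_mem h2] at hout ⊢
    split_ifs with h3 h4
    · subst h3
      rw [length_dblVertex_of_notMem h1] at hm
      rw [ha, lo_val]
      interval_cases m
      simp +arith [natSwap]
    · subst h4
      rw [length_dblVertex_of_mem h2] at hm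
      rw [ha, hlh]
      interval_cases m <;> simp +arith [natSwap]
    · have := hout h3 h4
      rw [← ha]
      simp only [natSwap_of_ne (show a.1 ≠ dblPos I₁ i r.1 by omega)
        (show a.1 ≠ dblPos I₁ i r.1 + 1 by omega),
        natSwap_of_ne (show a.1 ≠ dblPos I₁ i r.1 + 1 by omega)
        (show a.1 ≠ dblPos I₁ i r.1 + 1 + 1 by omega)]
  · obtain ⟨q0, e0, hw⟩ := starWord_of_notMem_of_notMem h1 h2
    simp only [hw, wordPerm_cons, wordPerm_nil, mul_one, simple_val_eq_natSwap, e0]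
    rw [length_dblVertex_of_notMem h1] at hlh hout
    rw [length_dblVertex_of_notMem h2] at hout ⊢
    split_ifs with h3 h4
    · subst h3
      rw [length_dblVertex_of_notMem h1] at hm
      rw [ha, lo_val]
      interval_cases m
      simp +arith [natSwap]
    · subst h4
      rw [length_dblVertex_of_notMem h2] at hm
      rw [ha, hlh]
      interval_cases m
      simp +arith [natSwap]
    · have := hout h3 h4
      rw [← ha]
      simp only [natSwap_of_ne (show a.1 ≠ dblPos I₁ i r.1 by omega)
        (show a.1 ≠ dblPos I₁ i r.1 + 1 by omega)]

end StarWords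

/-! ### The action of the starred generators -/

section StarAction

open MvPolynomial

variable (k : Type w) [Field k] {I : Type u} {I₁ : Set I} {α : I →₀ ℕ}

theorem tauAt_eq {V : Type u} [Quiver.{v} V] {d : ℕ} {S : Set (Fin d → V)} [Fintype S]
    {q : Fin (d - 1)} {n : ℕ} (h : q.1 = n) : tauAt k S n = tau k S q := by
  subst h
  rw [tauAt, dif_pos q.2]

theorem xAt_eq {V : Type u} [Quiver.{v} V] {d : ℕ} {S : Set (Fin d → V)} [Fintype S]
    {q : Fin d} {n : ℕ} (h : q.1 = n) : xAt k S n = x k S q := by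
  subst h
  rw [xAt, dif_pos q.2]

open Classical in
variable (I₁) in
/-- The sign in the definition of `τ*_r e(φ(i))`. -/
noncomputable def starSign (r : Fin (α.degree - 1)) (i : seqs α) : k :=
  if i.1 (lo r) ∈ I₁ ∧ i.1 (lo r) = i.1 (hi r) then -1 else 1

theorem tauStarAt_eq [Quiver.{v} I] (r : Fin (α.degree - 1)) (i : seqs α) :
    tauStarAt k I₁ r i
      = starSign k I₁ r i • (wordTau k (starWord I₁ r i) * e k (dblSeq I₁ i)) := by
  unfold tauStarAt starSign
  by_cases h1 : i.1 (lo r) ∈ I₁ <;> by_cases h2 : i.1 (hi r) ∈ I₁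
  · obtain ⟨q0, q1, q2, e0, e1, e2, hw⟩ := starWord_of_mem_of_mem h1 h2
    simp only [h1, h2, if_true, true_and, tauAt_eq k e0, tauAt_eq k e1, tauAt_eq k e2, hw,
      wordTau_cons, wordTau_nil, mul_one, ← mul_assoc]
    split_ifs <;> simp_all
  · obtain ⟨q0, q1, e0, e1, hw⟩ := starWord_of_mem_of_notMem h1 h2
    have hne : i.1 (lo r) ≠ i.1 (hi r) := fun h => h2 (h ▸ h1)
    simp only [h1, h2, hne, if_true, if_false, and_false, tauAt_eq k e0, tauAt_eq k e1, hw,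
      wordTau_cons, wordTau_nil, mul_one, one_smul]
  · obtain ⟨q0, q1, e0, e1, hw⟩ := starWord_of_notMem_of_mem h1 h2
    simp only [h1, h2, if_true, if_false, false_and, tauAt_eq k e0, tauAt_eq k e1, hw,
      wordTau_cons, wordTau_nil, mul_one, one_smul]
  · obtain ⟨q0, e0, hw⟩ := starWord_of_notMem_of_notMem h1 h2
    simp only [h1, h2, if_false, false_and, tauAt_eq k e0, hw,
      wordTau_cons, wordTau_nil, mul_one, one_smul]

theorem blk_wordPerm_starWord_startPos (r : Fin (α.degree - 1)) (i : seqs α) (t : Fin α.degree) :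
    blk I₁ (permSeq (simple r) i) (wordPerm (starWord I₁ r i) (startPos I₁ i t))
      = simple r t := by
  rw [(isBlockPerm_starWord r i).blk_apply, blk_startPos]

theorem rename_startPos_comp {m : ℕ} (i : seqs α)
    (g : Fin (dblDim I₁ α).degree → Fin m) (f : MvPolynomial (Fin α.degree) k) :
    rename g (rename (startPos I₁ i) f) = rename (fun t => g (startPos I₁ i t)) f := by
  rw [rename_rename]; rfl

section ArrowCounts

variable [Quiver.{v} I]

theorem arrowCount_eq_zero {V : Type u} [Quiver.{v} V] {a b : V} (h : IsEmpty (a ⟶ b)) :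
    arrowCount a b = 0 := Nat.card_of_isEmpty

theorem arrowCount_zero_two (a : (I₁ᶜ : Set I)) (b : I₁) :
    arrowCount (DoubledVertex.zero a) (DoubledVertex.two b : DoubledVertex I I₁) = 0 :=
  arrowCount_eq_zero ⟨fun h => PEmpty.elim h⟩

theorem arrowCount_one_zero (a : I₁) (b : (I₁ᶜ : Set I)) :
    arrowCount (DoubledVertex.one a) (DoubledVertex.zero b : DoubledVertex I I₁) = 0 :=
  arrowCount_eq_zero ⟨fun h => PEmpty.elim h⟩

theorem arrowCount_one_one (a b : I₁) :
    arrowCount (DoubledVertex.one a) (DoubledVertex.one b : DoubledVertex I I₁) = 0 :=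
  arrowCount_eq_zero ⟨fun h => PEmpty.elim h⟩

theorem arrowCount_two_two (a b : I₁) :
    arrowCount (DoubledVertex.two a) (DoubledVertex.two b : DoubledVertex I I₁) = 0 :=
  arrowCount_eq_zero ⟨fun h => PEmpty.elim h⟩

theorem arrowCount_two_one (a b : I₁) :
    arrowCount (DoubledVertex.two a) (DoubledVertex.one b : DoubledVertex I I₁) = 0 :=
  arrowCount_eq_zero ⟨fun h => PEmpty.elim h⟩

theorem arrowCount_one_two_of_ne {a b : I₁} (h : a ≠ b) :
    arrowCount (DoubledVertex.one a) (DoubledVertex.two b : DoubledVertex I I₁) = 0 :=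
  arrowCount_eq_zero ⟨fun h' : ULift (PLift (a = b)) => h h'.down.down⟩

theorem arrowCount_zero_zero (a b : (I₁ᶜ : Set I)) :
    arrowCount (DoubledVertex.zero a) (DoubledVertex.zero b : DoubledVertex I I₁)
      = arrowCount (a : I) (b : I) := rfl

theorem arrowCount_zero_one (a : (I₁ᶜ : Set I)) (b : I₁) :
    arrowCount (DoubledVertex.zero a) (DoubledVertex.one b : DoubledVertex I I₁)
      = arrowCount (a : I) (b : I) := rfl

theorem arrowCount_two_zero (a : I₁) (b : (I₁ᶜ : Set I)) :
    arrowCount (DoubledVertex.two a) (DoubledVertex.zero b : DoubledVertex I I₁)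
      = arrowCount (a : I) (b : I) := rfl

end ArrowCounts

/-- A divided difference between two positions of a doubled sequence restricts on the diagonals to a
divided difference if the exchange of these positions does. -/
theorem eq_dem_rename {m n : ℕ} {r : Fin (n - 1)} {q : Fin (m - 1)} {g : Fin m → Fin n}
    (h0 : g (lo q) = lo r) (h1 : g (hi q) = hi r) {A : MvPolynomial (Fin m) k}
    {f : MvPolynomial (Fin n) k} (hA : rename g A = f)
    (hA' : rename g (rename (simple q) A) = rename (simple r) f) :
    rename g (dem q A) = dem r f := by
  refine eq_dem ?_
  have := congrArg (rename g) (dem_spec q A)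
  rwa [map_mul, map_sub, map_sub, rename_X, rename_X, h0, h1, hA, hA'] at this

theorem blk_permSeq_fst (r : Fin (α.degree - 1)) (i : seqs α) {a : Fin (dblDim I₁ α).degree}
    (ha : a.1 = dblPos I₁ i r.1) : blk I₁ (permSeq (simple r) i) a = lo r :=
  blk_eq_of_val_eq (by rw [lo_val, dblPos_permSeq_of_le i r le_rfl, ha])

theorem blk_permSeq_snd (r : Fin (α.degree - 1)) (i : seqs α) {a : Fin (dblDim I₁ α).degree}
    (ha : a.1 = dblPos I₁ i r.1 + (dblVertex I₁ (i.1 (hi r))).length) :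
    blk I₁ (permSeq (simple r) i) a = hi r :=
  blk_eq_of_val_eq (by rw [hi_val, dblPos_permSeq_hi, ha])

theorem blk_permSeq_fst_succ {r : Fin (α.degree - 1)} {i : seqs α} (h : i.1 (hi r) ∈ I₁)
    {a : Fin (dblDim I₁ α).degree}
    (ha : a.1 = dblPos I₁ i r.1 + 1) : blk I₁ (permSeq (simple r) i) a = lo r :=
  blk_eq_of_val_eq_succ (by rwa [permSeq_simple_lo])
    (by rw [lo_val, dblPos_permSeq_of_le i r le_rfl, ha])

theorem dblPos_hi (r : Fin (α.degree - 1)) (i : seqs α) :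
    dblPos I₁ i (hi r).1 = dblPos I₁ i r.1 + (dblVertex I₁ (i.1 (lo r))).length :=
  dblPos_succ i (lo r)

/-- The crossings that replace `τ_r` act on the diagonals as `τ_r` does. For different labels,
at most one of the crossings contributes a polynomial factor, and this is the factor of `τ_r`. -/
theorem rename_wordOp_starWord [Quiver.{v} I] (hI : ∀ i ∈ I₁, ∀ j ∈ I₁, IsEmpty (i ⟶ j))
    (r : Fin (α.degree - 1)) (i : seqs α) (f : MvPolynomial (Fin α.degree) k) :
    starSign k I₁ r i • rename (blk I₁ (permSeq (simple r) i))
      (wordOp k (dblSeq I₁ i) (starWord I₁ r i) (rename (startPos I₁ i) f))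
      = cross (i.1 (lo r)) (i.1 (hi r)) r f := by
  have hcomp := blk_wordPerm_starWord_startPos (I₁ := I₁) r i
  have hhi := dblPos_hi (I₁ := I₁) r i
  have fst := @blk_permSeq_fst _ I₁ _ r i
  have snd := @blk_permSeq_snd _ I₁ _ r i
  unfold starSign
  by_cases h1 : i.1 (lo r) ∈ I₁ <;> by_cases h2 : i.1 (hi r) ∈ I₁
  · obtain ⟨q0, q1, q2, e0, e1, e2, hw⟩ := starWord_of_mem_of_mem h1 h2
    rw [length_dblVertex_of_mem h1] at hhi
    rw [length_dblVertex_of_mem h2] at snd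
    have l0 : (dblSeq I₁ i).1 (lo q0) = _ := dblSeq_one h1 (by rw [lo_val, e0]; rfl)
    have l1 : (dblSeq I₁ i).1 (lo q1) = _ := dblSeq_two h1 (by rw [lo_val, e1]; rfl)
    have l2 : (dblSeq I₁ i).1 (lo q2) = _ := dblSeq_one h2 (by rw [lo_val, e2, hhi])
    have l3 : (dblSeq I₁ i).1 (hi q2) = _ := dblSeq_two h2 (by rw [hi_val, e2, hhi])
    have hq0 : hi q0 = lo q1 := Fin.ext (by rw [hi_val, lo_val, e0, e1])
    have hq1 : hi q1 = lo q2 := Fin.ext (by rw [hi_val, lo_val, e1, e2])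
    have n01 : lo q0 ≠ lo q1 := Fin.ne_of_val_ne (by rw [lo_val, lo_val]; omega)
    have n02 : lo q0 ≠ lo q2 := Fin.ne_of_val_ne (by rw [lo_val, lo_val]; omega)
    have n03 : lo q0 ≠ hi q2 := Fin.ne_of_val_ne (by rw [lo_val, hi_val]; omega)
    have n12 : lo q1 ≠ lo q2 := Fin.ne_of_val_ne (by rw [lo_val, lo_val]; omega)
    have n13 : lo q1 ≠ hi q2 := Fin.ne_of_val_ne (by rw [lo_val, hi_val]; omega)
    have n23 : lo q2 ≠ hi q2 := lo_ne_hi q2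
    have p0 : ∀ j : seqs (dblDim I₁ α), (permSeq (simple q0) j).1 (lo q1) = j.1 (lo q0) :=
      fun j => by rw [← hq0, permSeq_simple_hi]
    have p1 : ∀ j : seqs (dblDim I₁ α), (permSeq (simple q1) j).1 (lo q2) = j.1 (lo q1) :=
      fun j => by rw [← hq1, permSeq_simple_hi]
    have p1' : ∀ j : seqs (dblDim I₁ α), (permSeq (simple q1) j).1 (lo q1) = j.1 (lo q2) :=
      fun j => by rw [← hq1, permSeq_simple_lo]
    have h02 : q0.1 + 1 < q2.1 := by omega
    rw [hw] at hcomp ⊢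
    have c0 : ∀ {a}, a ≠ lo q0 → a ≠ lo q1 → ∀ j : seqs (dblDim I₁ α),
        (permSeq (simple q0) j).1 a = j.1 a := fun ha hb j =>
      permSeq_simple_of_ne ha (by rwa [hq0]) j
    have c1 : ∀ {a}, a ≠ lo q1 → a ≠ lo q2 → ∀ j : seqs (dblDim I₁ α),
        (permSeq (simple q1) j).1 a = j.1 a := fun ha hb j =>
      permSeq_simple_of_ne ha (by rwa [hq1]) j
    simp only [wordOp, LinearMap.comp_apply, LinearMap.id_apply, wordPerm_cons, wordPerm_nil,
      mul_one, permSeq_one, permSeq_mul, hq0, hq1, p0, p1, p1', permSeq_simple_lo,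
      c0 n02.symm n12.symm, c0 n03.symm n13.symm, c1 n01 n02, c1 n13.symm n23.symm,
      permSeq_simple_of_ne n12 n13, l0, l1, l2, l3]
    simp only [wordPerm_cons, wordPerm_nil, mul_one, Equiv.Perm.mul_apply] at hcomp
    by_cases heq : i.1 (lo r) = i.1 (hi r)
    · have hi' : permSeq (simple r) i = i := permSeq_simple_of_eq heq
      have hv : (⟨i.1 (hi r), h2⟩ : I₁) = ⟨i.1 (lo r), h1⟩ := Subtype.ext heq.symm
      -- the variables of `f` become the first positions of the blocks
      have hst : ∀ t, (startPos I₁ i t).1 ≠ dblPos I₁ i r.1 + 1 ∧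
          (startPos I₁ i t).1 ≠ dblPos I₁ i r.1 + 3 := fun t => by
        constructor
        · intro h
          have hb := blk_eq_of_val_eq_succ (r := lo r) h1 h
          rw [blk_startPos] at hb
          rw [hb, startPos_val, lo_val] at h
          omega
        · intro h
          have hb := blk_eq_of_val_eq_succ (r := hi r) h2 (h.trans (by omega))
          rw [blk_startPos] at hb
          rw [hb, startPos_val] at h
          omega
      have hinv : ∀ t, simple q2 (simple q1 (startPos I₁ i t)) = simple q1 (startPos I₁ i t) :=
        fun t => by
          obtain ⟨h3, h4⟩ := hst t
          refine Fin.ext ?_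
          rw [simple_val_eq_natSwap, natSwap_of_ne] <;>
          · rw [simple_val_eq_natSwap, e1, e2, natSwap]
            split_ifs <;> omega
      -- the first crossing, of `i²` and `i¹`, contributes a linear factor; the divided difference
      -- of the two strands `i²` consumes this factor and changes the sign
      set A := rename (simple q1) (rename (startPos I₁ i) f) with hA
      have hA2 : rename (simple q2) A = A := by
        rw [hA, rename_startPos_comp, rename_rename]
        exact congrArg (fun g => rename g f) (funext hinv)
      have hd2 : dem q2 ((X (lo q2) - X (lo q1)) * A) = -A := by
        refine (eq_dem ?_).symm
        rw [map_mul, map_sub, rename_X, rename_X, simple_lo, simple_of_ne n12 n13, hA2]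
        ring
      rw [cross_of_ne (by simp), hv, cross_self, cross_self, cross_of_ne (by simp),
        arrowCount_two_one, arrowCount_one_two, pow_one, pow_zero, one_mul, ← hA, hq1]
      have hcm := cross_commute (k := k) (DoubledVertex.one ⟨i.1 (lo r), h1⟩)
        (DoubledVertex.one ⟨i.1 (lo r), h1⟩) (DoubledVertex.two ⟨i.1 (lo r), h1⟩)
        (DoubledVertex.two ⟨i.1 (lo r), h1⟩ : DoubledVertex I I₁) h02
        ((X (lo q2) - X (lo q1)) * A)
      rw [cross_self, cross_self] at hcm
      rw [← hcm, hd2, map_neg, map_neg, map_neg, if_pos ⟨h1, heq⟩, neg_smul, one_smul, neg_neg,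
        heq, cross_self, rename_rename]
      refine eq_dem_rename k ?_ ?_ ?_ ?_
      · rw [Function.comp_apply, simple_of_ne n01 (by rwa [hq1]), fst (by rw [lo_val, e0])]
      · rw [Function.comp_apply, hq0, simple_lo, hq1, snd (by rw [lo_val, e2])]
      · rw [hA, ← rename_rename, rename_simple_simple, rename_startPos_comp, hi']
        simp only [blk_startPos]
        exact rename_id_apply f
      · rw [hA, rename_rename, rename_rename, rename_startPos_comp]
        refine congrArg (fun g => rename g f) (funext fun t => ?_)
        rw [← hcomp t]
        have hc := DFunLike.congr_fun (simple_commute h02) (simple q1 (startPos I₁ i t))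
        simp only [Equiv.Perm.mul_apply, hinv] at hc
        simp only [Function.comp_apply, ← hc]
    · have hne : (⟨i.1 (hi r), h2⟩ : I₁) ≠ ⟨i.1 (lo r), h1⟩ := fun h =>
        heq (congrArg Subtype.val h).symm
      rw [cross_of_ne (by simp), cross_of_ne (by simpa using heq), cross_of_ne (by simpa using heq),
        cross_of_ne (by simp), cross_of_ne heq, arrowCount_one_two_of_ne hne, arrowCount_one_one,
        arrowCount_two_two, arrowCount_two_one, arrowCount_eq_zero (hI _ h2 _ h1)]
      have hneg : ¬(i.1 (lo r) ∈ I₁ ∧ i.1 (lo r) = i.1 (hi r)) := fun h => heq h.2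
      simp only [pow_zero, one_mul, rename_rename, if_neg hneg, one_smul]
      simp only [Function.comp_def, hcomp]
  · have hne : i.1 (lo r) ≠ i.1 (hi r) := fun h => h2 (h ▸ h1)
    obtain ⟨q0, q1, e0, e1, hw⟩ := starWord_of_mem_of_notMem h1 h2
    rw [length_dblVertex_of_mem h1] at hhi
    rw [length_dblVertex_of_notMem h2] at snd
    have l0 : (dblSeq I₁ i).1 (lo q0) = _ := dblSeq_one h1 (by rw [lo_val, e0]; rfl)
    have l1 : (dblSeq I₁ i).1 (lo q1) = _ := dblSeq_two h1 (by rw [lo_val, e1]; rfl)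
    have l2 : (dblSeq I₁ i).1 (hi q1) = _ := dblSeq_of_notMem h2 (by rw [hi_val, e1, hhi])
    have hq : hi q0 = lo q1 := Fin.ext (by rw [hi_val, lo_val, e0, e1])
    have n0 : lo q0 ≠ lo q1 := Fin.ne_of_val_ne (by rw [lo_val, lo_val]; omega)
    have n1 : lo q0 ≠ hi q1 := Fin.ne_of_val_ne (by rw [lo_val, hi_val]; omega)
    rw [hw] at hcomp ⊢
    simp only [wordOp, LinearMap.comp_apply, LinearMap.id_apply, wordPerm_cons, wordPerm_nil,
      mul_one, permSeq_one, hq, permSeq_simple_lo, permSeq_simple_of_ne n0 n1, l0, l1, l2]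
    rw [cross_of_ne (by simp), cross_of_ne (by simp), cross_of_ne hne, arrowCount_zero_two,
      arrowCount_zero_one, pow_zero, one_mul, map_mul, map_pow, map_sub, rename_X, rename_X,
      fst (a := lo q0) (by rw [lo_val, e0]), hq, snd (a := lo q1) (by rw [lo_val, e1]),
      if_neg (fun h => hne h.2), one_smul, rename_rename, rename_rename, rename_startPos_comp]
    simp only [wordPerm_cons, wordPerm_nil, mul_one, Equiv.Perm.mul_apply] at hcomp
    simp only [Function.comp_apply, hcomp]
  · have hne : i.1 (lo r) ≠ i.1 (hi r) := fun h => h1 (h ▸ h2)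
    obtain ⟨q0, q1, e0, e1, hw⟩ := starWord_of_notMem_of_mem h1 h2
    rw [length_dblVertex_of_notMem h1] at hhi
    rw [length_dblVertex_of_mem h2] at snd
    have l0 : (dblSeq I₁ i).1 (lo q0) = _ := dblSeq_of_notMem h1 (by rw [lo_val, e0]; rfl)
    have l1 : (dblSeq I₁ i).1 (lo q1) = _ := dblSeq_one h2 (by rw [lo_val, e1, hhi])
    have l2 : (dblSeq I₁ i).1 (hi q1) = _ := dblSeq_two h2 (by rw [hi_val, e1, hhi])
    have hq : hi q0 = lo q1 := Fin.ext (by rw [hi_val, lo_val, e0, e1])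
    have n0 : hi q1 ≠ lo q0 := Fin.ne_of_val_ne (by rw [lo_val, hi_val]; omega)
    have n1 : hi q1 ≠ lo q1 := (lo_ne_hi q1).symm
    have p0 : ∀ j : seqs (dblDim I₁ α), (permSeq (simple q0) j).1 (lo q1) = j.1 (lo q0) :=
      fun j => by rw [← hq, permSeq_simple_hi]
    rw [hw] at hcomp ⊢
    simp only [wordOp, LinearMap.comp_apply, LinearMap.id_apply, wordPerm_cons, wordPerm_nil,
      mul_one, permSeq_one, hq, p0, permSeq_simple_of_ne n0 (by rwa [hq]), l0, l1, l2]
    rw [cross_of_ne (by simp), cross_of_ne (by simp), cross_of_ne hne, arrowCount_one_zero,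
      arrowCount_two_zero, pow_zero, one_mul, map_mul, map_pow, map_sub, rename_X, rename_X,
      blk_permSeq_fst_succ h2 (a := lo q1) (by rw [lo_val, e1]),
      snd (a := hi q1) (by rw [hi_val, e1]),
      if_neg (fun h => hne h.2), one_smul, rename_rename, rename_rename, rename_startPos_comp]
    simp only [wordPerm_cons, wordPerm_nil, mul_one, Equiv.Perm.mul_apply] at hcomp
    simp only [Function.comp_apply, hcomp]
  · obtain ⟨q0, e0, hw⟩ := starWord_of_notMem_of_notMem h1 h2
    rw [length_dblVertex_of_notMem h1] at hhi
    rw [length_dblVertex_of_notMem h2] at snd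
    have l0 : (dblSeq I₁ i).1 (lo q0) = _ := dblSeq_of_notMem h1 (by rw [lo_val, e0]; rfl)
    have l1 : (dblSeq I₁ i).1 (hi q0) = _ := dblSeq_of_notMem h2 (by rw [hi_val, e0, hhi])
    rw [hw] at hcomp ⊢
    simp only [wordPerm_cons, wordPerm_nil, mul_one] at hcomp
    simp only [wordOp, LinearMap.comp_apply, LinearMap.id_apply, wordPerm_nil,
      permSeq_one, l0, l1, h1, false_and, if_false, one_smul]
    by_cases heq : i.1 (lo r) = i.1 (hi r)
    · simp only [heq, cross_self]
      have hi' : permSeq (simple r) i = i := permSeq_simple_of_eq heq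
      refine eq_dem_rename k (fst (by rw [lo_val, e0])) (snd (by rw [hi_val, e0])) ?_ ?_
      · rw [rename_startPos_comp, hi']
        simp only [blk_startPos]
        exact rename_id_apply f
      · rw [rename_rename, rename_startPos_comp]
        simp only [Function.comp_apply, hcomp]
    · rw [cross_of_ne (by simpa using heq), cross_of_ne heq, arrowCount_zero_zero, map_mul, map_pow,
        map_sub, rename_X, rename_X, fst (a := lo q0) (by rw [lo_val, e0]),
        snd (a := hi q0) (by rw [hi_val, e0]), rename_rename, rename_startPos_comp]
      simp only [Function.comp_apply, hcomp]

open Classical in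
theorem restrictPol_single (i : seqs α) (f : MvPolynomial (Fin (dblDim I₁ α).degree) k) :
    restrictPol k I₁ α (Pi.single (dblSeq I₁ i) f) = Pi.single i (rename (blk I₁ i) f) := by
  funext j
  rw [restrictPol_apply]
  by_cases h : j = i
  · subst h
    rw [Pi.single_eq_same, Pi.single_eq_same]
  · rw [Pi.single_eq_of_ne h, Pi.single_eq_of_ne (dblSeq_injective.ne h), map_zero]

variable [Quiver.{v} I]

open Classical in
/-- The operators of `a e(φ(i))` and `b e(i)` agree if they do on the polynomials at `i`. -/
theorem dblAct_mul_e {a : Block k (dblDim I₁ α)} {b : Block k α} {i : seqs α}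
    (h : ∀ f, restrictPol k I₁ α
        (polRep k _ a (Pi.single (dblSeq I₁ i) (rename (startPos I₁ i) f)))
      = polRep k α b (Pi.single i f)) :
    dblAct k I₁ α (a * e k (dblSeq I₁ i)) = polRep k α (b * e k i) := by
  refine LinearMap.pi_ext fun j f => ?_
  rw [dblAct_apply, extendPol_single, map_mul, map_mul, Module.End.mul_apply, Module.End.mul_apply,
    polRep_e, polRep_e, polE_single, polE_single]
  by_cases hj : j = i
  · subst hj
    rw [if_pos rfl, if_pos rfl, h]
  · rw [if_neg hj, if_neg (dblSeq_injective.ne hj), map_zero, map_zero, map_zero]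

theorem dblAct_polyHom (p : MvPolynomial (Fin α.degree) k) (i : seqs α) :
    dblAct k I₁ α (polyHom k _ (rename (startPos I₁ i) p) * e k (dblSeq I₁ i))
      = polRep k α (polyHom k α p * e k i) := by
  classical
  refine dblAct_mul_e k fun f => ?_
  rw [polRep_polyHom, polRep_polyHom, polMul_single, polMul_single, restrictPol_single, ← map_mul,
    rename_startPos_comp]
  simp only [blk_startPos]
  rw [show (fun t : Fin α.degree => t) = id from rfl, rename_id_apply]

theorem dblAct_e (i : seqs α) : dblAct k I₁ α (e k (dblSeq I₁ i)) = polRep k α (e k i) := by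
  simpa using dblAct_polyHom (I₁ := I₁) k 1 i

theorem xStarAt_eq (r : Fin α.degree) (i : seqs α) :
    xStarAt k I₁ r i = polyHom k _ (rename (startPos I₁ i) (X r)) * e k (dblSeq I₁ i) := by
  rw [xStarAt, xAt_eq k (startPos_val i r), rename_X, polyHom_X]

theorem dblAct_xStarAt (r : Fin α.degree) (i : seqs α) :
    dblAct k I₁ α (xStarAt k I₁ r i) = polRep k α (x k _ r * e k i) := by
  rw [xStarAt_eq, dblAct_polyHom, polyHom_X]

theorem dblAct_tauStarAt (hI : ∀ i ∈ I₁, ∀ j ∈ I₁, IsEmpty (i ⟶ j))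
    (r : Fin (α.degree - 1)) (i : seqs α) :
    dblAct k I₁ α (tauStarAt k I₁ r i) = polRep k α (tau k _ r * e k i) := by
  classical
  rw [tauStarAt_eq, ← smul_mul_assoc]
  refine dblAct_mul_e k fun f => ?_
  rw [map_smul, LinearMap.smul_apply, map_smul, polRep_wordTau_single,
    (isBlockPerm_starWord r i).permSeq_dblSeq, restrictPol_single, ← Pi.single_smul,
    rename_wordOp_starWord k hI, polRep_tau, polTau_single]

end StarAction

/-! ### Words of crossings that permute the blocks -/

section StarLists

variable {I : Type u} {I₁ : Set I} {α : I →₀ ℕ}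

theorem IsReduced.concat {d : ℕ} {l : List (Fin (d - 1))} (h : IsReduced l) {r : Fin (d - 1)}
    (hr : wordPerm l (lo r) < wordPerm l (hi r)) : IsReduced (l ++ [r]) := by
  unfold IsReduced
  rw [wordPerm_concat, len_mul_simple hr, h, List.length_append, List.length_singleton]

variable (I₁) in
/-- The concatenation of the words that replace the letters of a word of crossings on `i`. -/
noncomputable def starList : List (Fin (α.degree - 1)) → seqs α →
    List (Fin ((dblDim I₁ α).degree - 1))
  | [], _ => []
  | r :: l, i => starWord I₁ r (permSeq (wordPerm l) i) ++ starList l i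

theorem starList_concat (l : List (Fin (α.degree - 1))) (r : Fin (α.degree - 1)) (i : seqs α) :
    starList I₁ (l ++ [r]) i = starList I₁ l (permSeq (simple r) i) ++ starWord I₁ r i := by
  induction l with
  | nil => simp [starList]
  | cons s l ih =>
    rw [List.cons_append, starList, starList, ih, List.append_assoc, wordPerm_concat, permSeq_mul]

theorem isBlockPerm_starList (l : List (Fin (α.degree - 1))) (i : seqs α) :
    IsBlockPerm (I₁ := I₁) (wordPerm (starList I₁ l i)) (wordPerm l) i := by
  induction l with
  | nil => exact isBlockPerm_one i
  | cons r l ih =>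
    rw [starList, wordPerm_append, wordPerm_cons]
    exact (isBlockPerm_starWord r _).mul ih

theorem IsBlockPerm.lt {w : Equiv.Perm (Fin (dblDim I₁ α).degree)}
    {σ : Equiv.Perm (Fin α.degree)} {i : seqs α} (h : IsBlockPerm w σ i)
    {a b : Fin (dblDim I₁ α).degree} (hab : σ (blk I₁ i a) < σ (blk I₁ i b)) : w a < w b := by
  rw [← h.blk_apply, ← h.blk_apply] at hab
  have h1 := lt_dblPos_blk_succ (permSeq σ i) (w a)
  have h2 := dblPos_blk_le (permSeq σ i) (w b)
  have h3 := dblPos_mono (I₁ := I₁) (permSeq σ i)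
    (show (blk I₁ (permSeq σ i) (w a)).1 + 1 ≤ _ from hab)
  exact Fin.lt_def.2 (by omega)

theorem blk_permSeq_snd_succ {r : Fin (α.degree - 1)} {i : seqs α} (h : i.1 (lo r) ∈ I₁)
    {a : Fin (dblDim I₁ α).degree}
    (ha : a.1 = dblPos I₁ i r.1 + (dblVertex I₁ (i.1 (hi r))).length + 1) :
    blk I₁ (permSeq (simple r) i) a = hi r :=
  blk_eq_of_val_eq_succ (by rwa [permSeq_simple_hi]) (by rw [hi_val, dblPos_permSeq_hi, ha])

/-- If `w` does not exchange the two blocks, then the exchange of the two blocks can be prepended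
to a reduced word of `w`. -/
theorem isReduced_append_starWord {l : List (Fin ((dblDim I₁ α).degree - 1))} (hl : IsReduced l)
    {σ : Equiv.Perm (Fin α.degree)} {r : Fin (α.degree - 1)} {i : seqs α}
    (h : IsBlockPerm (wordPerm l) σ (permSeq (simple r) i)) (hσ : σ (lo r) < σ (hi r)) :
    IsReduced (l ++ starWord I₁ r i) := by
  have key : ∀ {a b}, blk I₁ (permSeq (simple r) i) a = lo r →
      blk I₁ (permSeq (simple r) i) b = hi r → wordPerm l a < wordPerm l b :=
    fun ha hb => h.lt (by rwa [ha, hb])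
  have fst := @blk_permSeq_fst _ I₁ _ r i
  have fst' := @blk_permSeq_fst_succ _ I₁ _ r i
  have snd := @blk_permSeq_snd _ I₁ _ r i
  have snd' := @blk_permSeq_snd_succ _ I₁ _ r i
  by_cases h1 : i.1 (lo r) ∈ I₁ <;> by_cases h2 : i.1 (hi r) ∈ I₁
  · obtain ⟨q0, q1, q2, e0, e1, e2, hw⟩ := starWord_of_mem_of_mem h1 h2
    rw [length_dblVertex_of_mem h2] at snd snd'
    have hq0 : hi q0 = lo q1 := Fin.ext (by rw [hi_val, lo_val, e0, e1])
    have hq1 : hi q1 = lo q2 := Fin.ext (by rw [hi_val, lo_val, e1, e2])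
    have n01 : lo q0 ≠ lo q1 := Fin.ne_of_val_ne (by rw [lo_val, lo_val]; omega)
    have n02 : lo q0 ≠ lo q2 := Fin.ne_of_val_ne (by rw [lo_val, lo_val]; omega)
    have n03 : lo q0 ≠ hi q2 := Fin.ne_of_val_ne (by rw [lo_val, hi_val]; omega)
    have n12 : lo q1 ≠ lo q2 := Fin.ne_of_val_ne (by rw [lo_val, lo_val]; omega)
    have n13 : lo q1 ≠ hi q2 := Fin.ne_of_val_ne (by rw [lo_val, hi_val]; omega)
    have n23 : lo q2 ≠ hi q2 := lo_ne_hi q2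
    have b0 := fst (a := lo q0) (by rw [lo_val, e0])
    have b1 := fst' h2 (a := lo q1) (by rw [lo_val, e1])
    have b2 := snd (a := lo q2) (by rw [lo_val, e2])
    have b3 := snd' h1 (a := hi q2) (by rw [hi_val, e2])
    have s0 : simple q0 (lo q1) = lo q0 := by rw [← hq0, simple_hi]
    have s0' : simple q0 (lo q2) = lo q2 := simple_of_ne n02.symm (by rw [hq0]; exact n12.symm)
    have s1 : simple q1 (lo q2) = lo q1 := by rw [← hq1, simple_hi]
    have s1' : simple q1 (lo q1) = lo q2 := by rw [simple_lo, hq1]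
    have s1'' : simple q1 (lo q0) = lo q0 := simple_of_ne n01 (by rwa [hq1])
    have s1''' : simple q1 (hi q2) = hi q2 := simple_of_ne n13.symm (by rw [hq1]; exact n23.symm)
    have s2 : simple q2 (lo q0) = lo q0 := simple_of_ne n02 n03
    have s2' : simple q2 (lo q1) = lo q1 := simple_of_ne n12 n13
    rw [hw, show l ++ [q1, q2, q0, q1] = l ++ [q1] ++ [q2] ++ [q0] ++ [q1] by simp]
    refine (((hl.concat ?_).concat ?_).concat ?_).concat ?_ <;>
      simp only [wordPerm_concat, Equiv.Perm.mul_apply, hq0, hq1, s0, s0', s1, s1', s1'', s1''', s2,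
        s2', simple_lo]
    · exact key b1 b2
    · exact key b1 b3
    · exact key b0 b2
    · exact key b0 b3
  · obtain ⟨q0, q1, e0, e1, hw⟩ := starWord_of_mem_of_notMem h1 h2
    rw [length_dblVertex_of_notMem h2] at snd snd'
    have hq : hi q0 = lo q1 := Fin.ext (by rw [hi_val, lo_val, e0, e1])
    have n1 : hi q1 ≠ lo q0 := Fin.ne_of_val_ne (by rw [lo_val, hi_val]; omega)
    have n2 : hi q1 ≠ lo q1 := (lo_ne_hi q1).symm
    have s0 : simple q0 (lo q1) = lo q0 := by rw [← hq, simple_hi]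
    have s0' : simple q0 (hi q1) = hi q1 := simple_of_ne n1 (by rwa [hq])
    have b0 := fst (a := lo q0) (by rw [lo_val, e0])
    have b1 := snd (a := lo q1) (by rw [lo_val, e1])
    have b2 := snd' h1 (a := hi q1) (by rw [hi_val, e1])
    rw [hw, show l ++ [q0, q1] = l ++ [q0] ++ [q1] by simp]
    refine (hl.concat ?_).concat ?_
    · rw [hq]
      exact key b0 b1
    · simp only [wordPerm_concat, Equiv.Perm.mul_apply, s0, s0']
      exact key b0 b2
  · obtain ⟨q0, q1, e0, e1, hw⟩ := starWord_of_notMem_of_mem h1 h2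
    rw [length_dblVertex_of_mem h2] at snd
    have hq : hi q0 = lo q1 := Fin.ext (by rw [hi_val, lo_val, e0, e1])
    have n0 : lo q0 ≠ lo q1 := Fin.ne_of_val_ne (by rw [lo_val, lo_val]; omega)
    have n1 : lo q0 ≠ hi q1 := Fin.ne_of_val_ne (by rw [lo_val, hi_val]; omega)
    have s1 : simple q1 (lo q0) = lo q0 := simple_of_ne n0 n1
    have b0 := fst (a := lo q0) (by rw [lo_val, e0])
    have b1 := fst' h2 (a := lo q1) (by rw [lo_val, e1])
    have b2 := snd (a := hi q1) (by rw [hi_val, e1])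
    rw [hw, show l ++ [q1, q0] = l ++ [q1] ++ [q0] by simp]
    refine (hl.concat (key b1 b2)).concat ?_
    simp only [wordPerm_concat, Equiv.Perm.mul_apply, hq, s1, simple_lo]
    exact key b0 b2
  · obtain ⟨q0, e0, hw⟩ := starWord_of_notMem_of_notMem h1 h2
    rw [length_dblVertex_of_notMem h2] at snd
    rw [hw]
    exact hl.concat (key (fst (by rw [lo_val, e0])) (snd (by rw [hi_val, e0])))

/-- The blockwise version of a reduced word is reduced. -/
theorem isReduced_starList_redWord (σ : Equiv.Perm (Fin α.degree)) (i : seqs α) :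
    IsReduced (starList I₁ (redWord σ) i) := by
  induction σ using redWord_induction generalizing i with
  | one => rw [redWord_one]; exact len_one
  | step σ r hr hw ih =>
    rw [hw, starList_concat]
    refine isReduced_append_starWord (ih _)
      (isBlockPerm_starList (redWord (σ * simple r)) (permSeq (simple r) i)) ?_
    rw [wordPerm_redWord]
    simpa using hr

/-- A permutation that keeps the order within each pair `i¹, i²` of `φ(i)`, and maps `φ(i)` to a
doubled sequence, permutes the blocks of `φ(i)`. -/
theorem exists_isBlockPerm {w : Equiv.Perm (Fin (dblDim I₁ α).degree)} {i i' : seqs α}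
    (hi : permSeq w (dblSeq I₁ i) = dblSeq I₁ i')
    (hw : ∀ (t : Fin α.degree) (a b : Fin (dblDim I₁ α).degree), i.1 t ∈ I₁ →
      a.1 = dblPos I₁ i t.1 → b.1 = dblPos I₁ i t.1 + 1 → w a < w b) :
    ∃ σ : Equiv.Perm (Fin α.degree), IsBlockPerm w σ i := by
  classical
  have happ : ∀ a, (dblSeq I₁ i').1 (w a) = (dblSeq I₁ i).1 a := fun a => by
    rw [← hi, permSeq_apply_perm]
  -- labels show that starts of blocks are mapped to starts of blocks
  have hlabel : ∀ t, startPos I₁ i' (blk I₁ i' (w (startPos I₁ i t))) = w (startPos I₁ i t) ∧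
      i'.1 (blk I₁ i' (w (startPos I₁ i t))) = i.1 t := by
    intro t
    have h1 := happ (startPos I₁ i t)
    have hst := startPos_val (I₁ := I₁) i t
    rcases val_eq_or i' (w (startPos I₁ i t)) with h2 | ⟨h2, h3⟩
    · refine ⟨h2.symm, ?_⟩
      set s := blk I₁ i' (w (startPos I₁ i t))
      rw [h2] at h1
      have hs := startPos_val (I₁ := I₁) i' s
      by_cases hm : i.1 t ∈ I₁ <;> by_cases hm' : i'.1 s ∈ I₁
      · rw [dblSeq_one hm hst, dblSeq_one hm' hs] at h1
        injection h1 with h1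
        exact congrArg Subtype.val h1
      · rw [dblSeq_one hm hst, dblSeq_of_notMem hm' hs] at h1
        cases h1
      · rw [dblSeq_of_notMem hm hst, dblSeq_one hm' hs] at h1
        cases h1
      · rw [dblSeq_of_notMem hm hst, dblSeq_of_notMem hm' hs] at h1
        injection h1 with h1
        exact congrArg Subtype.val h1
    · rw [dblSeq_two h2 h3] at h1
      by_cases hm : i.1 t ∈ I₁
      · rw [dblSeq_one hm hst] at h1
        cases h1
      · rw [dblSeq_of_notMem hm hst] at h1
        cases h1
  -- `f` and `g'` give the blocks to which the first and the last entries of the blocks are moved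
  let f : Fin α.degree → Fin α.degree := fun t => blk I₁ i' (w (startPos I₁ i t))
  have hf : ∀ t, startPos I₁ i' (f t) = w (startPos I₁ i t) := fun t => (hlabel t).1
  have hfi : ∀ t, i'.1 (f t) = i.1 t := fun t => (hlabel t).2
  have hfinj : Function.Injective f := fun s t hst =>
    startPos_injective i (w.injective (by rw [← hf, ← hf, hst]))
  let σ : Equiv.Perm (Fin α.degree) := Equiv.ofBijective f (Finite.injective_iff_bijective.1 hfinj)
  have hσ : permSeq σ i = i' := by
    refine Subtype.ext (funext fun b => ?_)
    obtain ⟨t, rfl⟩ := σ.surjective b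
    rw [permSeq_apply_perm]
    exact (hfi t).symm
  -- the second positions of the pairs
  have hsnd : ∀ t, ∃ (b : Fin (dblDim I₁ α).degree) (s : Fin α.degree), i.1 t ∈ I₁ →
      b.1 = dblPos I₁ i t.1 + 1 ∧ i'.1 s ∈ I₁ ∧ (w b).1 = dblPos I₁ i' s.1 + 1 := by
    intro t
    by_cases ht : i.1 t ∈ I₁
    swap
    · exact ⟨startPos I₁ i t, t, fun h => absurd h ht⟩
    have hlt : dblPos I₁ i t.1 + 1 < (dblDim I₁ α).degree := dblPos_add_one_lt_degree ht
    have h1 := happ ⟨_, hlt⟩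
    rw [dblSeq_two ht rfl] at h1
    refine ⟨⟨_, hlt⟩, blk I₁ i' (w ⟨_, hlt⟩), fun _ => ⟨rfl, ?_⟩⟩
    rcases val_eq_or i' (w ⟨_, hlt⟩) with h2 | h2
    · rw [h2] at h1
      by_cases hm : i'.1 (blk I₁ i' (w ⟨_, hlt⟩)) ∈ I₁
      · rw [dblSeq_one hm (startPos_val i' _)] at h1
        cases h1
      · rw [dblSeq_of_notMem hm (startPos_val i' _)] at h1
        cases h1
    · exact h2
  choose b g hbg using hsnd
  have hb := fun t ht => (hbg t ht).1
  have hgm := fun t ht => (hbg t ht).2.1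
  have hg := fun t ht => (hbg t ht).2.2
  let g' : Fin α.degree → Fin α.degree := fun t => if i.1 t ∈ I₁ then g t else f t
  have hg'inj : Function.Injective g' := by
    intro s t hst
    simp only [g'] at hst
    split_ifs at hst with h1 h2 h2
    · have h3 : w (b s) = w (b t) := Fin.ext (by rw [hg s h1, hg t h2, hst])
      have h4 := congrArg Fin.val (w.injective h3)
      rw [hb s h1, hb t h2] at h4
      exact startPos_injective i (Fin.ext (Nat.succ_injective h4))
    · exact absurd (hst ▸ hgm s h1) (by rwa [hfi])
    · exact absurd (hst ▸ hgm t h2) (by rwa [hfi])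
    · exact hfinj hst
  have hle : ∀ t, (f t).1 ≤ (g' t).1 := by
    intro t
    simp only [g']
    split_ifs with h1
    · have h2 := Fin.lt_def.1 (hw t (startPos I₁ i t) (b t) h1 (startPos_val i t) (hb t h1))
      rw [← hf, startPos_val, hg t h1] at h2
      by_contra! hlt
      have h3 := dblPos_mono (I₁ := I₁) i' (Nat.succ_le_of_lt hlt)
      rw [Nat.succ_eq_add_one, dblPos_succ_of_mem (hgm t h1)] at h3
      omega
    · exact le_rfl
  -- both maps are bijections, hence the inequalities add up to an equality
  have hsum : ∑ t, (f t).1 = ∑ t, (g' t).1 :=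
    (Equiv.sum_comp σ (fun t => t.1)).trans
      (Equiv.sum_comp (Equiv.ofBijective g' (Finite.injective_iff_bijective.1 hg'inj))
        (fun t => t.1)).symm
  have heq : ∀ t, (f t).1 = (g' t).1 := fun t =>
    (Finset.sum_eq_sum_iff_of_le fun t _ => hle t).1 hsum t (Finset.mem_univ t)
  refine ⟨σ, fun t m hm a ha => ?_⟩
  rw [hσ]
  change (w a).1 = dblPos I₁ i' (f t).1 + m
  by_cases h1 : i.1 t ∈ I₁
  · rw [length_dblVertex_of_mem h1] at hm
    interval_cases m
    · rw [show a = startPos I₁ i t from Fin.ext ha, ← hf]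
      rfl
    · rw [show a = b t from Fin.ext (ha.trans (hb t h1).symm), hg t h1, heq]
      simp only [g', if_pos h1]
  · rw [length_dblVertex_of_notMem h1] at hm
    interval_cases m
    rw [show a = startPos I₁ i t from Fin.ext ha, ← hf]
    rfl

end StarLists

/-! ### Unordered sequences next to well-ordered ones -/

section Unordered

/-- Exchanging an adjacent pair `one j, two j` of a well-ordered sequence gives an
unordered one: the initial segment that ends with the moved `two j` has more entries of the second
kind than of the first. -/
theorem isUnordered_permSeq_simple {V : Type u} {J : Type v} {one two : J → V} {β : V →₀ ℕ}
    (hne : ∀ j j', one j ≠ two j') {i : seqs β} (hi : IsWellOrdered one two i.1)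
    {r : Fin (β.degree - 1)} (hr : i.1 (lo r) ∈ Set.range one) :
    IsUnordered one two (permSeq (simple r) i).1 := by
  classical
  obtain ⟨j₀, hj₀⟩ := hr
  have hlt : ∀ {a : Fin β.degree}, a < lo r → (permSeq (simple r) i).1 a = i.1 a := fun ha =>
    permSeq_simple_of_ne ha.ne (ha.trans (lo_lt_hi r)).ne i
  have hlo : (permSeq (simple r) i).1 (lo r) = two j₀ := by
    obtain ⟨h, h'⟩ := hi (lo r) j₀ hj₀.symm
    rw [permSeq_simple_lo, ← h']
    rfl
  refine ⟨lo r, ?_⟩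
  -- the entry after an entry `one j` is `two j`, and the last entry is `two j₀` as well
  have hmem : lo r ∈ Finset.univ.filter fun a : Fin β.degree =>
      a ≤ lo r ∧ (permSeq (simple r) i).1 a ∈ Set.range two := by
    simp [hlo]
  refine lt_of_le_of_lt ?_ (Finset.card_erase_lt_of_mem hmem)
  have hstep : ∀ a : Fin β.degree, a ≤ lo r → (permSeq (simple r) i).1 a ∈ Set.range one →
      ∃ b : Fin β.degree, b.1 = a.1 + 1 ∧ b < lo r ∧ i.1 b ∈ Set.range two := by
    rintro a ha ⟨j, hj⟩
    have ha' : a < lo r := lt_of_le_of_ne ha (by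
      rintro rfl
      exact hne _ _ (hj.trans hlo))
    rw [hlt ha'] at hj
    obtain ⟨h, h'⟩ := hi a j hj.symm
    refine ⟨⟨a.1 + 1, h⟩, rfl, lt_of_le_of_ne (Nat.succ_le_of_lt ha') ?_, j, h'.symm⟩
    intro h2
    rw [h2] at h'
    exact hne _ _ (hj₀.trans h')
  choose! f hf hf' hf'' using hstep
  refine Finset.card_le_card_of_injOn f (fun a ha => ?_) (fun a ha b hb hab => ?_)
  · simp only [Finset.coe_filter, Finset.mem_univ, true_and, Set.mem_ofPred_eq] at ha
    have h1 := hf' a ha.1 ha.2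
    refine Finset.mem_coe.2 (Finset.mem_erase.2 ⟨h1.ne, ?_⟩)
    simp only [Finset.mem_filter, Finset.mem_univ, true_and]
    refine ⟨h1.le, ?_⟩
    rw [hlt h1]
    exact hf'' a ha.1 ha.2
  · simp only [Finset.coe_filter, Finset.mem_univ, true_and, Set.mem_ofPred_eq] at ha hb
    have h1 := congrArg Fin.val hab
    rw [hf a ha.1 ha.2, hf b hb.1 hb.2] at h1
    exact Fin.ext (Nat.succ_injective h1)

end Unordered

/-! ### Spanning sets of balanced algebras -/

section Spanning

variable (k : Type w) [Field k]

section General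

variable {V : Type u} [Quiver.{v} V] {J : Type*} {one two : J → V} {β : V →₀ ℕ}

theorem toBalanced_add (a b : Block k β) :
    toBalanced k one two β (a + b) = toBalanced k one two β a + toBalanced k one two β b :=
  map_add (toBalancedLin k one two β) a b

theorem toBalanced_mul_e_eq_zero {i : seqs β} (hi : ¬ IsWellOrdered one two i.1) (a : Block k β) :
    toBalanced k one two β (a * e k i) = 0 := by
  have h : toCorner (ordIdem_isIdempotentElem k one two β) (a * e k i) = 0 := Subtype.ext (by
    rw [toCorner_val, mul_assoc, mul_assoc, e_mul_ordIdem, if_neg hi, mul_zero, mul_zero]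
    rfl)
  unfold toBalanced
  rw [h]
  rfl

/-- A crossing of a pair `one j`, `two j` passes through an unordered sequence. -/
theorem toBalanced_mul_tau_mul_e (hne : ∀ j j', one j ≠ two j') {i : seqs β}
    (hi : IsWellOrdered one two i.1) {r : Fin (β.degree - 1)} (hr : i.1 (lo r) ∈ Set.range one)
    (a b : Block k β) : toBalanced k one two β (a * tau k _ r * e k i * b) = 0 := by
  rw [mul_assoc a, tau_mul_e, ← mul_assoc, mul_assoc (a * _)]
  exact toBalanced_eq_zero k one two β (isUnordered_permSeq_simple hne hi hr) a _

end General

open MvPolynomial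

variable {I : Type u} [Quiver.{v} I] {I₁ : Set I} {α : I →₀ ℕ}

/-- The square of the crossing of a pair `i¹, i²` is the difference of the two variables, so these
variables agree in the balanced algebra. -/
theorem cls_mul_x_mul_e (b : Block k (dblDim I₁ α)) (i : seqs α)
    (a : Fin (dblDim I₁ α).degree) :
    cls k I₁ (b * x k _ a * e k (dblSeq I₁ i))
      = cls k I₁ (b * x k _ (startPos I₁ i (blk I₁ i a)) * e k (dblSeq I₁ i)) := by
  rcases val_eq_or i a with h | ⟨hm, h⟩
  · rw [← h]
  · set t := blk I₁ i a
    let q : Fin ((dblDim I₁ α).degree - 1) := ⟨dblPos I₁ i t.1, by have := a.2; omega⟩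
    have hlo : lo q = startPos I₁ i t := Fin.ext rfl
    have hhi : hi q = a := Fin.ext h.symm
    have hone : (dblSeq I₁ i).1 (lo q) = .one ⟨i.1 t, hm⟩ := dblSeq_one hm rfl
    have htwo : (dblSeq I₁ i).1 (hi q) = .two ⟨i.1 t, hm⟩ := dblSeq_two hm rfl
    have h1 := (relations_alg k (S := seqs (dblDim I₁ α))).tau_sq q (dblSeq I₁ i)
    rw [hone, htwo, klrQ, if_neg (by simp), arrowCount_one_two, arrowCount_two_one, pow_one,
      pow_zero, mul_one, hlo, hhi] at h1
    have h2 := toBalanced_mul_tau_mul_e k (one := DoubledVertex.one (I₁ := I₁))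
      (two := DoubledVertex.two) (by simp) (isWellOrdered_dblSeq i) (r := q) ⟨_, hone.symm⟩
      (b * tau k _ q) 1
    rw [mul_one, mul_assoc b, mul_assoc b, h1, sub_mul, mul_sub, ← mul_assoc, ← mul_assoc,
      ← toBalancedLin_apply, map_sub, sub_eq_zero] at h2
    exact h2

theorem cls_mul_polyHom_mul_e (b : Block k (dblDim I₁ α)) (i : seqs α)
    (p : MvPolynomial (Fin (dblDim I₁ α).degree) k) :
    cls k I₁ (b * polyHom k _ p * e k (dblSeq I₁ i))
      = cls k I₁ (b * polyHom k _ (rename (startPos I₁ i) (rename (blk I₁ i) p))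
          * e k (dblSeq I₁ i)) := by
  induction p using MvPolynomial.induction_on generalizing b with
  | C c => simp
  | add p q hp hq =>
    simp only [map_add, mul_add, add_mul, toBalanced_add, cls] at hp hq ⊢
    rw [hp, hq]
  | mul_X p a hp =>
    simp only [map_mul, polyHom_X, rename_X]
    rw [← mul_assoc, cls_mul_x_mul_e, mul_assoc b, ← polyHom_X, ← map_mul, mul_comm p, map_mul,
      ← mul_assoc, hp, mul_assoc b, ← map_mul, mul_comm (X _), map_mul, mul_assoc b]

/-- The product of the elements `τ*_r` along a word, on `φ(i)`. -/
noncomputable def starLift : List (Fin (α.degree - 1)) → seqs α → Block k (dblDim I₁ α)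
  | [], i => e k (dblSeq I₁ i)
  | r :: l, i => tauStarAt k I₁ r (permSeq (wordPerm l) i) * starLift l i

/-- The products of the `τ*_r` are, up to a sign, products of the crossings along `starList`. -/
theorem starLift_eq (l : List (Fin (α.degree - 1))) (i : seqs α) : ∃ c : k, c * c = 1 ∧
    starLift (I₁ := I₁) k l i = c • (wordTau k (starList I₁ l i) * e k (dblSeq I₁ i)) := by
  induction l with
  | nil => exact ⟨1, one_mul 1, by simp [starLift, starList]⟩
  | cons r l ih =>
    obtain ⟨c, hc, h⟩ := ih
    set j := permSeq (wordPerm l) i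
    have hs : starSign k I₁ r j * starSign k I₁ r j = 1 := by
      unfold starSign
      split_ifs <;> simp
    refine ⟨starSign k I₁ r j * c, by linear_combination c * c * hs + hc, ?_⟩
    rw [starLift, h, tauStarAt_eq, starList, wordTau_append, mul_smul_comm, smul_mul_assoc,
      smul_smul, mul_comm c, mul_assoc _ (e k _), wordTau_mul_e,
      (isBlockPerm_starList l i).permSeq_dblSeq, ← mul_assoc (e k _), e_mul_self,
      ← (isBlockPerm_starList l i).permSeq_dblSeq, ← wordTau_mul_e, mul_assoc]

theorem e_dblSeq_mul_ordIdem (i : seqs α) :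
    e k (dblSeq I₁ i) * dblIdem k I₁ α = e k (dblSeq I₁ i) := by
  classical
  rw [e_mul_ordIdem, if_pos (isWellOrdered_dblSeq i)]

theorem dblAct_mul_of_mul_e {a : Block k (dblDim I₁ α)} {i : seqs α}
    (ha : a * e k (dblSeq I₁ i) = a) (b : Block k (dblDim I₁ α)) :
    dblAct k I₁ α (a * b) = dblAct k I₁ α a * dblAct k I₁ α b := by
  rw [← dblAct_mul_idem_mul, ← ha, mul_assoc a _ (dblIdem k I₁ α), e_dblSeq_mul_ordIdem]

theorem tauStarAt_mul_e (r : Fin (α.degree - 1)) (i : seqs α) :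
    tauStarAt k I₁ r i * e k (dblSeq I₁ i) = tauStarAt k I₁ r i := by
  rw [tauStarAt_eq, smul_mul_assoc, mul_assoc, e_mul_self]

theorem starLift_mul_e (l : List (Fin (α.degree - 1))) (i : seqs α) :
    starLift (I₁ := I₁) k l i * e k (dblSeq I₁ i) = starLift k l i := by
  obtain ⟨c, -, h⟩ := starLift_eq (I₁ := I₁) k l i
  rw [h, smul_mul_assoc, mul_assoc, e_mul_self]

theorem dblAct_starLift (hI : ∀ i ∈ I₁, ∀ j ∈ I₁, IsEmpty (i ⟶ j))
    (l : List (Fin (α.degree - 1))) (i : seqs α) :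
    dblAct k I₁ α (starLift k l i) = polRep k α (wordTau k l * e k i) := by
  induction l with
  | nil => rw [starLift, wordTau_nil, one_mul, dblAct_e]
  | cons r l ih =>
    rw [starLift, dblAct_mul_of_mul_e k (tauStarAt_mul_e k _ _), ih, dblAct_tauStarAt k hI,
      ← map_mul, mul_assoc, wordTau_mul_e, ← mul_assoc (e k _), e_mul_self, ← wordTau_mul_e,
      wordTau_cons, mul_assoc]

variable (I₁) in
/-- The combination of the elements `τ*_w p(x*) e(φ(i))` with given coefficients, in `S_ᾱ`. -/
noncomputable def starCombine : Coeffs k α →ₗ[k] DoubledBalanced k I₁ α where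
  toFun p := ∑ w, ∑ i, cls k I₁
    (starLift k (redWord w) i * polyHom k _ (rename (startPos I₁ i) (p w i)))
  map_add' p q := by
    simp only [Pi.add_apply, map_add, mul_add, toBalanced_add, cls, Finset.sum_add_distrib]
  map_smul' c p := by
    simp only [Pi.smul_apply, map_smul, mul_smul_comm, cls, ← toBalancedLin_apply,
      Finset.smul_sum, RingHom.id_apply]

theorem starCombine_apply (p : Coeffs k α) : starCombine k I₁ p = ∑ w, ∑ i, cls k I₁
    (starLift k (redWord w) i * polyHom k _ (rename (startPos I₁ i) (p w i))) := rfl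

theorem cls_starLift_mem_range (w : Equiv.Perm (Fin α.degree)) (i : seqs α)
    (p : MvPolynomial (Fin α.degree) k) :
    cls k I₁ (starLift k (redWord w) i * polyHom k _ (rename (startPos I₁ i) p))
      ∈ LinearMap.range (starCombine k I₁ (α := α)) := by
  classical
  refine ⟨Pi.single w (Pi.single i p), ?_⟩
  have h0 : toBalanced k (DoubledVertex.one (I₁ := I₁)) DoubledVertex.two (dblDim I₁ α) 0 = 0 :=
    map_zero (toBalancedLin k _ _ _)
  rw [starCombine_apply, Finset.sum_eq_single w, Finset.sum_eq_single i, Pi.single_eq_same,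
    Pi.single_eq_same]
  · intro j _ hj
    rw [Pi.single_eq_same, Pi.single_eq_of_ne hj, map_zero, map_zero, mul_zero, cls, h0]
  · simp
  · intro w' _ hw
    simp [Pi.single_eq_of_ne hw, cls, h0]
  · simp

/-- A combination of the `τ*_w p(x*) e(φ(i))` acts on polynomials as the combination of the
`τ_w p(x) e(i)` with the same coefficients. -/
theorem dblAct_starCombine (hI : ∀ i ∈ I₁, ∀ j ∈ I₁, IsEmpty (i ⟶ j))
    {θ : DoubledBalanced k I₁ α →ₐ[k] Module.End k (PolSpace k α)}
    (hθ : ∀ a, θ (cls k I₁ a) = dblAct k I₁ α a) (p : Coeffs k α) :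
    θ (starCombine k I₁ p) = polRep k α (combine k p) := by
  rw [starCombine_apply, combine_apply]
  simp only [map_sum]
  refine Finset.sum_congr rfl fun w _ => Finset.sum_congr rfl fun i _ => ?_
  have h1 : starLift (I₁ := I₁) k (redWord w) i * polyHom k _ (rename (startPos I₁ i) (p w i))
      = starLift k (redWord w) i
        * (polyHom k _ (rename (startPos I₁ i) (p w i)) * e k (dblSeq I₁ i)) := by
    rw [polyHom_mul_e, ← mul_assoc, starLift_mul_e]
  rw [hθ, h1, dblAct_mul_of_mul_e k (starLift_mul_e k _ _), dblAct_starLift k hI, dblAct_polyHom,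
    ← map_mul, polyHom_mul_e, mul_assoc, ← mul_assoc (e k i), e_mul_self, ← polyHom_mul_e,
    mul_assoc]

/-- A reduced word on `φ(i)` vanishes in the balanced algebra, or it reverses a pair `i¹, i²` and
factors through an unordered sequence up to shorter words, or it permutes the blocks of `φ(i)` and
is a product of the `τ*_r` up to sign and shorter words. -/
theorem cls_filt_mem_range (n : ℕ) : ∀ a ∈ filt k (dblDim I₁ α) n,
    cls k I₁ a ∈ LinearMap.range (starCombine k I₁ (α := α)) := by
  classical
  induction n with
  | zero =>
    have hle : filt k (dblDim I₁ α) 0 ≤ ⊥ := Submodule.span_le.2 (by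
      rintro _ ⟨l, y, hy, hl, rfl⟩
      exact absurd hl (Nat.not_lt_zero _))
    intro a ha
    rw [(Submodule.mem_bot k).1 (hle ha), cls, ← toBalancedLin_apply, map_zero]
    exact zero_mem _
  | succ n ih =>
    intro a ha
    have hsub : ∀ {a b : Block k (dblDim I₁ α)}, a - b ∈ filt k _ n →
        cls k I₁ b ∈ LinearMap.range (starCombine k I₁ (α := α)) →
        cls k I₁ a ∈ LinearMap.range (starCombine k I₁ (α := α)) := by
      intro a b hab hb
      have h1 := ih _ hab
      rw [cls, ← toBalancedLin_apply, map_sub] at h1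
      exact (Submodule.sub_mem_iff_left _ hb).1 h1
    have hle : filt k (dblDim I₁ α) (n + 1)
        ≤ (LinearMap.range (starCombine k I₁ (α := α))).comap (toBalancedLin k _ _ _) := by
      refine Submodule.span_le.2 ?_
      rintro _ ⟨l, y, hy, hl, rfl⟩
      rw [eq_sum_mul_e k (_ * y)]
      refine sum_mem fun j _ => ?_
      obtain ⟨p, hp⟩ := exists_polyHom_mul_e k hy j
      rw [mul_assoc, hp, ← mul_assoc]
      change cls k I₁ _ ∈ LinearMap.range (starCombine k I₁ (α := α))
      by_cases hj : IsWellOrdered (DoubledVertex.one (I₁ := I₁)) DoubledVertex.two j.1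
      swap
      · rw [cls, toBalanced_mul_e_eq_zero k hj]
        exact zero_mem _
      obtain ⟨i, rfl⟩ := exists_dblSeq_eq hj
      have hpe : polyHom k _ p * e k (dblSeq I₁ i) ∈ polySub k (dblDim I₁ α) :=
        hp ▸ mul_mem hy (e_mem_polySub k _)
      have hln : filt k (dblDim I₁ α) l.length ≤ filt k _ n := filt_mono k (by omega)
      by_cases hr : IsReduced l
      swap
      · rw [mul_assoc]
        exact ih _ (filt_mul_polySub (hln (wordTau_mem_filt_of_not_isReduced hr)) hpe)
      by_cases hw : IsWellOrdered (DoubledVertex.one (I₁ := I₁)) DoubledVertex.two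
        (permSeq (wordPerm l) (dblSeq I₁ i)).1
      swap
      · rw [mul_assoc, polyHom_mul_e, ← mul_assoc, wordTau_mul_e, mul_assoc, cls,
          toBalanced_e_mul_eq_zero k _ _ _ hw]
        exact zero_mem _
      obtain ⟨i', hi'⟩ := exists_dblSeq_eq hw
      by_cases hpair : ∀ (t : Fin α.degree) (a b : Fin (dblDim I₁ α).degree), i.1 t ∈ I₁ →
          a.1 = dblPos I₁ i t.1 → b.1 = dblPos I₁ i t.1 + 1 → wordPerm l a < wordPerm l b
      · obtain ⟨σ, hσ⟩ := exists_isBlockPerm hi'.symm hpair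
        have hσ' := isBlockPerm_starList (I₁ := I₁) (redWord σ) i
        rw [wordPerm_redWord] at hσ'
        obtain ⟨c, hc, hlift⟩ := starLift_eq (I₁ := I₁) k (redWord σ) i
        have h1 := wordTau_sub_mem_filt (k := k) hr (isReduced_starList_redWord σ i)
          (hσ.unique hσ')
        have h2 := filt_mul_polySub (hln h1) hpe
        rw [sub_mul, ← mul_assoc, ← mul_assoc] at h2
        refine hsub h2 ?_
        have h3 : wordTau k (starList I₁ (redWord σ) i) * polyHom k _ p * e k (dblSeq I₁ i)
            = c • (starLift k (redWord σ) i * polyHom k _ p * e k (dblSeq I₁ i)) := by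
          rw [hlift, smul_mul_assoc, smul_mul_assoc, smul_smul, hc, one_smul, mul_assoc,
            polyHom_mul_e, ← mul_assoc, mul_assoc _ _ (e k _), polyHom_mul_e, ← mul_assoc,
            mul_assoc _ (e k _) (e k _), e_mul_self]
        rw [h3, cls, ← toBalancedLin_apply, map_smul, toBalancedLin_apply]
        refine Submodule.smul_mem _ _ ?_
        have h4 := cls_mul_polyHom_mul_e k (starLift (I₁ := I₁) k (redWord σ) i) i p
        rw [mul_assoc _ _ (e k (dblSeq I₁ i)), mul_assoc _ _ (e k (dblSeq I₁ i)), polyHom_mul_e,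
          polyHom_mul_e, ← mul_assoc, ← mul_assoc, starLift_mul_e] at h4
        rw [mul_assoc _ _ (e k (dblSeq I₁ i)), polyHom_mul_e, ← mul_assoc, starLift_mul_e]
        have h5 := cls_starLift_mem_range (I₁ := I₁) k σ i (rename (blk I₁ i) p)
        rw [← h4] at h5
        exact h5
      · push Not at hpair
        -- the word reverses a pair, so the crossing of this pair may be taken to act first
        obtain ⟨t, a, b, ht, ha, hb, hab⟩ := hpair
        let q : Fin ((dblDim I₁ α).degree - 1) := ⟨a.1, by have := b.2; omega⟩
        have hqa : lo q = a := Fin.ext rfl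
        have hqb : hi q = b := Fin.ext (by rw [hi_val]; change a.1 + 1 = b.1; omega)
        have hlt : wordPerm l (hi q) < wordPerm l (lo q) := by
          rw [hqa, hqb]
          refine lt_of_le_of_ne hab ((wordPerm l).injective.ne ?_)
          exact Fin.ne_of_val_ne (by omega)
        have hc : IsReduced (redWord (wordPerm l * simple q) ++ [q]) :=
          (isReduced_redWord _).concat (by rw [wordPerm_redWord]; simpa using hlt)
        have hce : wordPerm (redWord (wordPerm l * simple q) ++ [q]) = wordPerm l := by
          rw [wordPerm_concat, wordPerm_redWord, mul_assoc, simple_mul_self, mul_one]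
        have h1 := filt_mul_polySub (hln (wordTau_sub_mem_filt (k := k) hr hc hce.symm)) hpe
        rw [sub_mul, ← mul_assoc] at h1
        refine hsub h1 ?_
        rw [wordTau_concat, polyHom_mul_e, ← mul_assoc, cls, toBalanced_mul_tau_mul_e k (by simp)
          (isWellOrdered_dblSeq i) ⟨⟨_, ht⟩, (dblSeq_one ht (by rw [hqa, ha])).symm⟩]
        exact zero_mem _
    exact hle ha

/-- The elements `τ*_w p(x*) e(φ(i))` span the balanced algebra. -/
theorem starCombine_surjective : Function.Surjective (starCombine k I₁ (α := α)) := fun s => by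
  obtain ⟨a, rfl⟩ := toBalanced_surjective k _ _ _ s
  obtain ⟨n, hn⟩ := exists_mem_filt a
  exact cls_filt_mem_range k n a hn

end Spanning

/-! ### The isomorphism -/

section Isomorphism

variable (k : Type w) [Field k] {I : Type u} [Quiver.{v} I] {I₁ : Set I} {α : I →₀ ℕ}

/-- The two algebras are identified as algebras of operators: both are spanned by the combinations
with coefficients in `Coeffs k α`, which act by the same operators and are determined by these. -/
theorem exists_doubledEquiv (hI : ∀ i ∈ I₁, ∀ j ∈ I₁, IsEmpty (i ⟶ j)) :
    ∃ Φ : Block k α ≃ₐ[k] DoubledBalanced k I₁ α,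
      (∀ i : seqs α, Φ (e k i) = cls k I₁ (e k (dblSeq I₁ i))) ∧
      (∀ (r : Fin α.degree) (i : seqs α),
        Φ (x k (seqs α) r * e k i) = cls k I₁ (xStarAt k I₁ r i)) ∧
      (∀ (r : Fin (α.degree - 1)) (i : seqs α),
        Φ (tau k (seqs α) r * e k i) = cls k I₁ (tauStarAt k I₁ r i)) := by
  obtain ⟨θ, hθ⟩ := exists_balancedRep (I₁ := I₁) (α := α) k
  have hcomb := dblAct_starCombine k hI hθ
  have hinj : Function.Injective θ := by
    rw [injective_iff_map_eq_zero]
    intro s hs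
    obtain ⟨p, rfl⟩ := starCombine_surjective k s
    rw [hcomb] at hs
    rw [polRep_combine_injective k hs, map_zero]
  -- both algebras act faithfully on polynomials, and by the same operators
  have hrange : (polRep k α).range = θ.range := by
    ext T
    constructor
    · rintro ⟨a, rfl⟩
      obtain ⟨p, rfl⟩ := combine_surjective k a
      exact ⟨_, hcomb p⟩
    · rintro ⟨s, rfl⟩
      obtain ⟨p, rfl⟩ := starCombine_surjective k s
      exact ⟨_, (hcomb p).symm⟩
  let Φ : Block k α ≃ₐ[k] DoubledBalanced k I₁ α :=
    (AlgEquiv.ofInjective (polRep k α) (polRep_injective k)).trans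
      ((Subalgebra.equivOfEq _ _ hrange).trans (AlgEquiv.ofInjective θ hinj).symm)
  have hΦ : ∀ a, θ (Φ a) = polRep k α a := fun a =>
    congrArg Subtype.val ((AlgEquiv.ofInjective θ hinj).apply_symm_apply
      (Subalgebra.equivOfEq _ _ hrange (AlgEquiv.ofInjective (polRep k α) (polRep_injective k) a)))
  refine ⟨Φ, fun i => hinj ?_, fun r i => hinj ?_, fun r i => hinj ?_⟩
  · rw [hΦ, hθ, dblAct_e]
  · rw [hΦ, hθ, dblAct_xStarAt]
  · rw [hΦ, hθ, dblAct_tauStarAt k hI]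

end Isomorphism

/-! ### Functoriality of balanced algebras -/

section Functoriality

variable {k : Type w} [Field k]

section

variable {V : Type u} [Quiver.{v} V] {J : Type*} {one two : J → V} {β : V →₀ ℕ}

theorem toBalanced_ordIdem_mul_mul_ordIdem (a : Block k β) :
    toBalanced k one two β (ordIdem k one two β * a * ordIdem k one two β)
      = toBalanced k one two β a := by
  have hid := ordIdem_isIdempotentElem k one two β
  have h : toCorner hid (ordIdem k one two β * a * ordIdem k one two β) = toCorner hid a :=
    Subtype.ext (by
      rw [toCorner_val, toCorner_val]
      simp only [← mul_assoc, hid.eq]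
      rw [mul_assoc _ (ordIdem k one two β) (ordIdem k one two β), hid.eq])
  unfold toBalanced
  rw [h]

theorem toBalanced_ordIdem : toBalanced k one two β (ordIdem k one two β) = 1 := by
  have h := toBalanced_ordIdem_mul_mul_ordIdem (one := one) (two := two) (1 : Block k β)
  rwa [mul_one, (ordIdem_isIdempotentElem k one two β).eq, toBalanced_one] at h

/-- The balanced algebra is a quotient of the subalgebra `𝐞 R_β 𝐞` of `R_β`. -/
theorem isSubquotientAlgebra_of_balanced {B : Type*} [Ring B] [Algebra k B]
    (Φ : B ≃ₐ[k] Balanced k one two β) : IsSubquotientAlgebra k B (Block k β) := by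
  have hid := ordIdem_isIdempotentElem k one two β
  let C : NonUnitalSubalgebra k (Block k β) :=
    { carrier := {a | ordIdem k one two β * a = a ∧ a * ordIdem k one two β = a}
      add_mem' := fun {a b} ha hb =>
        ⟨by rw [mul_add, ha.1, hb.1], by rw [add_mul, ha.2, hb.2]⟩
      zero_mem' := ⟨mul_zero _, zero_mul _⟩
      mul_mem' := fun {a b} ha hb =>
        ⟨by rw [← mul_assoc, ha.1], by rw [mul_assoc, hb.2]⟩
      smul_mem' := fun c a ha =>
        ⟨by rw [mul_smul_comm, ha.1], by rw [smul_mul_assoc, ha.2]⟩ }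
  let f : C →ₙₐ[k] B :=
    { toFun := fun a => Φ.symm (toBalanced k one two β a.1)
      map_smul' := fun c a => (congrArg Φ.symm (map_smul (toBalancedLin k one two β) c a.1)).trans
        (map_smul Φ.symm c _)
      map_zero' := (congrArg Φ.symm (map_zero (toBalancedLin k one two β))).trans (map_zero Φ.symm)
      map_add' := fun a b => (congrArg Φ.symm (toBalanced_add k a.1 b.1)).trans
        (map_add Φ.symm _ _)
      map_mul' := fun a b => (congrArg Φ.symm
        (toBalanced_mul_of_mul_ordIdem k one two β a.2.2 b.1)).trans (map_mul Φ.symm _ _) }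
  refine ⟨C, f, fun b => ?_⟩
  obtain ⟨a, ha⟩ := toBalanced_surjective k one two β (Φ b)
  refine ⟨⟨ordIdem k one two β * a * ordIdem k one two β, ?_, ?_⟩, ?_⟩
  · rw [← mul_assoc, ← mul_assoc, hid.eq]
  · rw [mul_assoc, hid.eq]
  · change Φ.symm (toBalanced k one two β _) = b
    rw [toBalanced_ordIdem_mul_mul_ordIdem, ha, Φ.symm_apply_apply]

variable {V' : Type*} [Quiver V'] {J' : Type*} {one' two' : J' → V'} {β' : V' →₀ ℕ}

/-- A homomorphism of KLR algebras that preserves `𝐞` and the idempotents of unordered sequences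
descends to the balanced algebras. -/
theorem exists_balanced_map (f : Block k β →ₐ[k] Block k β')
    (hf : f (ordIdem k one two β) = ordIdem k one' two' β')
    (hun : ∀ i : seqs β, IsUnordered one two i.1 →
      ∃ i' : seqs β', IsUnordered one' two' i'.1 ∧ f (e k i) = e k i') :
    ∃ g : Balanced k one two β →ₐ[k] Balanced k one' two' β',
      ∀ a, g (toBalanced k one two β a) = toBalanced k one' two' β' (f a) := by
  have hid := ordIdem_isIdempotentElem k one two β
  let F : OrdCorner k one two β →ₐ[k] Balanced k one' two' β' := AlgHom.ofLinearMap
    { toFun := fun y => toBalanced k one' two' β' (f y.1)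
      map_add' := fun y z => (congrArg _ (map_add f y.1 z.1)).trans (toBalanced_add k _ _)
      map_smul' := fun c y => (congrArg _ (map_smul f c y.1)).trans
        (map_smul (toBalancedLin k one' two' β') c _) }
    ((congrArg _ hf).trans toBalanced_ordIdem)
    (fun y z => by
      obtain ⟨b, hb⟩ := toCorner_surjective hid y
      have hy : y.1 * ordIdem k one two β = y.1 := by
        rw [← hb, toCorner_val, mul_assoc, hid.eq]
      change toBalanced k one' two' β' (f (y.1 * z.1)) = _
      rw [map_mul, toBalanced_mul_of_mul_ordIdem]
      · rfl
      · rw [← hf, ← map_mul, hy])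
  have hF : ∀ a, F (toCorner hid a) = toBalanced k one' two' β' (f a) := fun a => by
    change toBalanced k one' two' β' (f (ordIdem k one two β * a * ordIdem k one two β)) = _
    rw [map_mul, map_mul, hf, toBalanced_ordIdem_mul_mul_ordIdem]
  obtain ⟨g, hg⟩ := exists_balanced_lift F fun i a b hi => by
    obtain ⟨i', hi', he⟩ := hun i hi
    rw [hF, map_mul, map_mul, he, toBalanced_eq_zero k one' two' β' hi']
  exact ⟨g, fun a => (hg a).trans (hF a)⟩

end

/-! ### Isomorphic quivers -/

theorem klrQ_congr {V V' : Type*} [Quiver V] [Quiver V'] {A : Type*} [Ring A] (g : V ≃ V')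
    (hg : ∀ a b, arrowCount (g a) (g b) = arrowCount a b) (i j : V) (a b : A) :
    klrQ (g i) (g j) a b = klrQ i j a b := by
  unfold klrQ
  by_cases h : i = j <;> simp [h, hg]

theorem klrDiff_congr {V V' : Type*} [Quiver V] [Quiver V'] {A : Type*} [Ring A] (g : V ≃ V')
    (hg : ∀ a b, arrowCount (g a) (g b) = arrowCount a b) (i j : V) (a b c : A) :
    klrDiff (g i) (g j) a b c = klrDiff i j a b c := by
  unfold klrDiff
  by_cases h : i = j <;> simp [h, hg]

variable {V : Type*} {V' : Type*}

theorem exists_alg_map [Quiver V] [Quiver V'] {d : ℕ} {S : Set (Fin d → V)}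
    {S' : Set (Fin d → V')} [Fintype S] [Fintype S'] (g : V ≃ V')
    (hg : ∀ a b, arrowCount (g a) (g b) = arrowCount a b)
    (σ : S ≃ S') (hσ : ∀ i a, (σ i).1 a = g (i.1 a)) :
    ∃ f : Alg k d S →ₐ[k] Alg k d S', (∀ i, f (e k i) = e k (σ i)) ∧
      (∀ r, f (x k S r) = x k S' r) ∧ ∀ r, f (tau k S r) = tau k S' r := by
  classical
  have R := relations_alg k (S := S')
  refine exists_lift (E := fun i => e k (σ i)) (X := x k S') (T := tau k S')
    ⟨fun i => R.e_mul_self _, fun i j h => R.e_mul_ne _ _ (σ.injective.ne h),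
      (Equiv.sum_comp σ (fun i => e k i)).trans R.sum_e, fun r i => R.x_e r _, fun r i j h => ?_,
      R.x_x, fun r i => ?_, fun r i => ?_, R.tau_x, R.tau_tau, fun r i => ?_, fun r s h i => ?_⟩
  · refine R.tau_e r _ _ (funext fun a => ?_)
    rw [hσ, h]
    exact (hσ i _).symm
  · have := R.tau_x_hi r (σ i)
    simpa only [hσ, g.injective.eq_iff] using this
  · have := R.x_hi_tau r (σ i)
    simpa only [hσ, g.injective.eq_iff] using this
  · have := R.tau_sq r (σ i)
    simpa only [hσ, klrQ_congr g hg] using this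
  · have := R.braid r s h (σ i)
    simpa only [hσ, klrDiff_congr g hg, g.injective.eq_iff] using this

theorem exists_alg_equiv [Quiver V] [Quiver V'] {d d' : ℕ} (hd : d = d')
    {S : Set (Fin d → V)} {S' : Set (Fin d' → V')} [Fintype S] [Fintype S'] (g : V ≃ V')
    (hg : ∀ a b, arrowCount (g a) (g b) = arrowCount a b)
    (σ : S ≃ S') (hσ : ∀ i a, (σ i).1 (Fin.cast hd a) = g (i.1 a)) :
    ∃ f : Alg k d S ≃ₐ[k] Alg k d' S', ∀ i, f (e k i) = e k (σ i) := by
  subst hd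
  obtain ⟨f, fE, fX, fT⟩ := exists_alg_map (k := k) g hg σ hσ
  obtain ⟨f', fE', fX', fT'⟩ := exists_alg_map (k := k) g.symm
    (fun a b => by rw [← hg, g.apply_symm_apply, g.apply_symm_apply]) σ.symm
    (fun i a => by
      rw [Equiv.eq_symm_apply]
      have := hσ (σ.symm i) a
      rw [σ.apply_symm_apply] at this
      exact this.symm)
  refine ⟨AlgEquiv.ofAlgHom f f' (hom_ext k (fun i => ?_) (fun r => ?_) (fun r => ?_))
    (hom_ext k (fun i => ?_) (fun r => ?_) (fun r => ?_)), fE⟩ <;>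
  simp [fE, fX, fT, fE', fX', fT']

theorem isWellOrdered_relabel {J J' : Type*} {one two : J → V} {one' two' : J' → V'} (g : V ≃ V')
    (h : J ≃ J') (h1 : ∀ j, one' (h j) = g (one j)) (h2 : ∀ j, two' (h j) = g (two j)) {d d' : ℕ}
    (hd : d = d') {i : Fin d → V} {i' : Fin d' → V'} (hi : ∀ a, i' (Fin.cast hd a) = g (i a)) :
    IsWellOrdered one' two' i' ↔ IsWellOrdered one two i := by
  subst hd
  obtain rfl : i' = g ∘ i := funext hi
  simp only [IsWellOrdered, Function.comp_apply, ← h.forall_congr_right,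
    h1, h2, g.injective.eq_iff]

theorem isUnordered_relabel {J J' : Type*} {one two : J → V} {one' two' : J' → V'} (g : V ≃ V')
    (h : J ≃ J') (h1 : ∀ j, one' (h j) = g (one j)) (h2 : ∀ j, two' (h j) = g (two j)) {d d' : ℕ}
    (hd : d = d') {i : Fin d → V} {i' : Fin d' → V'} (hi : ∀ a, i' (Fin.cast hd a) = g (i a)) :
    IsUnordered one' two' i' ↔ IsUnordered one two i := by
  subst hd
  obtain rfl : i' = g ∘ i := funext hi
  have hr : ∀ {f : J → V} {f' : J' → V'}, (∀ j, f' (h j) = g (f j)) → ∀ v,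
      g v ∈ Set.range f' ↔ v ∈ Set.range f := fun hf v => by
    simp only [Set.mem_range, ← h.exists_congr_right, hf, g.injective.eq_iff]
  exact exists_congr fun r => iff_of_eq (congrArg₂ (· < ·)
    (congrArg Finset.card (by ext a; simp only [Finset.mem_filter, Function.comp_apply, hr h1]))
    (congrArg Finset.card (by ext a; simp only [Finset.mem_filter, Function.comp_apply, hr h2])))

theorem degree_relabel {β : V →₀ ℕ} {β' : V' →₀ ℕ} (g : V ≃ V')
    (hβ : ∀ v, β' (g v) = β v) : β.degree = β'.degree := by
  obtain rfl : β' = β.mapDomain g := by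
    ext v
    obtain ⟨v, rfl⟩ := g.surjective v
    rw [hβ, Finsupp.mapDomain_apply g.injective]
  exact (Finsupp.degree_mapDomain g β).symm

theorem relabel_mem_seqs {β : V →₀ ℕ} {β' : V' →₀ ℕ} (g : V ≃ V')
    (hβ : ∀ v, β' (g v) = β v) {d : ℕ} (hd : d = β.degree) (hd' : d = β'.degree) (i : Fin d → V)
    (hi : (fun a => i (Fin.cast hd.symm a)) ∈ seqs β) :
    (fun a => g (i (Fin.cast hd'.symm a))) ∈ seqs β' := by
  change ∑ a, Finsupp.single (i (finCongr hd.symm a)) 1 = _ at hi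
  change ∑ a, Finsupp.single (g (i (finCongr hd'.symm a))) 1 = _
  rw [(finCongr hd.symm).sum_comp (fun a => Finsupp.single (i a) 1)] at hi
  rw [(finCongr hd'.symm).sum_comp (fun a => Finsupp.single (g (i a)) 1)]
  ext v
  obtain ⟨v, rfl⟩ := g.surjective v
  rw [hβ, ← hi, Finsupp.finsetSum_apply, Finsupp.finsetSum_apply]
  refine Finset.sum_congr rfl fun a _ => ?_
  rw [← Finsupp.mapDomain_single, Finsupp.mapDomain_apply g.injective]

/-- The relabelling of the sequences along a bijection of the vertices. -/
noncomputable def relabel {β : V →₀ ℕ} {β' : V' →₀ ℕ} (g : V ≃ V')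
    (hβ : ∀ v, β' (g v) = β v) : seqs β ≃ seqs β' where
  toFun i := ⟨fun a => g (i.1 (Fin.cast (degree_relabel g hβ).symm a)),
    relabel_mem_seqs g hβ rfl (degree_relabel g hβ) i.1 i.2⟩
  invFun i := ⟨fun a => g.symm (i.1 (Fin.cast (degree_relabel g hβ) a)),
    relabel_mem_seqs g.symm (fun v => by rw [← hβ, g.apply_symm_apply]) rfl
      (degree_relabel g hβ).symm i.1 i.2⟩
  left_inv i := Subtype.ext (funext fun a => by simp)
  right_inv i := Subtype.ext (funext fun a => by simp)

theorem relabel_apply {β : V →₀ ℕ} {β' : V' →₀ ℕ} (g : V ≃ V')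
    (hβ : ∀ v, β' (g v) = β v) (i : seqs β) (a : Fin β.degree) :
    (relabel g hβ i).1 (Fin.cast (degree_relabel g hβ) a) = g (i.1 a) := rfl

variable (k) in
/-- Balanced algebras depend only on the numbers of arrows and on the labels of the vertices. -/
theorem nonempty_balanced_equiv [Quiver V] [Quiver V'] {β : V →₀ ℕ} {β' : V' →₀ ℕ}
    {J J' : Type*} {one two : J → V} {one' two' : J' → V'} (g : V ≃ V')
    (hg : ∀ a b, arrowCount (g a) (g b) = arrowCount a b)
    (h : J ≃ J') (h1 : ∀ j, one' (h j) = g (one j)) (h2 : ∀ j, two' (h j) = g (two j))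
    (hβ : ∀ v, β' (g v) = β v) :
    Nonempty (Balanced k one two β ≃ₐ[k] Balanced k one' two' β') := by
  classical
  let σ := relabel g hβ
  obtain ⟨f, fE⟩ := exists_alg_equiv (k := k) (degree_relabel g hβ) g hg σ (relabel_apply g hβ)
  have hwo : ∀ i, IsWellOrdered one' two' (σ i).1 ↔ IsWellOrdered one two i.1 := fun i =>
    isWellOrdered_relabel g h h1 h2 (degree_relabel g hβ) (relabel_apply g hβ i)
  have hun : ∀ i, IsUnordered one' two' (σ i).1 ↔ IsUnordered one two i.1 := fun i =>
    isUnordered_relabel g h h1 h2 (degree_relabel g hβ) (relabel_apply g hβ i)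
  have hid : f (ordIdem k one two β) = ordIdem k one' two' β' := by
    unfold ordIdem eSum
    rw [map_sum]
    simp only [fE]
    refine Finset.sum_equiv σ (fun i => ?_) (fun i _ => rfl)
    simp [hwo]
  obtain ⟨G, hG⟩ := exists_balanced_map (one := one) (two := two) (one' := one') (two' := two')
    f.toAlgHom hid (fun i hi => ⟨σ i, (hun i).2 hi, fE i⟩)
  obtain ⟨G', hG'⟩ := exists_balanced_map (one := one') (two := two') (one' := one) (two' := two)
    f.symm.toAlgHom (f.symm_apply_eq.2 hid.symm) (fun i hi => ⟨σ.symm i, by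
      rw [← hun, σ.apply_symm_apply]
      exact hi, by
      refine f.symm_apply_eq.2 ?_
      rw [fE, σ.apply_symm_apply]⟩)
  refine ⟨AlgEquiv.ofAlgHom G G' (AlgHom.ext fun s => ?_) (AlgHom.ext fun s => ?_)⟩
  · obtain ⟨a, rfl⟩ := toBalanced_surjective k _ _ _ s
    rw [AlgHom.comp_apply, hG', hG]
    exact congrArg _ (f.apply_symm_apply a)
  · obtain ⟨a, rfl⟩ := toBalanced_surjective k _ _ _ s
    rw [AlgHom.comp_apply, hG, hG']
    exact congrArg _ (f.symm_apply_apply a)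

end Functoriality

end KLR

namespace CyclicVertex

/-! ### Cyclic quivers -/

section Cyclic

variable {n : ℕ}

theorem arrowCount_congr {V V' : Type*} [Quiver V] [Quiver V'] {a b : V} {a' b' : V'}
    (h : Subsingleton (a ⟶ b)) (h' : Subsingleton (a' ⟶ b'))
    (hiff : Nonempty (a' ⟶ b') ↔ Nonempty (a ⟶ b)) : arrowCount a' b' = arrowCount a b := by
  unfold arrowCount
  by_cases hne : Nonempty (a ⟶ b)
  · rw [Nat.card_eq_one_iff_unique.2 ⟨h, hne⟩, Nat.card_eq_one_iff_unique.2 ⟨h', hiff.2 hne⟩]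
  · have h1 := not_nonempty_iff.1 hne
    have h2 := not_nonempty_iff.1 (mt hiff.1 hne)
    rw [Nat.card_of_isEmpty, Nat.card_of_isEmpty]

instance (i j : CyclicVertex n) : Subsingleton (i ⟶ j) :=
  inferInstanceAs (Subsingleton (PLift _))

theorem nonempty_hom_iff (i j : CyclicVertex n) :
    Nonempty (i ⟶ j) ↔ j.val.1 = (i.val.1 + 1) % n :=
  ⟨fun ⟨h⟩ => h.down, fun h => ⟨⟨h⟩⟩⟩

theorem succ_mod {n a : ℕ} (h : a < n) : (a + 1) % n = if a + 1 = n then 0 else a + 1 := by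
  split_ifs with h'
  · rw [h', Nat.mod_self]
  · exact Nat.mod_eq_of_lt (by omega)

theorem val_ne {m : Fin n} (i : (({⟨m⟩} : Set (CyclicVertex n))ᶜ : Set _)) :
    i.1.val.1 ≠ m.1 := fun h => i.2 (CyclicVertex.ext (Fin.ext h))

theorem eq_of_mem {m : Fin n} (i : ({⟨m⟩} : Set (CyclicVertex n))) : i.1 = ⟨m⟩ := i.2

/-- The bijection from the vertices of the doubled quiver, for the doubled vertex `m`, to the
vertices of the cyclic quiver of length `n + 1`. -/
def ofDoubled (m : Fin n) : DoubledVertex (CyclicVertex n) {⟨m⟩} → CyclicVertex (n + 1)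
  | .zero i => if i.1.val.1 < m.1 then ⟨i.1.val.castSucc⟩ else ⟨i.1.val.succ⟩
  | .one _ => ⟨m.castSucc⟩
  | .two _ => ⟨m.succ⟩

theorem ofDoubled_zero_val (m : Fin n) (i : (({⟨m⟩} : Set (CyclicVertex n))ᶜ : Set _)) :
    (ofDoubled m (.zero i)).val.1 = if i.1.val.1 < m.1 then i.1.val.1 else i.1.val.1 + 1 := by
  simp only [ofDoubled]
  split_ifs <;> rfl

theorem ofDoubled_one_val (m : Fin n) (i : ({⟨m⟩} : Set (CyclicVertex n))) :
    (ofDoubled m (.one i)).val.1 = m.1 := rfl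

theorem ofDoubled_two_val (m : Fin n) (i : ({⟨m⟩} : Set (CyclicVertex n))) :
    (ofDoubled m (.two i)).val.1 = m.1 + 1 := rfl

theorem ofDoubled_injective (m : Fin n) : Function.Injective (ofDoubled m) := by
  intro a b h
  have h1 := congrArg (fun j => j.val.1) h
  cases a with
  | zero i =>
    have hi := val_ne i
    cases b with
    | zero j =>
      have hj := val_ne j
      rw [ofDoubled_zero_val, ofDoubled_zero_val] at h1
      refine congrArg DoubledVertex.zero (Subtype.ext (CyclicVertex.ext (Fin.ext ?_)))
      split_ifs at h1 <;> omega
    | one j =>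
      rw [ofDoubled_zero_val, ofDoubled_one_val] at h1
      split_ifs at h1 <;> omega
    | two j =>
      rw [ofDoubled_zero_val, ofDoubled_two_val] at h1
      split_ifs at h1 <;> omega
  | one i =>
    cases b with
    | zero j =>
      have hj := val_ne j
      rw [ofDoubled_zero_val, ofDoubled_one_val] at h1
      split_ifs at h1 <;> omega
    | one j => exact congrArg DoubledVertex.one (Subsingleton.elim _ _)
    | two j =>
      rw [ofDoubled_one_val, ofDoubled_two_val] at h1
      omega
  | two i =>
    cases b with
    | zero j =>
      have hj := val_ne j
      rw [ofDoubled_zero_val, ofDoubled_two_val] at h1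
      split_ifs at h1 <;> omega
    | one j =>
      rw [ofDoubled_one_val, ofDoubled_two_val] at h1
      omega
    | two j => exact congrArg DoubledVertex.two (Subsingleton.elim _ _)

theorem ofDoubled_surjective (m : Fin n) : Function.Surjective (ofDoubled m) := by
  rintro ⟨j⟩
  have hm := m.2
  have hj := j.2
  rcases lt_trichotomy j.1 m.1 with h | h | h
  · refine ⟨.zero ⟨⟨⟨j.1, by omega⟩⟩, fun h' => ?_⟩, CyclicVertex.ext (Fin.ext ?_)⟩
    · have := congrArg (fun v => v.val.1) (show _ = _ from h')
      exact h.ne this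
    · rw [ofDoubled_zero_val]
      exact if_pos h
  · exact ⟨.one ⟨⟨m⟩, rfl⟩, CyclicVertex.ext (Fin.ext h.symm)⟩
  · rcases eq_or_lt_of_le (Nat.succ_le_of_lt h) with h2 | h2
    · exact ⟨.two ⟨⟨m⟩, rfl⟩, CyclicVertex.ext (Fin.ext h2)⟩
    · refine ⟨.zero ⟨⟨⟨j.1 - 1, by omega⟩⟩, fun h' => ?_⟩, CyclicVertex.ext (Fin.ext ?_)⟩
      · have h3 := congrArg (fun v => v.val.1) (show _ = _ from h')
        dsimp only at h3
        omega
      · rw [ofDoubled_zero_val]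
        dsimp only
        rw [if_neg (by omega)]
        omega

/-- The doubled quiver of the cyclic quiver, for the doubled vertex `m`, is the cyclic quiver with
one more vertex. -/
theorem arrowCount_ofDoubled (hn : 2 ≤ n) (m : Fin n)
    (a b : DoubledVertex (CyclicVertex n) {⟨m⟩}) :
    arrowCount (ofDoubled m a) (ofDoubled m b) = arrowCount a b := by
  have hm := m.2
  have key : ∀ {a b : DoubledVertex (CyclicVertex n) {⟨m⟩}}, Subsingleton (a ⟶ b) →
      ((ofDoubled m b).val.1 = ((ofDoubled m a).val.1 + 1) % (n + 1) ↔ Nonempty (a ⟶ b)) →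
      arrowCount (ofDoubled m a) (ofDoubled m b) = arrowCount a b := fun h h' =>
    arrowCount_congr h inferInstance ((nonempty_hom_iff _ _).trans h')
  have hsub : ∀ i j : CyclicVertex n, Subsingleton (i ⟶ j) := fun i j => inferInstance
  have hlt := fun a => succ_mod (ofDoubled m a).val.2
  have hP : ∀ {P : Prop}, ¬ P → (P ↔ Nonempty PEmpty) := fun h =>
    iff_of_false h (not_nonempty_iff.2 inferInstance)
  have hz := ofDoubled_zero_val m
  have ho := ofDoubled_one_val m
  have ht := ofDoubled_two_val m
  cases a with
  | zero i =>
    have hi := val_ne i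
    have hi' := i.1.val.2
    have hzi := hz i
    cases b with
    | zero j =>
      have hj := val_ne j
      have hj' := j.1.val.2
      have hzj := hz j
      refine key (hsub i.1 j.1) (Iff.trans ?_ (nonempty_hom_iff i.1 j.1).symm)
      rw [hlt, succ_mod hi']
      split_ifs at hzi hzj ⊢ <;> omega
    | one j =>
      refine key (hsub i.1 j.1) (Iff.trans ?_ (nonempty_hom_iff i.1 j.1).symm)
      rw [hlt, succ_mod hi', ho, eq_of_mem j]
      dsimp only
      split_ifs at hzi ⊢ <;> omega
    | two j =>
      refine key (inferInstanceAs (Subsingleton PEmpty)) (hP fun h => ?_)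
      rw [hlt, ht] at h
      split_ifs at hzi h <;> omega
  | one i =>
    cases b with
    | zero j =>
      have hj := val_ne j
      have hzj := hz j
      refine key (inferInstanceAs (Subsingleton PEmpty)) (hP fun h => ?_)
      rw [hlt, ho] at h
      split_ifs at hzj h <;> omega
    | one j =>
      refine key (inferInstanceAs (Subsingleton PEmpty)) (hP fun h => ?_)
      rw [hlt, ho, ho] at h
      split_ifs at h <;> omega
    | two j =>
      refine key (inferInstanceAs (Subsingleton (ULift (PLift _)))) (iff_of_true ?_ ?_)
      · rw [hlt, ho, ht, if_neg (by omega)]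
      · exact ⟨⟨⟨Subsingleton.elim i j⟩⟩⟩
  | two i =>
    cases b with
    | zero j =>
      have hj := val_ne j
      have hj' := j.1.val.2
      have hzj := hz j
      refine key (hsub i.1 j.1) (Iff.trans ?_ (nonempty_hom_iff i.1 j.1).symm)
      rw [hlt, ht, eq_of_mem i]
      dsimp only
      rw [succ_mod hm]
      split_ifs at hzj ⊢ <;> omega
    | one j =>
      refine key (inferInstanceAs (Subsingleton PEmpty)) (hP fun h => ?_)
      rw [hlt, ht, ho] at h
      split_ifs at h <;> omega
    | two j =>
      refine key (inferInstanceAs (Subsingleton PEmpty)) (hP fun h => ?_)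
      rw [hlt, ht, ht] at h
      split_ifs at h
      omega

theorem bar_ofDoubled (m : Fin n) (α : CyclicVertex n →₀ ℕ)
    (a : DoubledVertex (CyclicVertex n) {⟨m⟩}) : bar m α (ofDoubled m a) = dblDim _ α a := by
  have hbar : ∀ j, bar m α j = if h : j.val.1 ≤ m.1 then α ⟨⟨j.val.1, h.trans_lt m.2⟩⟩
    else α ⟨⟨j.val.1 - 1, by have := j.val.2; omega⟩⟩ := fun _ => rfl
  have hα : ∀ {i j : CyclicVertex n}, i.val.1 = j.val.1 → α i = α j := fun h =>
    congrArg α (CyclicVertex.ext (Fin.ext h))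
  rw [hbar]
  cases a with
  | zero i =>
    have hi := val_ne i
    have h1 := ofDoubled_zero_val m i
    rw [dblDim_zero_apply]
    split_ifs at h1 ⊢ <;> exact hα (by dsimp only; omega)
  | one i =>
    have h1 := ofDoubled_one_val m i
    rw [dblDim_one_apply, dif_pos h1.le, eq_of_mem i]
    exact hα h1
  | two i =>
    have h1 := ofDoubled_two_val m i
    rw [dblDim_two_apply, dif_neg (by omega), eq_of_mem i]
    exact hα (by dsimp only; omega)

theorem nonempty_blockEquiv (k : Type w) [Field k] (hn : 2 ≤ n) (m : Fin n)
    (α : CyclicVertex n →₀ ℕ) : Nonempty (KLR.Block k α ≃ₐ[k] BalancedAlg k m α) := by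
  have hI : ∀ i ∈ ({⟨m⟩} : Set (CyclicVertex n)), ∀ j ∈ ({⟨m⟩} : Set (CyclicVertex n)),
      IsEmpty (i ⟶ j) := by
    rintro _ rfl _ rfl
    refine not_nonempty_iff.1 fun h => ?_
    have h1 := (nonempty_hom_iff _ _).1 h
    dsimp only at h1
    rw [succ_mod m.2] at h1
    split_ifs at h1 <;> omega
  obtain ⟨Φ, -⟩ := KLR.exists_doubledEquiv (α := α) k hI
  obtain ⟨Ψ⟩ := KLR.nonempty_balanced_equiv k (β := dblDim _ α) (β' := bar m α)
    (one := DoubledVertex.one) (two := DoubledVertex.two)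
    (one' := fun _ : Unit => (⟨m.castSucc⟩ : CyclicVertex (n + 1)))
    (two' := fun _ : Unit => (⟨m.succ⟩ : CyclicVertex (n + 1)))
    (Equiv.ofBijective (ofDoubled m) ⟨ofDoubled_injective m, ofDoubled_surjective m⟩)
    (arrowCount_ofDoubled hn m) (Equiv.ofUnique _ _) (fun _ => rfl) (fun _ => rfl)
    (bar_ofDoubled m α)
  exact ⟨Φ.trans Ψ⟩

end Cyclic

end CyclicVertex

theorem mainTheorem1 (k : Type w) [Field k] :
    (∀ (I : Type u) [Quiver.{v} I] (_ : ∀ i j : I, Finite (i ⟶ j))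
        (_ : ∀ i : I, IsEmpty (i ⟶ i)) (I₁ : Set I)
        (_ : ∀ i ∈ I₁, ∀ j ∈ I₁, IsEmpty (i ⟶ j)) (α : I →₀ ℕ),
      ∃ Φ : KLR.Block k α ≃ₐ[k] KLR.DoubledBalanced k I₁ α,
        (∀ i : KLR.seqs α, Φ (KLR.e k i) = KLR.cls k I₁ (KLR.e k (dblSeq I₁ i))) ∧
        (∀ (r : Fin α.degree) (i : KLR.seqs α),
          Φ (KLR.x k (KLR.seqs α) r * KLR.e k i) = KLR.cls k I₁ (KLR.xStarAt k I₁ r i)) ∧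
        (∀ (r : Fin (α.degree - 1)) (i : KLR.seqs α),
          Φ (KLR.tau k (KLR.seqs α) r * KLR.e k i) = KLR.cls k I₁ (KLR.tauStarAt k I₁ r i)) ∧
        (∀ r : Fin α.degree, Φ (KLR.x k (KLR.seqs α) r) = KLR.xStar k I₁ r) ∧
        (∀ r : Fin (α.degree - 1), Φ (KLR.tau k (KLR.seqs α) r) = KLR.tauStar k I₁ r)) ∧
    (∀ (n : ℕ) (_ : 2 ≤ n) (m : Fin n) (α : CyclicVertex n →₀ ℕ),
      Nonempty (KLR.Block k α ≃ₐ[k] CyclicVertex.BalancedAlg k m α) ∧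
        IsSubquotientAlgebra k (KLR.Block k α) (KLR.Block k (CyclicVertex.bar m α))) := by
  refine ⟨fun I _ _ _ I₁ hI α => ?_, fun n hn m α => ?_⟩
  · obtain ⟨Φ, he, hx, ht⟩ := KLR.exists_doubledEquiv (α := α) k hI
    refine ⟨Φ, he, hx, ht, fun r => ?_, fun r => ?_⟩
    · rw [KLR.eq_sum_mul_e k (KLR.x k _ r), map_sum]
      exact Finset.sum_congr rfl fun i _ => hx r i
    · rw [KLR.eq_sum_mul_e k (KLR.tau k _ r), map_sum]
      exact Finset.sum_congr rfl fun i _ => ht r i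
  · obtain ⟨Φ⟩ := CyclicVertex.nonempty_blockEquiv k hn m α
    exact ⟨⟨Φ⟩, KLR.isSubquotientAlgebra_of_balanced Φ⟩
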